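/- **Setting.** Let $s, L, \sigma > 0$. For every $n$ one observes $(X_i, Y_i)_{1 \le i \le n}$ with $Y_i = f(X_i) + \sigma \xi_i$, where the $X_i$ are i.i.d. with density $\mu$ on $[0,1]$ and the $\xi_i$ are i.i.d. standard Gaussian, independent of the $X_i$; $\mathbf E_{f\mu}$ is the corresponding expectation. Let $F = H(s,L)$ be the set of functions $f : [0,1] \to \mathbb R$ whose derivative of order $r$, $r$ being the largest integer strictly smaller than $s$, exists and satisfies $|f^{(r)}(x) - f^{(r)}(y)| \le L |x-y|^{s-r}$ for all $x, y \in [0,1]$. A loss function is a non-negative non-decreasing $w$ on $[0,\infty)$ with $w(0) = 0$, $w(x) \to 0$ as $x \to 0^+$, and $w(x) \le A(1+x^b)$ for some $A, b > 0$. Write $\mu(I) = \int_{I \cap [0,1]} \mu(t)\,dt$. For $n \ge 2$ and $x \in [0,1]$ let $h_n(x)$ be the unique $h > 0$ with $$L h^s = \sigma \Big( \frac{\log n}{n\, \mu([x-h, x+h])} \Big)^{1/2},$$ and $r_n(x) = L h_n(x)^s$. Let $(\ell_n)$ be a positive sequence with $\log \ell_n = o(\log n)$, and assume that $\mu$ is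 bounded on $[0,1]$. **(a)** Let $\mu$ be bounded away from zero on $[0,1]$ (for instance continuous and positive everywhere). Then there are $c, C > 0$ with $c (\log n/n)^{s/(2s+1)} \le r_n(x) \le C (\log n/n)^{s/(2s+1)}$ for all $n$ large enough and all $x \in [0,1]$, and there is $c > 0$ with $\mu(I) \ge c |I|$ for every interval $I \subset [0,1]$. If $I_n \subset [0,1]$ are intervals with $|I_n| \sim (\ell_n/n)^{1/(1+2s)}$, there is a sequence of estimators $\widehat f_n$ such that, for every loss function $w$, $$\sup_{f \in F} \mathbf E_{f\mu} \Big[ w \Big( \Big( \frac{n}{\log n} \Big)^{s/(2s+1)} \sup_{x \in I_n} |\widehat f_n(x) - f(x)| \Big) \Big] = o(1).$$ **(b)** Let $x_0 \in [0,1]$ with $\mu(x_0) = 0$, and let $\beta \ge 0$ be such that $\mu([x_0-h, x_0+h]) = h^{\beta+1}$ for all small $h > 0$. Assume also that, for some $c > 0$, $\mu(y) \ge c |y - x_0|^\beta$ for all $y \in [0,1]$, $y \ne x_0$, in a neighbourhood of $x_0$. If $$I_n = [x_0 - (\ell_n/n)^{1/(1+2s+\beta)},\ x_0 + (\ell_n/n)^{1/(1+2s+\beta)}]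 \cap [0,1],$$ there is a sequence of estimators $\widehat f_n$ such that, for every loss function $w$, $$\sup_{f \in F} \mathbf E_{f\mu} \Big[ w \Big( \sup_{x \in I_n} r_n(x)^{-1} |\widehat f_n(x) - f(x)| \Big) \Big] = o(1).$$ -/

import Mathlib

open MeasureTheory ProbabilityTheory Filter Topology Set Asymptotics
open scoped ENNReal NNReal

noncomputable section

/-- The largest integer strictly smaller than `s`, for `s > 0`. -/
def strictFloor (s : ℝ) : ℕ := ⌈s⌉₊ - 1

/-- The Hölder class `H(s, L)` on `[0, 1]`: the derivative of order `strictFloor s` exists on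
`[0, 1]` and is Hölder continuous of exponent `s - strictFloor s` with constant `L`. Functions are
represented by functions on the line, of which only the values on `[0, 1]` matter. -/
def holderClass (s L : ℝ) : Set (ℝ → ℝ) :=
  {f | ContDiffOn ℝ (strictFloor s) f (Icc 0 1) ∧
    ∀ x ∈ Icc (0 : ℝ) 1, ∀ y ∈ Icc (0 : ℝ) 1,
      |iteratedDerivWithin (strictFloor s) f (Icc 0 1) x
        - iteratedDerivWithin (strictFloor s) f (Icc 0 1) y|
        ≤ L * |x - y| ^ (s - (strictFloor s : ℝ))}

/-- `μ` is a probability density on `[0, 1]`. -/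
structure IsDesignDensity (μ : ℝ → ℝ) : Prop where
  measurable : Measurable μ
  nonneg : ∀ x ∈ Icc (0 : ℝ) 1, 0 ≤ μ x
  lintegral_eq_one : ∫⁻ x in Icc (0 : ℝ) 1, ENNReal.ofReal (μ x) = 1

/-- The law on the line with density `μ` on `[0, 1]` (and no mass outside `[0, 1]`);
`(designLaw μ).real I` is `μ(I) = ∫_I μ(t) dt`. -/
def designLaw (μ : ℝ → ℝ) : Measure ℝ :=
  (volume.restrict (Icc 0 1)).withDensity fun x => ENNReal.ofReal (μ x)

/-- The joint law of the independent pairs `(X_i, ξ_i)`, `i < n`, where `X_i` has density `μ` and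
`ξ_i` is standard Gaussian and independent of `X_i`. -/
def sampleLaw (μ : ℝ → ℝ) (n : ℕ) : Measure (Fin n → ℝ × ℝ) :=
  Measure.pi fun _ => (designLaw μ).prod (gaussianReal 0 1)

/-- The observations `(X_i, Y_i)` with `Y_i = f(X_i) + σ ξ_i`. -/
def observations (f : ℝ → ℝ) (σ : ℝ) {n : ℕ} (ω : Fin n → ℝ × ℝ) : Fin n → ℝ × ℝ :=
  fun i => ((ω i).1, f (ω i).1 + σ * (ω i).2)

/-- A sequence of estimators: for every `n`, a jointly measurable function of the `n` observations
and of the point at which the regression function is estimated. -/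
structure Estimator where
  toFun : (n : ℕ) → (Fin n → ℝ × ℝ) → ℝ → ℝ
  measurable : ∀ n, Measurable fun p : (Fin n → ℝ × ℝ) × ℝ => toFun n p.1 p.2

/-- Loss functions on `[0, ∞)`: non-negative, non-decreasing, of at most polynomial growth, zero
at zero, and continuous at zero. -/
structure IsLoss (w : ℝ → ℝ) : Prop where
  nonneg : ∀ x, 0 ≤ x → 0 ≤ w x
  mono : MonotoneOn w (Ici 0)
  zero : w 0 = 0
  growth : ∃ A b : ℝ, 0 < A ∧ 0 < b ∧ ∀ x, 0 ≤ x → w x ≤ A * (1 + x ^ b)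
  tendsto_zero : Tendsto w (𝓝[>] 0) (𝓝 0)

/-- The extension of a non-decreasing loss function to `[0, ∞]`, with value `sup w` at `∞`. -/
def lossExt (w : ℝ → ℝ) (z : ℝ≥0∞) : ℝ≥0∞ :=
  ⨆ (t : ℝ≥0) (_ : (t : ℝ≥0∞) ≤ z), ENNReal.ofReal (w t)

theorem lossExt_coe {w : ℝ → ℝ} (hw : MonotoneOn w (Ici 0)) (t : ℝ≥0) :
    lossExt w t = ENNReal.ofReal (w t) := by
  refine le_antisymm (iSup₂_le fun u hu => ENNReal.ofReal_le_ofReal ?_)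
    (le_iSup₂_of_le t le_rfl le_rfl)
  exact hw u.2 t.2 (by exact_mod_cast hu)

/-- The maximal risk over `H(s, L)`, localized on `I` and weighted by `v`:
`sup_{f ∈ H(s, L)} E_{f μ} [ w ( sup_{x ∈ I} v(x) |f_n(x) - f(x)| ) ]`, with values in `[0, ∞]`. -/
def maxRisk (s L σ : ℝ) (μ w : ℝ → ℝ) (F : Estimator) (n : ℕ) (I : Set ℝ) (v : ℝ → ℝ) : ℝ≥0∞ :=
  ⨆ f ∈ holderClass s L,
    ∫⁻ ω, lossExt w
      (⨆ x ∈ I, ENNReal.ofReal (v x * |F.toFun n (observations f σ ω) x - f x|)) ∂(sampleLaw μ n)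

/-- The positive solutions `h` of `L h ^ s = σ (log n / (n μ([x - h, x + h]))) ^ (1/2)`. (If
`μ([x - h, x + h]) = 0` the right-hand side is read as `0` and `h` is not a solution.) -/
def bandwidthSet (s L σ : ℝ) (μ : ℝ → ℝ) (n : ℕ) (x : ℝ) : Set ℝ :=
  {h | 0 < h ∧
    L * h ^ s = σ * √(Real.log n / (n * (designLaw μ).real (Icc (x - h) (x + h))))}

/-- The bandwidth `h_n(x)`: the unique element of `bandwidthSet` (see
`existsUnique_bandwidth`). -/
def bandwidth (s L σ : ℝ) (μ : ℝ → ℝ) (n : ℕ) (x : ℝ) : ℝ :=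
  sInf (bandwidthSet s L σ μ n x)

/-- The rate `r_n(x) = L h_n(x) ^ s`. -/
def rate (s L σ : ℝ) (μ : ℝ → ℝ) (n : ℕ) (x : ℝ) : ℝ :=
  L * bandwidth s L σ μ n x ^ s

theorem isProbabilityMeasure_designLaw {μ : ℝ → ℝ} (hμ : IsDesignDensity μ) :
    IsProbabilityMeasure (designLaw μ) := by
  refine ⟨?_⟩
  rw [designLaw, withDensity_apply _ MeasurableSet.univ, Measure.restrict_univ]
  exact hμ.lintegral_eq_one

theorem continuousOn_designLaw_ball {μ : ℝ → ℝ} (hμ : IsDesignDensity μ) (x : ℝ) :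
    ContinuousOn (fun h => (designLaw μ).real (Icc (x - h) (x + h))) (Ici 0) := by
  have := isProbabilityMeasure_designLaw hμ
  have hac : designLaw μ ≪ volume :=
    (withDensity_absolutelyContinuous _ _).trans Measure.absolutelyContinuous_restrict
  have : NullSingletonClass (designLaw μ) := ⟨fun y => hac (measure_singleton y)⟩
  have hint : Integrable (fun _ : ℝ => (1 : ℝ)) (designLaw μ) := integrable_const 1
  have hP := hint.continuous_primitive 0
  have hc : Continuous fun h : ℝ => (∫ _ in (0 : ℝ)..(x + h), (1 : ℝ) ∂(designLaw μ))
      - ∫ _ in (0 : ℝ)..(x - h), (1 : ℝ) ∂(designLaw μ) :=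
    (hP.comp (continuous_const.add continuous_id)).sub
      (hP.comp (continuous_const.sub continuous_id))
  refine hc.continuousOn.congr fun h hh => ?_
  have hh' : (0 : ℝ) ≤ h := hh
  beta_reduce
  rw [intervalIntegral.integral_interval_sub_left hint.intervalIntegrable
    hint.intervalIntegrable, intervalIntegral.integral_of_le (by linarith)]
  simp [measureReal_def, measure_congr (Ioc_ae_eq_Icc (μ := designLaw μ))]

/-- The defining equation of the bandwidth has exactly one positive solution for `n ≥ 2`. -/
theorem existsUnique_bandwidth {s L σ : ℝ} (hs : 0 < s) (hL : 0 < L) (hσ : 0 < σ) {μ : ℝ → ℝ}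
    (hμ : IsDesignDensity μ) {n : ℕ} (hn : 2 ≤ n) {x : ℝ} (hx : x ∈ Icc (0 : ℝ) 1) :
    ∃! h, h ∈ bandwidthSet s L σ μ n x := by
  have := isProbabilityMeasure_designLaw hμ
  set m : ℝ → ℝ := fun h => (designLaw μ).real (Icc (x - h) (x + h)) with hm
  have hn' : (0 : ℝ) < n := by positivity
  have hlog : 0 < Real.log n := Real.log_pos (by exact_mod_cast hn)
  set K : ℝ := σ ^ 2 * (Real.log n / n) with hK
  have hK0 : 0 < K := by positivity
  have mono : ∀ a b, a ≤ b → m a ≤ m b := fun a b hab =>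
    measureReal_mono (Icc_subset_Icc (by linarith) (by linarith))
  have m0 : ∀ h, 0 ≤ m h := fun h => measureReal_nonneg
  have hm1 : ∀ h, 1 ≤ h → m h = 1 := by
    intro h hh
    have h0 : designLaw μ (Icc (x - h) (x + h))ᶜ = 0 := by
      rw [designLaw, withDensity_apply _ measurableSet_Icc.compl,
        Measure.restrict_restrict measurableSet_Icc.compl]
      have : (Icc (x - h) (x + h))ᶜ ∩ Icc (0 : ℝ) 1 = ∅ := by
        ext y
        simp only [mem_inter_iff, mem_compl_iff, mem_Icc, mem_empty_iff_false, iff_false] at hx ⊢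
        rintro ⟨h1, h2⟩
        exact h1 ⟨by linarith, by linarith⟩
      simp [this]
    have := prob_compl_eq_zero_iff (μ := designLaw μ) (measurableSet_Icc (a := x - h) (b := x + h))
    simp [hm, measureReal_def, this.1 h0]
  -- the equation in multiplicative form
  have key : ∀ h, h ∈ bandwidthSet s L σ μ n x ↔ 0 < h ∧ (L * h ^ s) ^ 2 * m h = K := by
    intro h
    refine and_congr_right fun hh => ?_
    change L * h ^ s = σ * √(Real.log n / (n * m h)) ↔ _
    have hp : 0 < L * h ^ s := by positivity
    rcases (m0 h).eq_or_lt with h0 | h0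
    · rw [← h0]
      simp [hp.ne', hK0.ne]
    · have hq : 0 ≤ Real.log n / (n * m h) := by positivity
      rw [← sq_eq_sq₀ hp.le (by positivity), mul_pow σ, Real.sq_sqrt hq, ← div_div,
        ← mul_div_assoc, eq_div_iff h0.ne']
  have hcont : ContinuousOn (fun h => (L * h ^ s) ^ 2 * m h) (Ici 0) :=
    ((continuousOn_const.mul (continuousOn_id.rpow_const fun _ _ => Or.inr hs.le)).pow 2).mul
      (continuousOn_designLaw_ball hμ x)
  set T : ℝ := max 1 ((√K / L) ^ s⁻¹) with hT
  have hT1 : 1 ≤ T := le_max_left _ _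
  have hTK : K ≤ (L * T ^ s) ^ 2 * m T := by
    rw [hm1 T hT1, mul_one]
    have h1 : √K / L ≤ T ^ s := by
      have := Real.rpow_le_rpow (by positivity) (le_max_right 1 ((√K / L) ^ s⁻¹)) hs.le
      rwa [← Real.rpow_mul (by positivity), inv_mul_cancel₀ hs.ne', Real.rpow_one] at this
    have h2 : √K ≤ L * T ^ s := by rwa [div_le_iff₀' hL] at h1
    calc K = √K ^ 2 := (Real.sq_sqrt hK0.le).symm
      _ ≤ _ := by gcongr
  obtain ⟨h, hh, hhK⟩ := intermediate_value_Icc (by linarith : (0 : ℝ) ≤ T)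
    (hcont.mono Icc_subset_Ici_self)
    (show K ∈ Icc _ _ from ⟨by simp [Real.zero_rpow hs.ne', hK0.le], hTK⟩)
  have hhK' : (L * h ^ s) ^ 2 * m h = K := hhK
  have hpos : 0 < h := by
    rcases hh.1.eq_or_lt with h0 | h0
    · rw [← h0, Real.zero_rpow hs.ne'] at hhK'
      simp [hK0.ne] at hhK'
    · exact h0
  have strict : ∀ a b, 0 < a → a < b → (L * a ^ s) ^ 2 * m a = K →
      (L * b ^ s) ^ 2 * m b ≠ K := by
    intro a b ha hab hea heb
    have hma : 0 < m a := by
      rcases (m0 a).eq_or_lt with h0 | h0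
      · rw [← h0] at hea
        simp [hK0.ne] at hea
      · exact h0
    have h1 : a ^ s < b ^ s := Real.rpow_lt_rpow ha.le hab hs
    have h2 : (L * a ^ s) ^ 2 < (L * b ^ s) ^ 2 := by gcongr
    have h3 := mono a b hab.le
    nlinarith [mul_lt_mul_of_pos_right h2 hma, mul_le_mul_of_nonneg_left h3 (sq_nonneg (L * b ^ s))]
  refine ⟨h, (key h).2 ⟨hpos, hhK'⟩, fun y hy => ?_⟩
  obtain ⟨hy0, hyK⟩ := (key y).1 hy
  rcases lt_trichotomy y h with hlt | heq | hgt
  · exact absurd hhK' (strict y h hy0 hlt hyK)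
  · exact heq
  · exact absurd hyK (strict h y hpos hgt hhK')

theorem bandwidth_mem {s L σ : ℝ} (hs : 0 < s) (hL : 0 < L) (hσ : 0 < σ) {μ : ℝ → ℝ}
    (hμ : IsDesignDensity μ) {n : ℕ} (hn : 2 ≤ n) {x : ℝ} (hx : x ∈ Icc (0 : ℝ) 1) :
    bandwidth s L σ μ n x ∈ bandwidthSet s L σ μ n x := by
  obtain ⟨h, hh, hu⟩ := existsUnique_bandwidth hs hL hσ hμ hn hx
  have : bandwidthSet s L σ μ n x = {h} :=
    Set.eq_singleton_iff_unique_mem.2 ⟨hh, hu⟩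
  rw [bandwidth, this, csInf_singleton]
  exact mem_singleton h

end

/-!
The estimator averages, over tuples of `r + 1` observations, the polynomial of degree at most `r`
that interpolates them, where `r` is the largest integer smaller than `s`. The interval is cut into
cells, and on each cell only the tuples with one observation in each of `r + 1` separated subbins of
a window are used, so that the Lagrange cardinal functions are bounded. Such averages reproduce
polynomials (`tupEst_poly`); hence the error is a bias of the order of `h ^ s` for a window of
length `h`, plus an averaged noise whose variance is of the order of the inverse of the number of
observations in a subbin (`sum_sq_tupEst_single_le`).

The usual logarithmic loss of the uniform error comes from a number of cells that is a power of `n`.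
Here the intervals exceed the bandwidth only by a subpolynomial factor, so there are
`exp (o(log n))` cells, and the maximum of the noise over them costs only `o(log n)` in the
variance. There is thus room for windows that are shorter than the bandwidth by a factor `δ → 0`:
both the bias, by `δ ^ s`, and the noise become negligible with respect to the rate
(`exists_lintegral_regular_le`, `exists_estimator_of_bandwidth`). The density enters only through
the bandwidth and a lower bound `δ ^ γ` for the share of mass in a subinterval of relative length
`δ`. This holds with `γ = 1` if the density is bounded away from zero, and with `γ = β + 1` near a
zero of order `β` (`exists_mul_rpow_mul_ballMass_le`).

The loss may grow like any power, so all moments of the error must vanish, also on the event that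
some subbin is nearly empty. By Chernoff's bound this event has a probability smaller than every
power of `n`. When a subbin is empty, the estimator switches to tuples weighted by the squared
Vandermonde determinant, which tames the cardinal functions; the error is then at most a power of
`n` times the noise and the inverse of the sum of the weights, and that sum has negative moments of
all orders because the density is bounded (`exists_lintegral_inv_sum_vandWeight_le`).
-/

/-! ### Lagrange interpolation averaged over tuples of observations -/

/-- The `j`-th Lagrange cardinal function of the nodes `z`, evaluated at `x`. -/
noncomputable def lagr {r : ℕ} (z : Fin (r + 1) → ℝ) (j : Fin (r + 1)) (x : ℝ) : ℝ :=
  ∏ a ∈ Finset.univ.erase j, (x - z a) / (z j - z a)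

theorem lagr_eq_eval_basis {r : ℕ} (z : Fin (r + 1) → ℝ) (j : Fin (r + 1)) (x : ℝ) :
    lagr z j x = (Lagrange.basis Finset.univ z j).eval x := by
  simp only [lagr, Lagrange.basis, Lagrange.basisDivisor, Polynomial.eval_prod,
    Polynomial.eval_mul, Polynomial.eval_C, Polynomial.eval_sub, Polynomial.eval_X]
  exact Finset.prod_congr rfl fun a _ => by rw [div_eq_inv_mul]

theorem sum_eval_mul_lagr {r : ℕ} {z : Fin (r + 1) → ℝ} (hz : Function.Injective z)
    {P : Polynomial ℝ} (hP : P.natDegree ≤ r) (x : ℝ) :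
    ∑ j, P.eval (z j) * lagr z j x = P.eval x := by
  have h := Lagrange.eq_interpolate (s := Finset.univ) (v := z) (f := P) hz.injOn (by
    rw [Finset.card_univ, Fintype.card_fin]
    exact (Polynomial.degree_le_of_natDegree_le hP).trans_lt (by exact_mod_cast Nat.lt_succ_self r))
  conv_rhs => rw [h]
  simp [Lagrange.interpolate_apply, Polynomial.eval_finsetSum, lagr_eq_eval_basis]

/-- Interpolation of a cardinal function of other nodes. -/
theorem lagr_eq_sum_lagr {r : ℕ} {z : Fin (r + 1) → ℝ} (hz : Function.Injective z)
    (w : Fin (r + 1) → ℝ) (j : Fin (r + 1)) (x : ℝ) :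
    lagr w j x = ∑ l, lagr w j (z l) * lagr z l x := by
  have hdeg : (Lagrange.basis Finset.univ w j).natDegree ≤ r := by
    refine (Polynomial.natDegree_prod_le _ _).trans ?_
    refine (Finset.sum_le_card_nsmul _ _ 1 fun a _ => ?_).trans (by simp)
    exact (Polynomial.natDegree_C_mul_le _ _).trans (Polynomial.natDegree_X_sub_C _).le
  simp only [lagr_eq_eval_basis w, sum_eval_mul_lagr hz hdeg]

theorem abs_lagr_le {r : ℕ} {z : Fin (r + 1) → ℝ} {j : Fin (r + 1)} {x g G : ℝ} (hg : 0 < g)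
    (hsep : ∀ a, a ≠ j → g ≤ |z j - z a|) (hx : ∀ a, |x - z a| ≤ G) :
    |lagr z j x| ≤ (G / g) ^ r := by
  rw [lagr, Finset.abs_prod]
  refine (Finset.prod_le_prod (fun _ _ => abs_nonneg _) (g := fun _ => G / g)
    fun a ha => ?_).trans (by simp [div_pow])
  rw [abs_div]
  have := hsep a (Finset.ne_of_mem_erase ha)
  have h2 := hx a
  have : 0 ≤ G := (abs_nonneg _).trans h2
  gcongr

/-- The average, with weights `φ`, of the polynomials interpolating the points
`(X (t j), Y (t j))`, over all tuples `t` of `r + 1` indices, evaluated at `x`. -/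
noncomputable def tupEst {r n : ℕ} (φ : (Fin (r + 1) → Fin n) → ℝ) (X Y : Fin n → ℝ) (x : ℝ) : ℝ :=
  (∑ t, φ t * ∑ j, lagr (X ∘ t) j x * Y (t j)) / ∑ t, φ t

section tupEst

variable {r n : ℕ} {φ : (Fin (r + 1) → Fin n) → ℝ} {X : Fin n → ℝ}

theorem tupEst_add (U V : Fin n → ℝ) (c x : ℝ) :
    tupEst φ X (fun i => U i + c * V i) x = tupEst φ X U x + c * tupEst φ X V x := by
  simp only [tupEst, ← mul_div_assoc, ← add_div]
  congr 1
  rw [Finset.mul_sum, ← Finset.sum_add_distrib]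
  refine Finset.sum_congr rfl fun t _ => ?_
  rw [← mul_assoc, mul_comm c, mul_assoc, ← mul_add]
  congr 1
  rw [Finset.mul_sum, ← Finset.sum_add_distrib]
  exact Finset.sum_congr rfl fun j _ => by ring

/-- Averages of interpolating polynomials reproduce polynomials of degree at most `r`. -/
theorem tupEst_poly (hinj : ∀ t, φ t ≠ 0 → Function.Injective (X ∘ t)) (hφ : ∑ t, φ t ≠ 0)
    {P : Polynomial ℝ} (hP : P.natDegree ≤ r) (x : ℝ) :
    tupEst φ X (fun i => P.eval (X i)) x = P.eval x := by
  rw [tupEst, div_eq_iff hφ, Finset.mul_sum]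
  refine Finset.sum_congr rfl fun t _ => ?_
  by_cases h : φ t = 0
  · simp [h]
  · rw [← sum_eval_mul_lagr (hinj t h) hP x, mul_comm]
    simp [mul_comm]

theorem abs_tupEst_le_sum (hφ : ∀ t, 0 ≤ φ t) (U : Fin n → ℝ) (x : ℝ) :
    |tupEst φ X U x| ≤ (∑ t, ∑ j, φ t * |lagr (X ∘ t) j x| * |U (t j)|) / ∑ t, φ t := by
  rw [tupEst, abs_div, abs_of_nonneg (Finset.sum_nonneg fun t _ => hφ t)]
  refine div_le_div_of_nonneg_right ?_ (Finset.sum_nonneg fun t _ => hφ t)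
  refine (Finset.abs_sum_le_sum_abs _ _).trans (Finset.sum_le_sum fun t _ => ?_)
  rw [abs_mul, abs_of_nonneg (hφ t)]
  refine (mul_le_mul_of_nonneg_left (Finset.abs_sum_le_sum_abs _ _) (hφ t)).trans ?_
  rw [Finset.mul_sum]
  exact Finset.sum_le_sum fun j _ => by rw [abs_mul, mul_assoc]

theorem abs_tupEst_le (hφ : ∀ t, 0 ≤ φ t) {U : Fin n → ℝ} {x D b : ℝ}
    (hS : 0 < ∑ t, φ t) (hD : ∀ t, φ t ≠ 0 → ∀ j, |lagr (X ∘ t) j x| ≤ D)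
    (hU : ∀ t, φ t ≠ 0 → ∀ j, |U (t j)| ≤ b) :
    |tupEst φ X U x| ≤ (r + 1) * (D * b) := by
  refine (abs_tupEst_le_sum hφ U x).trans ?_
  rw [div_le_iff₀ hS, Finset.mul_sum]
  refine Finset.sum_le_sum fun t _ => ?_
  by_cases h : φ t = 0
  · simp [h]
  · refine (Finset.sum_le_card_nsmul _ _ (φ t * (D * b)) fun j _ => ?_).trans ?_
    · rw [mul_assoc]
      have h1 := hD t h j
      have h2 := hU t h j
      have := (abs_nonneg _).trans h1
      have := hφ t
      gcongr
    · simp only [Finset.card_univ, Fintype.card_fin, nsmul_eq_mul]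
      push_cast
      exact le_of_eq (by ring)

/-- The error bound for weights that tame the Lagrange cardinal functions. -/
theorem abs_tupEst_le_of_mul_le_one (hφ : ∀ t, 0 ≤ φ t) {U : Fin n → ℝ} {x b : ℝ}
    (hl : ∀ t j, φ t * |lagr (X ∘ t) j x| ≤ 1) (hU : ∀ i, |U i| ≤ b) :
    |tupEst φ X U x| ≤ (r + 1) * (n ^ (r + 1) / (∑ t, φ t) * b) := by
  refine (abs_tupEst_le_sum hφ U x).trans ?_
  have hS : 0 ≤ ∑ t, φ t := Finset.sum_nonneg fun t _ => hφ t
  have : ∑ t : Fin (r + 1) → Fin n, ∑ j, φ t * |lagr (X ∘ t) j x| * |U (t j)|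
      ≤ (n ^ (r + 1)) * ((r + 1) * b) := by
    refine (Finset.sum_le_card_nsmul _ _ ((r + 1) * b) fun t _ => ?_).trans ?_
    · refine (Finset.sum_le_card_nsmul _ _ b fun j _ => ?_).trans ?_
      · exact (mul_le_mul (hl t j) (hU _) (abs_nonneg _) zero_le_one).trans (by simp)
      · simp
    · simp
  calc _ ≤ (n ^ (r + 1) : ℝ) * ((r + 1) * b) / ∑ t, φ t := by gcongr
    _ = _ := by ring

/-- The values of the averaged polynomial are determined by its values at `r + 1` nodes. -/
theorem tupEst_eq_sum_nodes {z : Fin (r + 1) → ℝ} (hz : Function.Injective z) (U : Fin n → ℝ)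
    (x : ℝ) : tupEst φ X U x = ∑ l, lagr z l x * tupEst φ X U (z l) := by
  simp only [tupEst, ← mul_div_assoc, ← Finset.sum_div, Finset.mul_sum]
  congr 1
  conv_rhs => rw [Finset.sum_comm]
  refine Finset.sum_congr rfl fun t _ => ?_
  conv_rhs => rw [Finset.sum_comm]
  refine Finset.sum_congr rfl fun j _ => ?_
  rw [lagr_eq_sum_lagr hz, Finset.sum_mul, Finset.mul_sum]
  exact Finset.sum_congr rfl fun l _ => by ring

theorem tupEst_eq_sum_single (U : Fin n → ℝ) (x : ℝ) :
    tupEst φ X U x = ∑ i, tupEst φ X (Pi.single i 1) x * U i := by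
  simp only [tupEst, div_mul_eq_mul_div, ← Finset.sum_div, Finset.sum_mul]
  congr 1
  rw [Finset.sum_comm]
  refine Finset.sum_congr rfl fun t _ => ?_
  simp only [mul_assoc, ← Finset.mul_sum, Finset.sum_mul]
  congr 1
  rw [Finset.sum_comm]
  refine Finset.sum_congr rfl fun j _ => ?_
  simp [Pi.single_apply]

end tupEst

/-! ### The two families of weights -/

/-- The `j`-th of `r + 1` equally long and equally spaced subintervals of `[a, a + h]`. -/
def subbin (r : ℕ) (a h : ℝ) (j : Fin (r + 1)) : Set ℝ :=
  Icc (a + 2 * j * (h / (2 * r + 1))) (a + (2 * j + 1) * (h / (2 * r + 1)))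

theorem measurableSet_subbin (r : ℕ) (a h : ℝ) (j : Fin (r + 1)) :
    MeasurableSet (subbin r a h j) := measurableSet_Icc

theorem subbin_subset {r : ℕ} {a h : ℝ} (hh : 0 ≤ h) (j : Fin (r + 1)) :
    subbin r a h j ⊆ Icc a (a + h) := by
  have hj : (j : ℝ) ≤ r := by exact_mod_cast Nat.lt_succ_iff.1 j.2
  have hr : (0 : ℝ) < 2 * r + 1 := by positivity
  have h0 : 0 ≤ h / (2 * r + 1) := by positivity
  refine Icc_subset_Icc ?_ ?_
  · have : 0 ≤ 2 * (j : ℝ) * (h / (2 * r + 1)) := by positivity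
    linarith
  · have : (2 * (j : ℝ) + 1) * (h / (2 * r + 1)) ≤ (2 * r + 1) * (h / (2 * r + 1)) := by gcongr
    rw [mul_div_cancel₀ _ hr.ne'] at this
    linarith

theorem le_abs_sub_of_mem_subbin {r : ℕ} {a h : ℝ} (hh : 0 ≤ h) {j k : Fin (r + 1)} (hjk : j ≠ k)
    {x y : ℝ} (hx : x ∈ subbin r a h j) (hy : y ∈ subbin r a h k) :
    h / (2 * r + 1) ≤ |x - y| := by
  wlog hlt : k < j generalizing j k x y
  · rw [abs_sub_comm]
    exact this hjk.symm hy hx (lt_of_le_of_ne (not_lt.1 hlt) hjk)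
  have h0 : 0 ≤ h / (2 * r + 1) := by positivity
  have hkj : (k : ℝ) + 1 ≤ j := by exact_mod_cast hlt
  refine le_trans ?_ (le_abs_self _)
  have := mul_le_mul_of_nonneg_right hkj h0
  have h1 := hx.1
  have h2 := hy.2
  nlinarith

/-- The product weights that select the tuples having one observation in each subinterval. -/
noncomputable def boxWeight {r n : ℕ} (a h : ℝ) (X : Fin n → ℝ) (t : Fin (r + 1) → Fin n) : ℝ :=
  ∏ j, (subbin r a h j).indicator 1 (X (t j))

/-- The number of observations in the set `B`. -/
noncomputable def binCount {n : ℕ} (B : Set ℝ) (X : Fin n → ℝ) : ℝ := ∑ i, B.indicator 1 (X i)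

/-- The squared Vandermonde determinant of a tuple of observations. It vanishes on the tuples whose
interpolation problem is degenerate, and cancels the denominators of the Lagrange cardinal
functions. -/
noncomputable def vandWeight {r n : ℕ} (X : Fin n → ℝ) (t : Fin (r + 1) → Fin n) : ℝ :=
  ∏ a, ∏ b ∈ Finset.univ.erase a, |X (t a) - X (t b)|

section weights

variable {r n : ℕ} {X : Fin n → ℝ} {a h : ℝ}

theorem boxWeight_nonneg (t : Fin (r + 1) → Fin n) : 0 ≤ boxWeight a h X t :=
  Finset.prod_nonneg fun _ _ => Set.indicator_nonneg (fun _ _ => zero_le_one) _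

theorem mem_subbin_of_boxWeight_ne_zero {t : Fin (r + 1) → Fin n} (ht : boxWeight a h X t ≠ 0)
    (j : Fin (r + 1)) : X (t j) ∈ subbin r a h j := by
  by_contra hj
  exact ht (Finset.prod_eq_zero (Finset.mem_univ j) (Set.indicator_of_notMem hj _))

theorem sum_boxWeight : ∑ t : Fin (r + 1) → Fin n, boxWeight a h X t
    = ∏ j, binCount (subbin r a h j) X := by
  simp only [boxWeight, binCount]
  rw [Finset.prod_univ_sum, Fintype.piFinset_univ]

/-- The share of the tuples of a box that have a given observation at a given place. -/
theorem sum_boxWeight_fiber_le (j : Fin (r + 1)) (i : Fin n)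
    (hN : ∀ j, 0 < binCount (subbin r a h j) X) :
    (∑ t : Fin (r + 1) → Fin n, boxWeight a h X t * if t j = i then 1 else 0)
      ≤ (∑ t : Fin (r + 1) → Fin n, boxWeight a h X t) / binCount (subbin r a h j) X := by
  classical
  have h1 : ∀ t : Fin (r + 1) → Fin n, (boxWeight a h X t * if t j = i then 1 else 0)
      = ∏ l, ((subbin r a h l).indicator 1 (X (t l)) * if l = j ∧ t l ≠ i then 0 else 1) := by
    intro t
    rw [Finset.prod_mul_distrib, boxWeight]
    congr 1
    rw [Finset.prod_eq_single j]
    · by_cases h : t j = i <;> simp [h]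
    · intro l _ hl
      simp [hl]
    · simp
  rw [Finset.sum_congr rfl fun t _ => h1 t, ← Fintype.piFinset_univ, ← Finset.prod_univ_sum
    (fun _ => Finset.univ) (fun l k => (subbin r a h l).indicator 1 (X k)
      * if l = j ∧ k ≠ i then (0 : ℝ) else 1), Fintype.piFinset_univ, sum_boxWeight,
    ← Finset.mul_prod_erase _ _ (Finset.mem_univ j), ← Finset.mul_prod_erase _ (fun j =>
      binCount (subbin r a h j) X) (Finset.mem_univ j), mul_div_assoc, mul_comm (binCount _ _),
    div_mul_cancel₀ _ (hN j).ne']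
  have h2 : ∏ l ∈ Finset.univ.erase j, ∑ k : Fin n, (subbin r a h l).indicator 1 (X k)
      * (if l = j ∧ k ≠ i then (0 : ℝ) else 1)
      = ∏ l ∈ Finset.univ.erase j, binCount (subbin r a h l) X := by
    refine Finset.prod_congr rfl fun l hl => ?_
    simp [Finset.ne_of_mem_erase hl, binCount]
  rw [h2]
  refine mul_le_of_le_one_left (Finset.prod_nonneg fun l _ => (hN l).le) ?_
  rw [Finset.sum_eq_single i]
  · simp only [ne_eq, not_true_eq_false, and_false, if_false, mul_one]
    exact Set.indicator_le_self' (fun _ _ => zero_le_one) _ |>.trans_eq rfl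
  · intro k _ hk
    simp [hk]
  · simp

theorem vandWeight_nonneg (t : Fin (r + 1) → Fin n) : 0 ≤ vandWeight X t :=
  Finset.prod_nonneg fun _ _ => Finset.prod_nonneg fun _ _ => abs_nonneg _

theorem injective_of_vandWeight_ne_zero {t : Fin (r + 1) → Fin n} (ht : vandWeight X t ≠ 0) :
    Function.Injective (X ∘ t) := by
  intro j k hjk
  by_contra hne
  refine ht (Finset.prod_eq_zero (Finset.mem_univ j) (Finset.prod_eq_zero
    (Finset.mem_erase.2 ⟨fun h => hne h.symm, Finset.mem_univ k⟩) ?_))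
  rw [show X (t j) = X (t k) from hjk]
  simp

theorem vandWeight_mul_abs_lagr_le (hX : ∀ i, X i ∈ Icc (0 : ℝ) 1) {x : ℝ}
    (hx : x ∈ Icc (0 : ℝ) 1) (t : Fin (r + 1) → Fin n) (j : Fin (r + 1)) :
    vandWeight X t * |lagr (X ∘ t) j x| ≤ 1 := by
  have hle : ∀ u ∈ Icc (0 : ℝ) 1, ∀ v ∈ Icc (0 : ℝ) 1, |u - v| ≤ 1 := fun u hu v hv =>
    abs_le.2 ⟨by linarith [hu.1, hv.2], by linarith [hu.2, hv.1]⟩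
  rw [vandWeight, ← Finset.mul_prod_erase _ _ (Finset.mem_univ j), mul_assoc, mul_comm, mul_assoc]
  refine mul_le_one₀ (Finset.prod_le_one (fun _ _ => Finset.prod_nonneg fun _ _ => abs_nonneg _)
    fun _ _ => Finset.prod_le_one (fun _ _ => abs_nonneg _) fun _ _ => hle _ (hX _) _ (hX _))
    (mul_nonneg (abs_nonneg _) (Finset.prod_nonneg fun _ _ => abs_nonneg _)) ?_
  rw [lagr, Finset.abs_prod, ← Finset.prod_mul_distrib]
  refine Finset.prod_le_one (fun _ _ => by positivity) fun b _ => ?_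
  rw [abs_div]
  simp only [Function.comp]
  rcases eq_or_ne |X (t j) - X (t b)| 0 with h0 | h0
  · simp [h0]
  · rw [div_mul_cancel₀ _ h0]
    exact hle _ hx _ (hX _)

end weights

/-- The noise averaged over the tuples of a box is spread out: each observation enters with a
coefficient at most of the order of the inverse of the smallest number of observations in a
subinterval. -/
theorem sum_sq_tupEst_single_le {r n : ℕ} {X : Fin n → ℝ} {a h x D ν : ℝ} (hD0 : 0 ≤ D)
    (hν : 0 < ν) (hN : ∀ j : Fin (r + 1), ν ≤ binCount (subbin r a h j) X)
    (hD : ∀ t : Fin (r + 1) → Fin n, boxWeight a h X t ≠ 0 → ∀ j, |lagr (X ∘ t) j x| ≤ D) :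
    ∑ i, (tupEst (r := r) (boxWeight a h X) X (Pi.single i 1) x) ^ 2
      ≤ ((r + 1) * D) ^ 2 / ν := by
  have hN' : ∀ j : Fin (r + 1), 0 < binCount (subbin r a h j) X := fun j => hν.trans_le (hN j)
  set S := ∑ t : Fin (r + 1) → Fin n, boxWeight a h X t with hS
  have hS0 : 0 < S := by
    rw [hS, sum_boxWeight]
    exact Finset.prod_pos fun j _ => hN' j
  set ψ : Fin n → Fin (r + 1) → ℝ := fun i j =>
    ∑ t : Fin (r + 1) → Fin n, boxWeight a h X t * if t j = i then 1 else 0 with hψ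
  have hψ0 : ∀ i j, 0 ≤ ψ i j := fun i j => Finset.sum_nonneg fun t _ =>
    mul_nonneg (boxWeight_nonneg t) (by split_ifs <;> norm_num)
  have hψs : ∀ j, ∑ i, ψ i j = S := by
    intro j
    rw [hψ, Finset.sum_comm]
    simp [hS]
  have h1 : ∀ i, |tupEst (r := r) (boxWeight a h X) X (Pi.single i 1) x|
      ≤ D * (∑ j, ψ i j) / S := by
    intro i
    refine (abs_tupEst_le_sum (fun t => boxWeight_nonneg t) _ x).trans ?_
    refine div_le_div_of_nonneg_right ?_ hS0.le
    rw [Finset.mul_sum, Finset.sum_comm]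
    refine Finset.sum_le_sum fun j _ => ?_
    rw [hψ, Finset.mul_sum]
    refine Finset.sum_le_sum fun t _ => ?_
    by_cases ht : boxWeight a h X t = 0
    · simp [ht]
    · have h2 := hD t ht j
      have h3 := boxWeight_nonneg (a := a) (h := h) (X := X) t
      by_cases hi : t j = i
      · simp only [hi, Pi.single_eq_same, abs_one, mul_one, if_true]
        rw [mul_comm D]
        gcongr
      · simp [hi]
  have h2 : ∀ i, |tupEst (r := r) (boxWeight a h X) X (Pi.single i 1) x| ≤ (r + 1) * D / ν := by
    intro i
    refine (h1 i).trans ?_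
    rw [mul_div_assoc, Finset.sum_div]
    have : ∑ j, ψ i j / S ≤ (r + 1) * (1 / ν) := by
      refine (Finset.sum_le_card_nsmul _ _ (1 / ν) fun j _ => ?_).trans (by simp)
      rw [div_le_iff₀ hS0]
      refine (sum_boxWeight_fiber_le j i hN').trans ?_
      rw [← hS, div_eq_inv_mul, ← one_div]
      have := hN j
      gcongr
    calc D * ∑ j, ψ i j / S ≤ D * ((r + 1) * (1 / ν)) := by gcongr
      _ = _ := by ring
  have h3 : ∑ i, |tupEst (r := r) (boxWeight a h X) X (Pi.single i 1) x| ≤ (r + 1) * D := by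
    refine (Finset.sum_le_sum fun i _ => h1 i).trans (le_of_eq ?_)
    rw [← Finset.sum_div, ← Finset.mul_sum, Finset.sum_comm, Finset.sum_congr rfl fun j _ => hψs j]
    simp only [Finset.sum_const, Finset.card_univ, Fintype.card_fin, nsmul_eq_mul]
    push_cast
    field_simp
  calc ∑ i, (tupEst (r := r) (boxWeight a h X) X (Pi.single i 1) x) ^ 2
      ≤ ∑ i, ((r + 1) * D / ν) * |tupEst (r := r) (boxWeight a h X) X (Pi.single i 1) x| := by
        refine Finset.sum_le_sum fun i _ => ?_
        rw [← sq_abs, sq]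
        exact mul_le_mul_of_nonneg_right (h2 i) (abs_nonneg _)
    _ ≤ ((r + 1) * D / ν) * ((r + 1) * D) := by
        rw [← Finset.mul_sum]
        gcongr
    _ = _ := by ring

/-! ### Polynomial approximation of Hölder functions -/

/-- An antiderivative of a polynomial with a prescribed value at one point. -/
theorem exists_polynomial_derivative_eq (Q : Polynomial ℝ) (x y : ℝ) :
    ∃ P : Polynomial ℝ, P.natDegree ≤ Q.natDegree + 1 ∧ P.derivative = Q ∧ P.eval x = y := by
  set R : Polynomial ℝ := Q.sum fun k c => Polynomial.monomial (k + 1) (c / (k + 1)) with hR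
  have hd : R.derivative = Q := by
    rw [hR, Polynomial.sum_def, Polynomial.derivative_sum]
    conv_rhs => rw [Q.as_sum_support]
    refine Finset.sum_congr rfl fun k _ => ?_
    rw [Polynomial.derivative_monomial]
    congr 1
    have : (k : ℝ) + 1 ≠ 0 := by positivity
    push_cast
    field_simp
  refine ⟨R + Polynomial.C (y - R.eval x), ?_, by simp [hd], by simp⟩
  rw [Polynomial.natDegree_add_C, hR, Polynomial.sum_def]
  refine Polynomial.natDegree_sum_le_of_forall_le _ _ fun k hk => ?_
  exact (Polynomial.natDegree_monomial_le _).trans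
    (Nat.succ_le_succ (Polynomial.le_natDegree_of_mem_supp k hk))

/-- Taylor's formula for functions whose derivative of order `r` is Hölder continuous, by induction
on `r`: an approximation of the derivative is integrated. -/
theorem exists_polynomial_abs_sub_le {L : ℝ} (hL : 0 ≤ L) (r : ℕ) {e : ℝ} (he : 0 < e)
    (f : ℝ → ℝ) (hf : ContDiffOn ℝ r f (Icc 0 1))
    (hh : ∀ x ∈ Icc (0 : ℝ) 1, ∀ y ∈ Icc (0 : ℝ) 1,
      |iteratedDerivWithin r f (Icc 0 1) x - iteratedDerivWithin r f (Icc 0 1) y|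
        ≤ L * |x - y| ^ e) {x : ℝ} (hx : x ∈ Icc (0 : ℝ) 1) :
    ∃ P : Polynomial ℝ, P.natDegree ≤ r ∧ P.eval x = f x ∧
      ∀ y ∈ Icc (0 : ℝ) 1, |f y - P.eval y| ≤ L * |y - x| ^ (e + r) := by
  induction r generalizing f with
  | zero =>
    refine ⟨Polynomial.C (f x), by simp, by simp, fun y hy => ?_⟩
    simpa using hh y hy x hx
  | succ r ih =>
    have hu : UniqueDiffOn ℝ (Icc (0 : ℝ) 1) := uniqueDiffOn_Icc zero_lt_one
    have hf' : ContDiffOn ℝ r (derivWithin f (Icc 0 1)) (Icc 0 1) :=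
      hf.derivWithin hu (by norm_cast)
    obtain ⟨Q, hQd, hQx, hQ⟩ := ih (derivWithin f (Icc 0 1)) hf' (by
      intro u hu' v hv
      have := hh u hu' v hv
      rwa [iteratedDerivWithin_succ'] at this)
    obtain ⟨P, hPd, hPQ, hPx⟩ := exists_polynomial_derivative_eq Q x (f x)
    refine ⟨P, hPd.trans (by omega), hPx, fun y hy => ?_⟩
    have hfd : DifferentiableOn ℝ f (Icc 0 1) := hf.differentiableOn (by simp)
    have hder : ∀ u ∈ uIcc x y, HasDerivWithinAt (fun v => f v - P.eval v)
        (derivWithin f (Icc 0 1) u - Q.eval u) (uIcc x y) u := by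
      intro u hu'
      have hsub : uIcc x y ⊆ Icc 0 1 := uIcc_subset_Icc hx hy
      have h1 := (hfd u (hsub hu')).hasDerivWithinAt.mono hsub
      have h2 := (P.hasDerivAt u).hasDerivWithinAt (s := uIcc x y)
      rw [hPQ] at h2
      exact h1.sub h2
    have hbd : ∀ u ∈ uIcc x y, ‖derivWithin f (Icc 0 1) u - Q.eval u‖
        ≤ L * |y - x| ^ (e + r) := by
      intro u hu'
      refine (hQ u (uIcc_subset_Icc hx hy hu')).trans ?_
      have : |u - x| ≤ |y - x| := by
        have := abs_sub_left_of_mem_uIcc hu'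
        rwa [abs_sub_comm u] at *
      gcongr
    have := (convex_uIcc x y).norm_image_sub_le_of_norm_hasDerivWithin_le hder hbd
      left_mem_uIcc right_mem_uIcc
    simp only [hPx, sub_self, sub_zero, Real.norm_eq_abs] at this
    refine this.trans (le_of_eq ?_)
    rcases eq_or_ne |y - x| 0 with h0 | h0
    · rw [h0, mul_zero, Real.zero_rpow (by positivity), mul_zero]
    · rw [mul_assoc, ← Real.rpow_add_one h0]
      congr 2
      push_cast
      ring

theorem strictFloor_lt {s : ℝ} (hs : 0 < s) : (strictFloor s : ℝ) < s := by
  have h1 : 0 < ⌈s⌉₊ := Nat.ceil_pos.2 hs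
  have h2 := Nat.ceil_lt_add_one hs.le
  rw [strictFloor, Nat.cast_sub h1]
  push_cast
  linarith

/-- Hölder functions are approximated near each point by polynomials, with an error uniform over
the class. -/
theorem exists_polynomial_of_mem_holderClass {s L : ℝ} (hs : 0 < s) (hL : 0 ≤ L) {f : ℝ → ℝ}
    (hf : f ∈ holderClass s L) {x : ℝ} (hx : x ∈ Icc (0 : ℝ) 1) :
    ∃ P : Polynomial ℝ, P.natDegree ≤ strictFloor s ∧ P.eval x = f x ∧
      ∀ y ∈ Icc (0 : ℝ) 1, |f y - P.eval y| ≤ L * |y - x| ^ s := by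
  have := exists_polynomial_abs_sub_le hL (strictFloor s) (sub_pos.2 (strictFloor_lt hs)) f hf.1
    hf.2 hx
  simpa using this

/-! ### Deterministic error bounds -/

/-- The estimate on a cell: the average over the tuples of the box `[a, a + h]` if there are any,
and otherwise the average over all tuples with Vandermonde weights. -/
noncomputable def localEst (r : ℕ) {n : ℕ} (a h : ℝ) (X Y : Fin n → ℝ) (x : ℝ) : ℝ :=
  if ∑ t : Fin (r + 1) → Fin n, boxWeight a h X t = 0 then
    tupEst (r := r) (vandWeight X) X Y x else tupEst (r := r) (boxWeight a h X) X Y x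

/-- A bound for the Lagrange cardinal functions of nodes in the subintervals of a window. -/
def lagrBound (r : ℕ) : ℝ := (3 * (2 * r + 1)) ^ r

theorem lagrBound_pos (r : ℕ) : 0 < lagrBound r := by unfold lagrBound; positivity

theorem abs_lagr_le_lagrBound {r : ℕ} {a h x : ℝ} (hh : 0 < h) (hx : |x - a| ≤ 2 * h)
    {z : Fin (r + 1) → ℝ} (hz : ∀ j, z j ∈ subbin r a h j) (j : Fin (r + 1)) :
    |lagr z j x| ≤ lagrBound r := by
  have : lagrBound r = (3 * h / (h / (2 * r + 1))) ^ r := by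
    rw [lagrBound]
    congr 1
    field_simp
  rw [this]
  refine abs_lagr_le (by positivity) (fun b hb => le_abs_sub_of_mem_subbin hh.le hb.symm (hz j)
    (hz b)) fun b => ?_
  have h1 := subbin_subset hh.le b (hz b)
  rw [abs_le] at hx ⊢
  exact ⟨by linarith [h1.2], by linarith [h1.1]⟩

/-- The midpoint of a subinterval. -/
noncomputable def subbinMid (r : ℕ) (a h : ℝ) (j : Fin (r + 1)) : ℝ :=
  a + (2 * j + 1 / 2) * (h / (2 * r + 1))

theorem subbinMid_mem {r : ℕ} {a h : ℝ} (hh : 0 ≤ h) (j : Fin (r + 1)) :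
    subbinMid r a h j ∈ subbin r a h j := by
  have : 0 ≤ h / (2 * r + 1) := by positivity
  constructor <;> rw [subbinMid] <;> nlinarith

theorem subbinMid_injective {r : ℕ} {a h : ℝ} (hh : 0 < h) :
    Function.Injective (subbinMid r a h) := by
  intro j k hjk
  by_contra hne
  have h1 := le_abs_sub_of_mem_subbin hh.le hne (subbinMid_mem (a := a) hh.le j)
    (subbinMid_mem (a := a) hh.le k)
  rw [hjk, sub_self, abs_zero] at h1
  have : 0 < h / (2 * r + 1) := by positivity
  linarith

section errors

variable {s L σ : ℝ} {n : ℕ} {X ξ : Fin n → ℝ} {f : ℝ → ℝ} {a h x : ℝ}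

theorem abs_sub_le_three_mul {r : ℕ} (hh : 0 ≤ h) (hxa : |x - a| ≤ 2 * h) {y : ℝ}
    {j : Fin (r + 1)} (hy : y ∈ subbin r a h j) : |y - x| ≤ 3 * h := by
  have h1 := subbin_subset hh j hy
  rw [abs_le] at hxa ⊢
  exact ⟨by linarith [h1.1], by linarith [h1.2]⟩

/-- The error is the sum of an error for the remainder of the approximation of `f` by a
polynomial, which is controlled uniformly over the class, and of the averaged noise. -/
theorem tupEst_sub_eq {r : ℕ} {φ : (Fin (r + 1) → Fin n) → ℝ}
    (hinj : ∀ t, φ t ≠ 0 → Function.Injective (X ∘ t)) (hφ : ∑ t, φ t ≠ 0)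
    {P : Polynomial ℝ} (hP : P.natDegree ≤ r) (hPx : P.eval x = f x) :
    tupEst φ X (fun i => f (X i) + σ * ξ i) x - f x
      = tupEst φ X (fun i => (f (X i) - P.eval (X i)) + σ * ξ i) x := by
  rw [tupEst_add, tupEst_add, ← hPx, ← tupEst_poly hinj hφ hP x]
  have := tupEst_add (φ := φ) (X := X) (fun i => f (X i)) (fun i => P.eval (X i)) (-1) x
  simp only [neg_mul, one_mul, ← sub_eq_add_neg] at this
  rw [this]
  ring

theorem injective_of_boxWeight_ne_zero {r : ℕ} (hh : 0 < h) {t : Fin (r + 1) → Fin n}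
    (ht : boxWeight a h X t ≠ 0) : Function.Injective (X ∘ t) := by
  intro j k hjk
  by_contra hne
  have h1 := le_abs_sub_of_mem_subbin hh.le hne (mem_subbin_of_boxWeight_ne_zero ht j)
    (mem_subbin_of_boxWeight_ne_zero ht k)
  rw [show X (t j) = X (t k) from hjk, sub_self, abs_zero] at h1
  have : 0 < h / (2 * r + 1) := by positivity
  linarith

/-- The bias and noise bound when every subinterval of the window holds an observation. -/
theorem abs_localEst_sub_le (hs : 0 < s) (hL : 0 ≤ L) (hσ : 0 ≤ σ) (hf : f ∈ holderClass s L)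
    (hX : ∀ i, X i ∈ Icc (0 : ℝ) 1) (hx : x ∈ Icc (0 : ℝ) 1) (hh : 0 < h)
    (hxa : |x - a| ≤ 2 * h)
    (hN : ∀ j : Fin (strictFloor s + 1), 0 < binCount (subbin (strictFloor s) a h j) X) :
    |localEst (strictFloor s) a h X (fun i => f (X i) + σ * ξ i) x - f x|
      ≤ (strictFloor s + 1) * (lagrBound (strictFloor s) * (L * (3 * h) ^ s))
        + ∑ l, σ * lagrBound (strictFloor s) *
          |tupEst (r := strictFloor s) (boxWeight a h X) X ξ
            (subbinMid (strictFloor s) a h l)| := by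
  obtain ⟨P, hPd, hPx, hP⟩ := exists_polynomial_of_mem_holderClass hs hL hf hx
  generalize strictFloor s = r at *
  have hS : 0 < ∑ t : Fin (r + 1) → Fin n, boxWeight a h X t := by
    rw [sum_boxWeight]
    exact Finset.prod_pos fun j _ => hN j
  rw [localEst, if_neg hS.ne', tupEst_sub_eq (fun t ht => injective_of_boxWeight_ne_zero hh ht)
    hS.ne' hPd hPx, tupEst_add]
  refine (abs_add_le _ _).trans (add_le_add ?_ ?_)
  · refine abs_tupEst_le (fun t => boxWeight_nonneg t) hS (fun t ht j => ?_) fun t ht j => ?_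
    · exact abs_lagr_le_lagrBound hh hxa (fun j => mem_subbin_of_boxWeight_ne_zero ht j) j
    · refine (hP _ (hX _)).trans ?_
      have := abs_sub_le_three_mul hh.le hxa (mem_subbin_of_boxWeight_ne_zero ht j)
      gcongr
  · rw [tupEst_eq_sum_nodes (subbinMid_injective (r := r) (a := a) hh), Finset.mul_sum]
    refine (Finset.abs_sum_le_sum_abs _ _).trans (Finset.sum_le_sum fun l _ => ?_)
    rw [abs_mul, abs_mul, abs_of_nonneg hσ, mul_assoc]
    have := abs_lagr_le_lagrBound hh hxa (fun j => subbinMid_mem hh.le j) l (r := r)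
    gcongr

/-- A crude bound that needs no regularity of the design beyond the existence of `r + 1` distinct
design points. -/
theorem abs_localEst_sub_le_crude (hs : 0 < s) (hL : 0 ≤ L) (hσ : 0 ≤ σ)
    (hf : f ∈ holderClass s L) (hX : ∀ i, X i ∈ Icc (0 : ℝ) 1) (hx : x ∈ Icc (0 : ℝ) 1)
    (hh : 0 < h) (hxa : |x - a| ≤ 2 * h)
    (hS : 0 < ∑ t : Fin (strictFloor s + 1) → Fin n, vandWeight X t) :
    |localEst (strictFloor s) a h X (fun i => f (X i) + σ * ξ i) x - f x|
      ≤ (strictFloor s + 1) * ((lagrBound (strictFloor s) + n ^ (strictFloor s + 1)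
          / ∑ t : Fin (strictFloor s + 1) → Fin n, vandWeight X t) * (L + σ * ∑ i, |ξ i|)) := by
  obtain ⟨P, hPd, hPx, hP⟩ := exists_polynomial_of_mem_holderClass hs hL hf hx
  generalize strictFloor s = r at *
  have hU : ∀ i, |f (X i) - P.eval (X i) + σ * ξ i| ≤ L + σ * ∑ i, |ξ i| := by
    intro i
    refine (abs_add_le _ _).trans (add_le_add ((hP _ (hX i)).trans ?_) ?_)
    · refine mul_le_of_le_one_right hL (Real.rpow_le_one (abs_nonneg _) ?_ hs.le)
      exact abs_le.2 ⟨by linarith [hx.2, (hX i).1], by linarith [hx.1, (hX i).2]⟩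
    · rw [abs_mul, abs_of_nonneg hσ]
      exact mul_le_mul_of_nonneg_left (Finset.single_le_sum (f := fun i => |ξ i|)
        (fun _ _ => abs_nonneg _) (Finset.mem_univ i)) hσ
  have hb : 0 ≤ L + σ * ∑ i, |ξ i| := by positivity
  have hD := lagrBound_pos r
  rw [localEst]
  split_ifs with h0
  · rw [tupEst_sub_eq (fun t ht => injective_of_vandWeight_ne_zero ht) hS.ne' hPd hPx]
    refine (abs_tupEst_le_of_mul_le_one (fun t => vandWeight_nonneg t)
      (fun t j => vandWeight_mul_abs_lagr_le hX hx t j) hU).trans ?_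
    gcongr
    linarith
  · have hS' : 0 < ∑ t : Fin (r + 1) → Fin n, boxWeight a h X t :=
      lt_of_le_of_ne (Finset.sum_nonneg fun t _ => boxWeight_nonneg t) (Ne.symm h0)
    rw [tupEst_sub_eq (fun t ht => injective_of_boxWeight_ne_zero hh ht) h0 hPd hPx]
    refine (abs_tupEst_le (D := lagrBound r) (fun t => boxWeight_nonneg t) hS' (fun t ht j => ?_)
      fun t ht j => hU (t j)).trans ?_
    · exact abs_lagr_le_lagrBound hh hxa (fun j => mem_subbin_of_boxWeight_ne_zero ht j) j
    · gcongr
      have : 0 ≤ n ^ (r + 1) / ∑ t : Fin (r + 1) → Fin n, vandWeight X t := by positivity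
      linarith

end errors

/-! ### Moments and deviations under the sampling law -/

/-- The law of the design points. -/
noncomputable def designPi (μ : ℝ → ℝ) (n : ℕ) : Measure (Fin n → ℝ) :=
  Measure.pi fun _ => designLaw μ

/-- The law of the noise variables. -/
noncomputable def noisePi (n : ℕ) : Measure (Fin n → ℝ) := Measure.pi fun _ => gaussianReal 0 1

instance (n : ℕ) : IsProbabilityMeasure (noisePi n) := by unfold noisePi; infer_instance

theorem isProbabilityMeasure_designPi {μ : ℝ → ℝ} (hμ : IsDesignDensity μ) (n : ℕ) :
    IsProbabilityMeasure (designPi μ n) := by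
  have := isProbabilityMeasure_designLaw hμ
  unfold designPi
  infer_instance

theorem isProbabilityMeasure_sampleLaw {μ : ℝ → ℝ} (hμ : IsDesignDensity μ) (n : ℕ) :
    IsProbabilityMeasure (sampleLaw μ n) := by
  have := isProbabilityMeasure_designLaw hμ
  unfold sampleLaw
  infer_instance

/-- Integration over the sample, noise first. -/
theorem lintegral_sampleLaw_le {μ : ℝ → ℝ} (hμ : IsDesignDensity μ) {n : ℕ}
    (g : (Fin n → ℝ) → (Fin n → ℝ) → ℝ≥0∞) :
    ∫⁻ ω, g (fun i => (ω i).1) (fun i => (ω i).2) ∂(sampleLaw μ n)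
      ≤ ∫⁻ X, ∫⁻ ξ, g X ξ ∂(noisePi n) ∂(designPi μ n) := by
  have := isProbabilityMeasure_designLaw hμ
  have hm := measurePreserving_arrowProdEquivProdArrow ℝ ℝ (Fin n) (fun _ => designLaw μ)
    (fun _ => gaussianReal 0 1)
  have h1 : ∫⁻ ω, g (fun i => (ω i).1) (fun i => (ω i).2) ∂(sampleLaw μ n)
      = ∫⁻ p, g p.1 p.2 ∂((designPi μ n).prod (noisePi n)) := by
    unfold designPi noisePi
    rw [← hm.map_eq, lintegral_map_equiv]
    rfl
  rw [h1]
  exact lintegral_prod_le _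

theorem ae_mem_Icc_designPi {μ : ℝ → ℝ} (hμ : IsDesignDensity μ) (n : ℕ) :
    ∀ᵐ X ∂(designPi μ n), ∀ i, X i ∈ Icc (0 : ℝ) 1 := by
  have := isProbabilityMeasure_designLaw hμ
  have h0 : ∀ᵐ y ∂(designLaw μ), y ∈ Icc (0 : ℝ) 1 :=
    (withDensity_absolutelyContinuous _ _).ae_le (ae_restrict_mem measurableSet_Icc)
  refine ae_all_iff.2 fun i => ?_
  exact (measurePreserving_eval (fun _ : Fin n => designLaw μ) i).quasiMeasurePreserving.ae h0

theorem lintegral_exp_sum_noisePi {n : ℕ} (a : Fin n → ℝ) :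
    ∫⁻ ξ, ENNReal.ofReal (Real.exp (∑ i, a i * ξ i)) ∂(noisePi n)
      = ENNReal.ofReal (Real.exp ((∑ i, a i ^ 2) / 2)) := by
  have h1 : ∀ ξ : Fin n → ℝ, ENNReal.ofReal (Real.exp (∑ i, a i * ξ i))
      = ∏ i, ENNReal.ofReal (Real.exp (a i * ξ i)) := fun ξ => by
    rw [Real.exp_sum, ENNReal.ofReal_prod_of_nonneg fun i _ => (Real.exp_pos _).le]
  simp only [h1]
  have hind : iIndepFun (fun (i : Fin n) (ξ : Fin n → ℝ) => ENNReal.ofReal (Real.exp (a i * ξ i)))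
      (noisePi n) := iIndepFun_pi (X := fun i y => ENNReal.ofReal (Real.exp (a i * y)))
    fun i => by fun_prop
  rw [lintegral_prod_eq_prod_lintegral_of_indepFun _ _ hind (fun i => by fun_prop)]
  have h2 : ∀ i, ∫⁻ ξ, ENNReal.ofReal (Real.exp (a i * ξ i)) ∂(noisePi n)
      = ENNReal.ofReal (Real.exp (a i ^ 2 / 2)) := by
    intro i
    have hev := measurePreserving_eval (fun _ : Fin n => gaussianReal 0 1) i
    have := hev.lintegral_comp (f := fun y => ENNReal.ofReal (Real.exp (a i * y)))
      (by fun_prop)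
    unfold noisePi
    refine this.trans ?_
    rw [← ofReal_integral_eq_lintegral_ofReal (integrable_exp_mul_gaussianReal _)
      (ae_of_all _ fun _ => (Real.exp_pos _).le)]
    have := mgf_gaussianReal (p := gaussianReal 0 1) (X := id) (μ := 0) (v := 1) (by simp) (a i)
    rw [mgf] at this
    simp only [id] at this
    rw [this]
    simp
  simp only [h2]
  rw [← ENNReal.ofReal_prod_of_nonneg fun i _ => (Real.exp_pos _).le, ← Real.exp_sum,
    Finset.sum_div]

theorem lintegral_exp_abs_sum_noisePi_le {n : ℕ} (a : Fin n → ℝ) {v : ℝ}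
    (hv : ∑ i, a i ^ 2 ≤ v) (c : ℝ) :
    ∫⁻ ξ, ENNReal.ofReal (Real.exp (c * |∑ i, a i * ξ i|)) ∂(noisePi n)
      ≤ ENNReal.ofReal (2 * Real.exp (c ^ 2 * v / 2)) := by
  have hexp : ∀ c : ℝ, ∫⁻ ξ, ENNReal.ofReal (Real.exp (c * ∑ i, a i * ξ i)) ∂(noisePi n)
      ≤ ENNReal.ofReal (Real.exp (c ^ 2 * v / 2)) := by
    intro c
    have := lintegral_exp_sum_noisePi fun i => c * a i
    simp only [mul_assoc, ← Finset.mul_sum, mul_pow] at this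
    rw [this]
    gcongr
  calc _ ≤ ∫⁻ ξ, (ENNReal.ofReal (Real.exp (c * ∑ i, a i * ξ i))
        + ENNReal.ofReal (Real.exp ((-c) * ∑ i, a i * ξ i))) ∂(noisePi n) := by
        refine lintegral_mono fun ξ => ?_
        rcases abs_choice (∑ i, a i * ξ i) with h | h <;> rw [h]
        · exact le_self_add
        · rw [mul_neg, ← neg_mul]
          exact le_add_self
    _ ≤ _ := by
        rw [lintegral_add_left (by fun_prop), two_mul, ENNReal.ofReal_add (by positivity)
          (by positivity)]
        refine add_le_add (hexp c) ?_
        simpa using hexp (-c)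

/-- All moments of the sum of the absolute values of the noise grow at most polynomially. -/
theorem exists_lintegral_sum_abs_noise_le {p : ℕ} (hp : p ≠ 0) : ∃ C : ℝ, 0 ≤ C ∧ ∀ n : ℕ,
    ∫⁻ ξ, ENNReal.ofReal ((∑ i, |ξ i|) ^ p) ∂(noisePi n) ≤ ENNReal.ofReal (C * n ^ (p + 1)) := by
  have hint : Integrable (fun y : ℝ => |y| ^ p) (gaussianReal 0 1) := by
    have := (memLp_id_gaussianReal (μ := 0) (v := 1) p).integrable_norm_pow'
    simpa using this
  refine ⟨∫ y, |y| ^ p ∂(gaussianReal 0 1), integral_nonneg fun _ => by positivity, fun n => ?_⟩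
  calc _ ≤ ∫⁻ ξ, ∑ i, ENNReal.ofReal (n ^ p) * ENNReal.ofReal (|ξ i| ^ p) ∂(noisePi n) := by
        refine lintegral_mono fun ξ => ?_
        simp only [← ENNReal.ofReal_mul (show (0 : ℝ) ≤ n ^ p by positivity)]
        rw [← ENNReal.ofReal_sum_of_nonneg fun i _ => by positivity]
        refine ENNReal.ofReal_le_ofReal ?_
        rcases Nat.eq_zero_or_pos n with rfl | hn
        · simp [hp]
        · obtain ⟨k, -, hk⟩ := Finset.exists_max_image (Finset.univ : Finset (Fin n))
            (fun i => |ξ i|) ⟨⟨0, hn⟩, Finset.mem_univ _⟩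
          calc (∑ i, |ξ i|) ^ p ≤ (n * |ξ k|) ^ p := by
                refine pow_le_pow_left₀ (Finset.sum_nonneg fun _ _ => abs_nonneg _) ?_ p
                exact (Finset.sum_le_card_nsmul _ _ _ hk).trans (by simp)
            _ = n ^ p * |ξ k| ^ p := mul_pow _ _ _
            _ ≤ _ := Finset.single_le_sum (f := fun i => (n : ℝ) ^ p * |ξ i| ^ p)
                (fun _ _ => by positivity) (Finset.mem_univ k)
    _ = ∑ i : Fin n, ENNReal.ofReal (n ^ p)
          * ∫⁻ y, ENNReal.ofReal (|y| ^ p) ∂(gaussianReal 0 1) := by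
        rw [lintegral_finsetSum _ fun i _ => by fun_prop]
        refine Finset.sum_congr rfl fun i _ => ?_
        rw [lintegral_const_mul _ (by fun_prop)]
        congr 1
        exact (measurePreserving_eval (fun _ : Fin n => gaussianReal 0 1) i).lintegral_comp
          (f := fun y => ENNReal.ofReal (|y| ^ p)) (by fun_prop)
    _ ≤ _ := by
        rw [← ofReal_integral_eq_lintegral_ofReal hint (ae_of_all _ fun _ => by positivity),
          ← ENNReal.ofReal_mul (by positivity)]
        simp only [Finset.sum_const, Finset.card_univ, Fintype.card_fin, nsmul_eq_mul]
        rw [← ENNReal.ofReal_natCast, ← ENNReal.ofReal_mul (by positivity)]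
        exact ENNReal.ofReal_le_ofReal (le_of_eq (by ring))

/-- Chernoff's bound: a set of large mass contains, with overwhelming probability, half the number
of observations that is expected. -/
theorem designPi_binCount_lt_le {μ : ℝ → ℝ} (hμ : IsDesignDensity μ) {n : ℕ} {B : Set ℝ}
    (hB : MeasurableSet B) {m : ℝ} (hm : m ≤ (designLaw μ).real B) :
    designPi μ n {X | binCount B X < n * m / 2} ≤ ENNReal.ofReal (Real.exp (-(n * m / 10))) := by
  have := isProbabilityMeasure_designLaw hμ
  set M := (designLaw μ).real B with hM
  have hmeas : Measurable fun y : ℝ => ENNReal.ofReal (Real.exp (-(B.indicator 1 y))) := by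
    have : Measurable (B.indicator (1 : ℝ → ℝ)) := measurable_one.indicator hB
    fun_prop
  have hone : ∫⁻ y, ENNReal.ofReal (Real.exp (-(B.indicator 1 y))) ∂(designLaw μ)
      ≤ ENNReal.ofReal (Real.exp (-(3 / 5 * M))) := by
    have h1 : ∀ y, ENNReal.ofReal (Real.exp (-(B.indicator 1 y)))
        = ENNReal.ofReal (1 - (1 - Real.exp (-1)) * B.indicator 1 y) := by
      intro y
      by_cases hy : y ∈ B <;> simp [hy]
    have hint : Integrable (B.indicator (1 : ℝ → ℝ)) (designLaw μ) :=
      (integrable_const (1 : ℝ)).indicator hB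
    have he : Real.exp (-1) ≤ 2 / 5 := by
      rw [Real.exp_neg, inv_le_comm₀ (Real.exp_pos _) (by norm_num)]
      have := Real.exp_one_gt_d9
      norm_num
      linarith
    have hint' : Integrable (fun y => 1 - (1 - Real.exp (-1)) * B.indicator (1 : ℝ → ℝ) y)
      (designLaw μ) := (integrable_const _).sub (hint.const_mul _)
    simp only [h1]
    rw [← ofReal_integral_eq_lintegral_ofReal hint' (ae_of_all _ fun y => ?_)]
    · rw [integral_sub (integrable_const _) (hint.const_mul _), integral_const_mul,
        integral_indicator_one hB, ← hM]
      refine ENNReal.ofReal_le_ofReal ?_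
      have := Real.add_one_le_exp (-(3 / 5 * M))
      have hM0 : 0 ≤ M := measureReal_nonneg
      simp only [integral_const, probReal_univ, smul_eq_mul, mul_one]
      nlinarith
    · by_cases hy : y ∈ B
      · simp [hy]
        positivity
      · simp [hy]
  calc designPi μ n {X | binCount B X < n * m / 2}
      ≤ ∫⁻ X, ENNReal.ofReal (Real.exp (n * m / 2)) * ∏ i, ENNReal.ofReal
          (Real.exp (-(B.indicator 1 (X i)))) ∂(designPi μ n) := by
        have hms : MeasurableSet {X : Fin n → ℝ | binCount B X < n * m / 2} := by
          have : Measurable (B.indicator (1 : ℝ → ℝ)) := measurable_one.indicator hB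
          unfold binCount
          exact measurableSet_lt (by fun_prop) measurable_const
        rw [← lintegral_indicator_one hms]
        refine lintegral_mono fun X => ?_
        rw [← ENNReal.ofReal_prod_of_nonneg fun i _ => (Real.exp_pos _).le, ← Real.exp_sum,
          ← ENNReal.ofReal_mul (Real.exp_pos _).le, ← Real.exp_add]
        by_cases hX : binCount B X < n * m / 2
        · rw [Set.indicator_of_mem (by exact hX)]
          simp only [Pi.one_apply]
          rw [← ENNReal.ofReal_one]
          refine ENNReal.ofReal_le_ofReal (Real.one_le_exp ?_)
          rw [binCount] at hX
          rw [Finset.sum_neg_distrib]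
          linarith
        · rw [Set.indicator_of_notMem (by exact hX)]
          exact zero_le
    _ = ENNReal.ofReal (Real.exp (n * m / 2)) * ∏ i : Fin n, ∫⁻ y, ENNReal.ofReal
          (Real.exp (-(B.indicator 1 y))) ∂(designLaw μ) := by
        rw [lintegral_const_mul' _ _ ENNReal.ofReal_ne_top]
        congr 1
        unfold designPi
        rw [lintegral_prod_eq_prod_lintegral_of_indepFun Finset.univ
          (fun (i : Fin n) (X : Fin n → ℝ) => ENNReal.ofReal (Real.exp (-(B.indicator 1 (X i)))))
          (iIndepFun_pi (X := fun i y => ENNReal.ofReal (Real.exp (-(B.indicator 1 y))))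
            fun i => hmeas.aemeasurable) (fun i => hmeas.comp (measurable_pi_apply i))]
        refine Finset.prod_congr rfl fun i _ => ?_
        exact (measurePreserving_eval (fun _ : Fin n => designLaw μ) i).lintegral_comp hmeas
    _ ≤ ENNReal.ofReal (Real.exp (n * m / 2))
          * ∏ i : Fin n, ENNReal.ofReal (Real.exp (-(3 / 5 * M))) := by
        gcongr
    _ ≤ _ := by
        rw [← ENNReal.ofReal_prod_of_nonneg fun i _ => (Real.exp_pos _).le, ← Real.exp_sum,
          ← ENNReal.ofReal_mul (Real.exp_pos _).le, ← Real.exp_add]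
        refine ENNReal.ofReal_le_ofReal (Real.exp_le_exp.2 ?_)
        simp only [Finset.sum_const, Finset.card_univ, Fintype.card_fin, nsmul_eq_mul]
        have : (n : ℝ) * m ≤ n * M := by gcongr
        linarith

/-! ### Negative moments of the Vandermonde weights -/

theorem lintegral_inv_abs_rpow_half_lt_top :
    ∫⁻ u in Icc (-1 : ℝ) 1, (ENNReal.ofReal |u|)⁻¹ ^ (1 / 2 : ℝ) < ∞ := by
  have h1 : IntervalIntegrable (fun u : ℝ => |u| ^ (-(1 / 2) : ℝ)) volume 0 1 := by
    refine (intervalIntegral.intervalIntegrable_rpow' (r := -(1 / 2)) (by norm_num)).congr ?_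
    intro u hu
    rw [uIoc_of_le zero_le_one] at hu
    beta_reduce
    rw [abs_of_pos hu.1]
  have h2 : IntervalIntegrable (fun u : ℝ => |u| ^ (-(1 / 2) : ℝ)) volume (-1) 0 := by
    rw [IntervalIntegrable.iff_comp_neg]
    simpa using h1.symm
  have h3 := (intervalIntegrable_iff_integrableOn_Icc_of_le (by norm_num)).1 (h2.trans h1)
  refine lt_of_le_of_lt (lintegral_mono_ae ?_) h3.lintegral_lt_top
  have h0 : ∀ᵐ u : ℝ ∂(volume.restrict (Icc (-1) 1)), u ≠ 0 := by
    refine ae_restrict_of_ae ?_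
    simp [ae_iff, measure_singleton]
  filter_upwards [h0] with u hu
  rw [← ENNReal.ofReal_inv_of_pos (abs_pos.2 hu), ENNReal.ofReal_rpow_of_nonneg (by positivity)
    (by norm_num), Real.inv_rpow (abs_nonneg _), Real.rpow_neg (abs_nonneg _)]

/-- Small spacings are unlikely because the design density is bounded. -/
theorem exists_lintegral_inv_abs_sub_le {μ : ℝ → ℝ} (hμ : IsDesignDensity μ)
    {M : ℝ} (hM : ∀ x ∈ Icc (0 : ℝ) 1, μ x ≤ M) :
    ∃ C : ℝ≥0∞, C ≠ ∞ ∧ ∀ y : ℝ,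
      ∫⁻ x, (ENNReal.ofReal |x - y|)⁻¹ ^ (1 / 2 : ℝ) ∂(designLaw μ) ≤ C := by
  have := isProbabilityMeasure_designLaw hμ
  set g : ℝ → ℝ≥0∞ := fun u => (ENNReal.ofReal |u|)⁻¹ ^ (1 / 2 : ℝ) with hg
  have hgm : Measurable g := by fun_prop
  set G : ℝ → ℝ≥0∞ := (Icc (-1 : ℝ) 1).indicator g with hG
  have hGm : Measurable G := hgm.indicator measurableSet_Icc
  have hle : ∀ u, g u ≤ 1 + G u := by
    intro u
    by_cases hu : u ∈ Icc (-1 : ℝ) 1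
    · rw [hG, Set.indicator_of_mem hu]
      exact le_add_self
    · have h1 : 1 ≤ |u| := by
        by_contra hlt
        exact hu (abs_le.1 (not_le.1 hlt).le)
      refine le_add_right ?_
      rw [hg]
      refine ENNReal.rpow_le_one ?_ (by norm_num)
      rw [ENNReal.inv_le_one, ENNReal.one_le_ofReal]
      exact h1
  refine ⟨1 + ENNReal.ofReal M * ∫⁻ u in Icc (-1 : ℝ) 1, g u,
    ENNReal.add_ne_top.2 ⟨ENNReal.one_ne_top,
      ENNReal.mul_ne_top ENNReal.ofReal_ne_top lintegral_inv_abs_rpow_half_lt_top.ne⟩, fun y => ?_⟩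
  have hGy : Measurable fun x => G (x - y) := hGm.comp (measurable_id.sub_const y)
  calc ∫⁻ x, g (x - y) ∂(designLaw μ) ≤ ∫⁻ x, (1 + G (x - y)) ∂(designLaw μ) :=
        lintegral_mono fun x => hle _
    _ = 1 + ∫⁻ x, G (x - y) ∂(designLaw μ) := by
        rw [lintegral_add_left measurable_const]
        simp
    _ ≤ _ := by
        gcongr
        rw [designLaw, lintegral_withDensity_eq_lintegral_mul _ hμ.measurable.ennreal_ofReal hGy]
        calc ∫⁻ x in Icc 0 1, ((fun x => ENNReal.ofReal (μ x)) * fun x => G (x - y)) x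
            ≤ ∫⁻ x in Icc 0 1, ENNReal.ofReal M * G (x - y) := by
              refine setLIntegral_mono' measurableSet_Icc fun x hx => ?_
              simp only [Pi.mul_apply]
              have := hM x hx
              gcongr
          _ ≤ ∫⁻ x, ENNReal.ofReal M * G (x - y) := setLIntegral_le_lintegral _ _
          _ = _ := by
              rw [lintegral_const_mul _ hGy, lintegral_sub_right_eq_self, hG,
                lintegral_indicator measurableSet_Icc]

theorem lintegral_designPi_pair_le {μ : ℝ → ℝ} (hμ : IsDesignDensity μ) {C : ℝ≥0∞}
    {g : ℝ → ℝ≥0∞} (hg : Measurable g) (hC : ∀ y : ℝ, ∫⁻ x, g (x - y) ∂(designLaw μ) ≤ C) {n : ℕ}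
    {i j : Fin n} (hij : i ≠ j) : ∫⁻ X, g (X i - X j) ∂(designPi μ n) ≤ C := by
  have := isProbabilityMeasure_designLaw hμ
  have := isProbabilityMeasure_designPi hμ n
  have hind : iIndepFun (fun (i : Fin n) (X : Fin n → ℝ) => X i) (designPi μ n) :=
    iIndepFun_pi (X := fun _ y => y) fun i => by fun_prop
  have hmap := (indepFun_iff_map_prod_eq_prod_map_map (measurable_pi_apply i).aemeasurable
    (measurable_pi_apply j).aemeasurable).1
    (hind.indepFun hij)
  have hmap' : ∀ i : Fin n, Measure.map (fun X : Fin n → ℝ => X i) (designPi μ n) = designLaw μ :=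
    fun i => (measurePreserving_eval (fun _ : Fin n => designLaw μ) i).map_eq
  rw [hmap', hmap'] at hmap
  have hgm : Measurable fun p : ℝ × ℝ => g (p.1 - p.2) :=
    hg.comp (measurable_fst.sub measurable_snd)
  calc ∫⁻ X, g (X i - X j) ∂(designPi μ n)
      = ∫⁻ p, g (p.1 - p.2) ∂((designLaw μ).prod (designLaw μ)) := by
        rw [← hmap, lintegral_map hgm (by fun_prop)]
    _ = ∫⁻ y, ∫⁻ x, g (x - y) ∂(designLaw μ) ∂(designLaw μ) :=
        lintegral_prod_symm' _ hgm
    _ ≤ ∫⁻ y, C ∂(designLaw μ) := lintegral_mono fun y => hC y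
    _ = C := by simp

/-- Functions of disjoint groups of independent coordinates are independent. -/
theorem lintegral_designPi_prod_of_disjoint {μ : ℝ → ℝ} (hμ : IsDesignDensity μ) {n : ℕ}
    {κ : Type*} (s : Finset κ) (S : κ → Finset (Fin n))
    (hS : Pairwise fun k l => Disjoint (S k) (S l))
    {f : κ → (Fin n → ℝ) → ℝ≥0∞} (hf : ∀ k, Measurable (f k))
    (hdep : ∀ k x y, (∀ i ∈ S k, x i = y i) → f k x = f k y) :
    ∫⁻ X, ∏ k ∈ s, f k X ∂(designPi μ n) = ∏ k ∈ s, ∫⁻ X, f k X ∂(designPi μ n) := by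
  classical
  have := isProbabilityMeasure_designLaw hμ
  have := isProbabilityMeasure_designPi hμ n
  have hind : iIndepFun (fun (i : Fin n) (X : Fin n → ℝ) => X i) (designPi μ n) :=
    iIndepFun_pi (X := fun _ y => y) fun i => by fun_prop
  let ext : (T : Finset (Fin n)) → (T → ℝ) → Fin n → ℝ :=
    fun T z i => if h : i ∈ T then z ⟨i, h⟩ else 0
  have hext : ∀ T, Measurable (ext T) := fun T => measurable_pi_lambda _ fun i => by
    by_cases h : i ∈ T
    · simpa [ext, h] using measurable_pi_apply _
    · simp [ext, h]
  have hfe : ∀ (T : Finset (Fin n)) k, S k ⊆ T → ∀ X, f k X = f k (ext T fun i => X i) := by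
    intro T k hT X
    refine hdep k _ _ fun i hi => ?_
    simp [ext, hT hi]
  induction s using Finset.cons_induction with
  | empty => simp
  | cons k s hk ih =>
    simp only [Finset.prod_cons]
    rw [← ih]
    have hdisj : Disjoint (S k) (s.biUnion S) := by
      rw [Finset.disjoint_biUnion_right]
      exact fun l hl => hS fun h => hk (h ▸ hl)
    have h1 := hind.indepFun_finset (S k) (s.biUnion S) hdisj (fun i => measurable_pi_apply i)
    have h2 := h1.comp ((hf k).comp (hext (S k)))
      (Finset.measurable_prod s fun l _ => (hf l).comp (hext (s.biUnion S)))
    have e1 : (f k ∘ ext (S k)) ∘ (fun (X : Fin n → ℝ) (i : S k) => X i) = f k := by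
      ext X
      exact (hfe (S k) k subset_rfl X).symm
    have e2 : (fun z : (s.biUnion S) → ℝ => ∏ l ∈ s, (f l ∘ ext (s.biUnion S)) z)
        ∘ (fun (X : Fin n → ℝ) (i : (s.biUnion S)) => X i) = fun X => ∏ l ∈ s, f l X := by
      ext X
      exact Finset.prod_congr rfl fun l hl =>
        (hfe _ l (Finset.subset_biUnion_of_mem S hl) X).symm
    rw [e1, e2] at h2
    exact lintegral_mul_eq_lintegral_mul_lintegral_of_indepFun (hf k)
      (Finset.measurable_prod s fun l _ => hf l) h2

/-- A bound for the inverse of the Vandermonde weight of one tuple in terms of the inverse square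
roots of the spacings. -/
theorem inv_vandWeight_rpow_le {r n : ℕ} (X : Fin n → ℝ) (t : Fin (r + 1) → Fin n) :
    (ENNReal.ofReal (vandWeight X t))⁻¹ ^ (1 / (2 * (r + 1) ^ 2) : ℝ)
      ≤ 1 + ∑ a, ∑ b ∈ Finset.univ.erase a,
        (ENNReal.ofReal |X (t a) - X (t b)|)⁻¹ ^ (1 / 2 : ℝ) := by
  set F : ℝ≥0∞ := 1 + ∑ a, ∑ b ∈ Finset.univ.erase a,
        (ENNReal.ofReal |X (t a) - X (t b)|)⁻¹ ^ (1 / 2 : ℝ) with hF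
  have hF1 : 1 ≤ F := le_self_add
  have hu : ∀ a, ∀ b ∈ Finset.univ.erase a,
      (F ^ 2)⁻¹ ≤ ENNReal.ofReal |X (t a) - X (t b)| := by
    intro a b hb
    rw [ENNReal.inv_le_iff_inv_le]
    have h1 : (ENNReal.ofReal |X (t a) - X (t b)|)⁻¹ ^ (1 / 2 : ℝ) ≤ F := by
      refine le_trans ?_ (le_add_self : _ ≤ F)
      refine le_trans ?_ (Finset.single_le_sum (f := fun a => ∑ b ∈ Finset.univ.erase a,
        (ENNReal.ofReal |X (t a) - X (t b)|)⁻¹ ^ (1 / 2 : ℝ)) (fun _ _ => zero_le)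
        (Finset.mem_univ a))
      exact Finset.single_le_sum (f := fun b =>
        (ENNReal.ofReal |X (t a) - X (t b)|)⁻¹ ^ (1 / 2 : ℝ)) (fun _ _ => zero_le) hb
    have h2 := pow_le_pow_left' h1 2
    rwa [← ENNReal.rpow_natCast, ← ENNReal.rpow_mul, show (1 / 2 : ℝ) * (2 : ℕ) = 1 by norm_num,
      ENNReal.rpow_one] at h2
  have hinv1 : (F ^ 2)⁻¹ ≤ 1 := ENNReal.inv_le_one.2 (one_le_pow₀ hF1)
  have hV : (F ^ (2 * (r + 1) ^ 2))⁻¹ ≤ ENNReal.ofReal (vandWeight X t) := by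
    rw [vandWeight, ENNReal.ofReal_prod_of_nonneg fun _ _ => Finset.prod_nonneg fun _ _ =>
      abs_nonneg _, pow_mul, ENNReal.inv_pow]
    calc ((F ^ 2)⁻¹) ^ ((r + 1) ^ 2) = ∏ a : Fin (r + 1), ((F ^ 2)⁻¹) ^ (r + 1) := by
          simp [← pow_mul, sq]
      _ ≤ ∏ a : Fin (r + 1), ENNReal.ofReal
            (∏ b ∈ Finset.univ.erase a, |X (t a) - X (t b)|) := by
          refine Finset.prod_le_prod' fun a _ => ?_
          rw [ENNReal.ofReal_prod_of_nonneg fun _ _ => abs_nonneg _]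
          calc ((F ^ 2)⁻¹) ^ (r + 1) ≤ ((F ^ 2)⁻¹) ^ r :=
                pow_le_pow_right_of_le_one' hinv1 (Nat.le_succ r)
            _ = ∏ b ∈ Finset.univ.erase a, (F ^ 2)⁻¹ := by simp
            _ ≤ _ := Finset.prod_le_prod' fun b hb => hu a b hb
  rw [ENNReal.inv_le_iff_inv_le] at hV
  have hq : (0 : ℝ) < 2 * (r + 1) ^ 2 := by positivity
  calc (ENNReal.ofReal (vandWeight X t))⁻¹ ^ (1 / (2 * (r + 1) ^ 2) : ℝ)
      ≤ (F ^ (2 * (r + 1) ^ 2)) ^ (1 / (2 * (r + 1) ^ 2) : ℝ) := by gcongr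
    _ = F := by
        rw [← ENNReal.rpow_natCast, ← ENNReal.rpow_mul]
        push_cast
        rw [mul_one_div_cancel hq.ne', ENNReal.rpow_one]

/-- The sum of the Vandermonde weights has negative moments of any given order as soon as the
sample is large enough: the sum exceeds the weights of a large number of disjoint tuples, which are
independent. -/
theorem exists_lintegral_inv_sum_vandWeight_le {μ : ℝ → ℝ} (hμ : IsDesignDensity μ)
    {M : ℝ} (hM : ∀ x ∈ Icc (0 : ℝ) 1, μ x ≤ M) (r p : ℕ) :
    ∃ C : ℝ≥0∞, C ≠ ∞ ∧ ∃ n₀ : ℕ, ∀ n, n₀ ≤ n →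
      ∫⁻ X, (ENNReal.ofReal (∑ t : Fin (r + 1) → Fin n, vandWeight X t))⁻¹ ^ p ∂(designPi μ n)
        ≤ C := by
  classical
  obtain ⟨C, hC, hCy⟩ := exists_lintegral_inv_abs_sub_le hμ hM
  set m : ℕ := p * (2 * (r + 1) ^ 2) with hm
  refine ⟨(1 + (r + 1) * ((r + 1) * C)) ^ m, ?_, m * (r + 1), fun n hn => ?_⟩
  · refine ENNReal.pow_ne_top (ENNReal.add_ne_top.2 ⟨ENNReal.one_ne_top, ?_⟩)
    have : (r + 1 : ℝ≥0∞) ≠ ∞ := by exact_mod_cast ENNReal.natCast_ne_top (r + 1)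
    exact ENNReal.mul_ne_top this (ENNReal.mul_ne_top this hC)
  have := isProbabilityMeasure_designPi hμ n
  have hlt : ∀ (g : Fin m) (a : Fin (r + 1)), (finProdFinEquiv (g, a) : ℕ) < n := fun g a =>
    (finProdFinEquiv (g, a)).2.trans_le hn
  set t : Fin m → Fin (r + 1) → Fin n := fun g a => ⟨finProdFinEquiv (g, a), hlt g a⟩ with ht
  have htinj : ∀ g a g' a', t g a = t g' a' → g = g' ∧ a = a' := by
    intro g a g' a' h
    have h1 := congrArg Fin.val h
    have h2 := finProdFinEquiv.injective (Fin.ext h1)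
    exact ⟨congrArg Prod.fst h2, congrArg Prod.snd h2⟩
  set f : Fin m → (Fin n → ℝ) → ℝ≥0∞ := fun g X => 1 + ∑ a, ∑ b ∈ Finset.univ.erase a,
        (ENNReal.ofReal |X (t g a) - X (t g b)|)⁻¹ ^ (1 / 2 : ℝ) with hf
  have hgm : Measurable fun u : ℝ => (ENNReal.ofReal |u|)⁻¹ ^ (1 / 2 : ℝ) := by fun_prop
  have hterm : ∀ i j : Fin n, Measurable fun X : Fin n → ℝ =>
      (ENNReal.ofReal |X i - X j|)⁻¹ ^ (1 / 2 : ℝ) := fun i j =>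
    hgm.comp ((measurable_pi_apply i).sub (measurable_pi_apply j))
  have hfm : ∀ g, Measurable (f g) := fun g =>
    Measurable.const_add (Finset.measurable_fun_sum _ fun a _ => Finset.measurable_fun_sum _
      fun b _ => hterm _ _) 1
  have hfE : ∀ g, ∫⁻ X, f g X ∂(designPi μ n) ≤ 1 + (r + 1) * ((r + 1) * C) := by
    intro g
    rw [hf, lintegral_add_left measurable_const]
    simp only [lintegral_const, measure_univ, mul_one]
    gcongr
    rw [lintegral_finsetSum _ fun a _ => Finset.measurable_fun_sum _ fun b _ => hterm _ _]
    refine (Finset.sum_le_card_nsmul _ _ ((r + 1) * C) fun a _ => ?_).trans (by simp)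
    rw [lintegral_finsetSum _ fun b _ => hterm _ _]
    refine (Finset.sum_le_card_nsmul _ _ C fun b hb => ?_).trans ?_
    · refine lintegral_designPi_pair_le hμ hgm hCy fun h => ?_
      exact Finset.ne_of_mem_erase hb (htinj _ _ _ _ h).2.symm
    · simp only [Finset.mem_univ, Finset.card_erase_of_mem, Finset.card_univ, Fintype.card_fin,
        Nat.add_sub_cancel, nsmul_eq_mul]
      gcongr
      exact le_self_add
  calc ∫⁻ X, (ENNReal.ofReal (∑ t : Fin (r + 1) → Fin n, vandWeight X t))⁻¹ ^ p ∂(designPi μ n)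
      ≤ ∫⁻ X, ∏ g, f g X ∂(designPi μ n) := by
        refine lintegral_mono fun X => ?_
        set S := ENNReal.ofReal (∑ t : Fin (r + 1) → Fin n, vandWeight X t) with hS
        have hq : (0 : ℝ) < 2 * (r + 1) ^ 2 := by positivity
        calc S⁻¹ ^ p = (S⁻¹ ^ (1 / (2 * (r + 1) ^ 2) : ℝ)) ^ m := by
              rw [← ENNReal.rpow_natCast, ← ENNReal.rpow_natCast, ← ENNReal.rpow_mul, hm]
              congr 1
              push_cast
              field_simp
          _ = ∏ _g : Fin m, S⁻¹ ^ (1 / (2 * (r + 1) ^ 2) : ℝ) := by simp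
          _ ≤ ∏ g, f g X := by
              refine Finset.prod_le_prod' fun g _ => ?_
              refine le_trans ?_ (inv_vandWeight_rpow_le X (t g))
              refine ENNReal.rpow_le_rpow (ENNReal.inv_le_inv.2 (ENNReal.ofReal_le_ofReal ?_))
                (by positivity)
              exact Finset.single_le_sum (f := fun t => vandWeight X t)
                (fun t _ => vandWeight_nonneg t) (Finset.mem_univ (t g))
    _ = ∏ g, ∫⁻ X, f g X ∂(designPi μ n) := by
        refine lintegral_designPi_prod_of_disjoint hμ _ (fun g => Finset.univ.image (t g)) ?_ hfm ?_
        · intro g g' hgg'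
          rw [Finset.disjoint_left]
          intro i hi hi'
          obtain ⟨a, -, rfl⟩ := Finset.mem_image.1 hi
          obtain ⟨b, -, hb⟩ := Finset.mem_image.1 hi'
          exact hgg' (htinj _ _ _ _ hb).1.symm
        · intro g x y hxy
          have : ∀ a, x (t g a) = y (t g a) := fun a =>
            hxy _ (Finset.mem_image_of_mem _ (Finset.mem_univ a))
          simp only [hf, this]
    _ ≤ _ := by
        refine (Finset.prod_le_prod' fun g _ => hfE g).trans ?_
        simp

/-! ### From moments to losses -/

/-- A loss is at most its value near zero, which is small, plus a multiple of an integer power. -/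
theorem exists_lossExt_le {w : ℝ → ℝ} (hw : IsLoss w) {ε : ℝ} (hε : 0 < ε) :
    ∃ (C : ℝ) (B : ℕ), 1 ≤ B ∧ ∀ z : ℝ≥0∞,
      lossExt w z ≤ ENNReal.ofReal (w ε) + ENNReal.ofReal C * z ^ B := by
  obtain ⟨A, b, hA, hb, hgr⟩ := hw.growth
  have hB : 1 ≤ ⌈b⌉₊ := Nat.ceil_pos.2 hb
  refine ⟨A * (1 + ε ^ b) / ε ^ ⌈b⌉₊, ⌈b⌉₊, hB, fun z => iSup₂_le fun t ht => ?_⟩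
  have ht0 : (0 : ℝ) ≤ t := t.2
  rcases le_or_gt (t : ℝ) ε with hle | hgt
  · exact le_add_right (ENNReal.ofReal_le_ofReal (hw.mono ht0 hε.le hle))
  · refine le_add_left ?_
    have hu : 1 ≤ (t : ℝ) / ε := (one_le_div hε).2 hgt.le
    have h1 : (t : ℝ) ^ b ≤ ε ^ b * (t / ε) ^ ⌈b⌉₊ := by
      have : (t : ℝ) ^ b = ε ^ b * (t / ε) ^ b := by
        rw [← Real.mul_rpow hε.le (by positivity), mul_div_cancel₀ _ hε.ne']
      rw [this, ← Real.rpow_natCast]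
      gcongr
      exact Nat.le_ceil b
    have h2 : w t ≤ A * (1 + ε ^ b) / ε ^ ⌈b⌉₊ * t ^ ⌈b⌉₊ := by
      refine (hgr t ht0).trans ?_
      have h3 : 1 ≤ ((t : ℝ) / ε) ^ ⌈b⌉₊ := one_le_pow₀ hu
      calc A * (1 + (t : ℝ) ^ b) ≤ A * ((t / ε) ^ ⌈b⌉₊ + ε ^ b * (t / ε) ^ ⌈b⌉₊) := by gcongr
        _ = _ := by rw [div_pow]; ring
    refine (ENNReal.ofReal_le_ofReal h2).trans ?_
    rw [ENNReal.ofReal_mul (by positivity), ENNReal.ofReal_pow ht0, ENNReal.ofReal_coe_nnreal]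
    gcongr

/-- The maximal risk tends to zero for every loss function as soon as all moments of the weighted
uniform error tend to zero uniformly over the class. -/
theorem tendsto_maxRisk_of_moments {s L σ : ℝ} {μ : ℝ → ℝ} (hμ : IsDesignDensity μ) {F : Estimator}
    {I : ℕ → Set ℝ} {v : ℕ → ℝ → ℝ}
    (hF : ∀ B, 1 ≤ B → ∃ τ : ℕ → ℝ≥0∞, Tendsto τ atTop (𝓝 0) ∧
      ∀ᶠ n in atTop, ∀ f ∈ holderClass s L,
        ∫⁻ ω, (⨆ x ∈ I n, ENNReal.ofReal (v n x * |F.toFun n (observations f σ ω) x - f x|)) ^ B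
          ∂(sampleLaw μ n) ≤ τ n)
    {w : ℝ → ℝ} (hw : IsLoss w) :
    Tendsto (fun n => maxRisk s L σ μ w F n (I n) (v n)) atTop (𝓝 0) := by
  refine ENNReal.tendsto_nhds_zero.2 fun e he => ?_
  have he2 : 0 < e / 2 := ENNReal.half_pos he.ne'
  have hw0 : Tendsto (fun x => ENNReal.ofReal (w x)) (𝓝[>] 0) (𝓝 0) := by
    simpa using ENNReal.tendsto_ofReal hw.tendsto_zero
  obtain ⟨ε, hε1, hε0⟩ := ((hw0.eventually_le_const he2).and self_mem_nhdsWithin).exists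
  obtain ⟨C, B, hB, hC⟩ := exists_lossExt_le hw (show 0 < ε from hε0)
  obtain ⟨τ, hτ, hFτ⟩ := hF B hB
  have hlim : Tendsto (fun n => ENNReal.ofReal C * τ n) atTop (𝓝 0) := by
    simpa using ENNReal.Tendsto.const_mul hτ (Or.inr ENNReal.ofReal_ne_top)
  filter_upwards [hFτ, hlim.eventually_le_const he2] with n hn hn2
  have := isProbabilityMeasure_sampleLaw hμ n
  refine iSup₂_le fun f hf => ?_
  refine (lintegral_mono fun ω => hC _).trans ?_
  rw [lintegral_add_left measurable_const, lintegral_const_mul' _ _ ENNReal.ofReal_ne_top]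
  simp only [lintegral_const, measure_univ, mul_one]
  calc _ ≤ e / 2 + ENNReal.ofReal C * τ n := by
        gcongr
        exact hn f hf
    _ ≤ e / 2 + e / 2 := by gcongr
    _ = e := ENNReal.add_halves e

/-! ### The estimator attached to a family of cells -/

theorem measurable_localEst (r n : ℕ) (a h : ℝ) : Measurable fun p : (Fin n → ℝ × ℝ) × ℝ =>
    localEst r a h (fun i => (p.1 i).1) (fun i => (p.1 i).2) p.2 := by
  have hX : ∀ i, Measurable fun p : (Fin n → ℝ × ℝ) × ℝ => (p.1 i).1 := fun i =>
    measurable_fst.comp ((measurable_pi_apply i).comp measurable_fst)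
  have hY : ∀ i, Measurable fun p : (Fin n → ℝ × ℝ) × ℝ => (p.1 i).2 := fun i =>
    measurable_snd.comp ((measurable_pi_apply i).comp measurable_fst)
  have hlagr : ∀ (t : Fin (r + 1) → Fin n) (j : Fin (r + 1)),
      Measurable fun p : (Fin n → ℝ × ℝ) × ℝ => lagr ((fun i => (p.1 i).1) ∘ t) j p.2 := fun t j =>
    Finset.measurable_fun_prod _ fun b _ =>
      (measurable_snd.sub (hX (t b))).div ((hX (t j)).sub (hX (t b)))
  have htup : ∀ φ : (Fin n → ℝ) → (Fin (r + 1) → Fin n) → ℝ,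
      (∀ t, Measurable fun p : (Fin n → ℝ × ℝ) × ℝ => φ (fun i => (p.1 i).1) t) →
      Measurable fun p : (Fin n → ℝ × ℝ) × ℝ =>
        tupEst (φ fun i => (p.1 i).1) (fun i => (p.1 i).1) (fun i => (p.1 i).2) p.2 := by
    intro φ hφ
    refine Measurable.div (Finset.measurable_fun_sum _ fun t _ => (hφ t).mul
      (Finset.measurable_fun_sum _ fun j _ => (hlagr t j).mul (hY _)))
      (Finset.measurable_fun_sum _ fun t _ => hφ t)
  have hbox : ∀ t, Measurable fun p : (Fin n → ℝ × ℝ) × ℝ =>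
      boxWeight (r := r) a h (fun i => (p.1 i).1) t := fun t =>
    Finset.measurable_fun_prod _ fun j _ =>
      (measurable_one.indicator (measurableSet_subbin r a h j)).comp (hX _)
  have hvand : ∀ t, Measurable fun p : (Fin n → ℝ × ℝ) × ℝ =>
      vandWeight (r := r) (fun i => (p.1 i).1) t := fun t =>
    Finset.measurable_fun_prod _ fun b _ => Finset.measurable_fun_prod _ fun c _ =>
      ((hX _).sub (hX _)).abs
  unfold localEst
  have hset : MeasurableSet {p : (Fin n → ℝ × ℝ) × ℝ |
      ∑ t : Fin (r + 1) → Fin n, boxWeight a h (fun i => (p.1 i).1) t = 0} :=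
    (Finset.measurable_fun_sum _ fun t _ => hbox t) (measurableSet_singleton 0)
  exact (htup vandWeight hvand).ite hset (htup (boxWeight a h) hbox)

theorem measurable_countable_choice {α : Type*} [MeasurableSpace α] {g : ℕ → α → ℝ}
    (hg : ∀ k, Measurable (g k)) {c : α → ℕ} (hc : Measurable c) :
    Measurable fun p => g (c p) p := by
  have h1 : Measurable fun q : ℕ × α => g q.1 q.2 := measurable_from_prod_countable_right hg
  exact h1.comp (hc.prodMk measurable_id)

/-- The estimator that uses at `x` the window `[a k, a k + h k]` of the cell `k` containing `x`. -/
noncomputable def cellEstimator (r : ℕ) (cell : ℕ → ℝ → ℕ) (hcell : ∀ n, Measurable (cell n))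
    (a h : ℕ → ℕ → ℝ) : Estimator where
  toFun n d x := localEst r (a n (cell n x)) (h n (cell n x)) (fun i => (d i).1)
    (fun i => (d i).2) x
  measurable n := measurable_countable_choice
    (fun k => measurable_localEst r n (a n k) (h n k)) ((hcell n).comp measurable_snd)

/-- The requirements on the cells at a given sample size `n`: `N` cells cover `I`; the weight `v`
is at most `u k` on the cell `k`, whose window starts at `a k` and has length `h k`, and each of
the subintervals of the window has mass at least `m k`. The bias is controlled by `ε` and the noise
by `θ`, where `Λ` bounds the logarithm of the number of cells. -/
structure IsCellDesign (s : ℝ) (μ : ℝ → ℝ) (n N : ℕ) (I : Set ℝ) (v : ℝ → ℝ) (cell : ℝ → ℕ)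
    (a h u m : ℕ → ℝ) (ε θ Λ U : ℝ) : Prop where
  subset : I ⊆ Icc 0 1
  cell_lt : ∀ x ∈ I, cell x < N
  abs_sub_le : ∀ x ∈ I, |x - a (cell x)| ≤ 2 * h (cell x)
  weight_nonneg : ∀ x ∈ I, 0 ≤ v x
  weight_le : ∀ x ∈ I, v x ≤ u (cell x)
  width_pos : ∀ k < N, 0 < h k
  bound_nonneg : ∀ k < N, 0 ≤ u k
  bound_le : ∀ k < N, u k ≤ U
  mass_pos : ∀ k < N, 0 < n * m k
  mass_le : ∀ k < N, ∀ j, m k ≤ (designLaw μ).real (subbin (strictFloor s) (a k) (h k) j)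
  bias_le : ∀ k < N, u k * h k ^ s ≤ ε
  noise_le : ∀ k < N, u k ^ 2 ≤ θ ^ 2 / Λ * (n * m k)
  noise_pos : 0 < θ
  one_le : 1 ≤ Λ
  card_le : (N : ℝ) ≤ Real.exp Λ

/-- The event that all subintervals contain half the expected number of observations. -/
def regularDesign (r : ℕ) {n : ℕ} (N : ℕ) (a h m : ℕ → ℝ) : Set (Fin n → ℝ) :=
  {X | ∀ k < N, ∀ j : Fin (r + 1), n * m k / 2 ≤ binCount (subbin r (a k) (h k) j) X}

/-- Powers are controlled by exponential moments beyond the level `T`. -/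
theorem pow_le_pow_add_exp {g lam T : ℝ} (hg : 0 ≤ g) (hl : 0 < lam) (hT : 0 ≤ T) (B : ℕ) :
    g ^ B ≤ T ^ B + B.factorial / lam ^ B * Real.exp (lam * (2 * g - T)) := by
  rcases le_or_gt g T with h | h
  · have := pow_le_pow_left₀ hg h B
    have : 0 ≤ B.factorial / lam ^ B * Real.exp (lam * (2 * g - T)) := by positivity
    linarith
  · have h1 := Real.pow_div_factorial_le_exp (x := lam * g) (by positivity) B
    have h2 : Real.exp (lam * g) ≤ Real.exp (lam * (2 * g - T)) := by
      gcongr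
      linarith
    have hf : (0 : ℝ) < B.factorial := by exact_mod_cast B.factorial_pos
    have h3 : g ^ B ≤ B.factorial / lam ^ B * Real.exp (lam * (2 * g - T)) := by
      have := h1.trans h2
      rw [div_le_iff₀ hf, mul_pow] at this
      rw [div_mul_eq_mul_div, le_div_iff₀ (by positivity)]
      linarith
    have : 0 ≤ T ^ B := by positivity
    linarith

section cells

variable {s L σ : ℝ} {μ : ℝ → ℝ} {n N : ℕ} {I : Set ℝ} {v : ℝ → ℝ} {cell : ℝ → ℕ}
  {a h u m : ℕ → ℝ} {ε θ Λ U : ℝ}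

/-- Exponential moments of the averaged noise, given a regular design. -/
theorem lintegral_exp_tupEst_noise_le (hc : IsCellDesign s μ n N I v cell a h u m ε θ Λ U)
    {X : Fin n → ℝ} (hX : X ∈ regularDesign (strictFloor s) N a h m) {k : ℕ} (hk : k < N)
    (l : Fin (strictFloor s + 1)) (c : ℝ) :
    ∫⁻ ξ, ENNReal.ofReal (Real.exp (c * |u k * tupEst (r := strictFloor s)
        (boxWeight (a k) (h k) X) X ξ (subbinMid (strictFloor s) (a k) (h k) l)|)) ∂(noisePi n)
      ≤ ENNReal.ofReal (2 * Real.exp (c ^ 2 *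
        ((2 * ((strictFloor s + 1) * lagrBound (strictFloor s)) * θ) ^ 2 / Λ) / 2)) := by
  have hm := hc.mass_le k hk
  have hX' := hX k hk
  generalize strictFloor s = r at *
  set z := subbinMid r (a k) (h k) l with hz
  have hw := hc.width_pos k hk
  have hmp := hc.mass_pos k hk
  have h1 : ∀ ξ : Fin n → ℝ, u k * tupEst (r := r) (boxWeight (a k) (h k) X) X ξ z
      = ∑ i, u k * tupEst (r := r) (boxWeight (a k) (h k) X) X (Pi.single i 1) z * ξ i := by
    intro ξ
    rw [tupEst_eq_sum_single, Finset.mul_sum]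
    exact Finset.sum_congr rfl fun i _ => (mul_assoc _ _ _).symm
  rw [lintegral_congr fun ξ => by rw [h1 ξ]]
  refine lintegral_exp_abs_sum_noisePi_le _ ?_ c
  rw [Finset.sum_congr rfl fun i _ => mul_pow (u k) _ 2, ← Finset.mul_sum]
  have hzmem : |z - a k| ≤ 2 * h k := by
    have := subbin_subset hw.le l (subbinMid_mem (a := a k) hw.le l)
    rw [abs_le]
    exact ⟨by linarith [this.1], by linarith [this.2]⟩
  have h2 := sum_sq_tupEst_single_le (lagrBound_pos r).le (half_pos hmp) hX'
    (fun t ht j => abs_lagr_le_lagrBound hw hzmem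
      (fun j => mem_subbin_of_boxWeight_ne_zero ht j) j)
  have hΛ := hc.one_le
  calc u k ^ 2 * ∑ i, (tupEst (r := r) (boxWeight (a k) (h k) X) X (Pi.single i 1) z) ^ 2
      ≤ (θ ^ 2 / Λ * (n * m k)) * (((r + 1) * lagrBound r) ^ 2 / (n * m k / 2)) := by
        gcongr
        exact hc.noise_le k hk
    _ = 2 * (((r + 1) * lagrBound r) ^ 2 * (θ ^ 2 / Λ)) := by
        generalize (n : ℝ) * m k = q at hmp
        field_simp
    _ ≤ 4 * (((r + 1) * lagrBound r) ^ 2 * (θ ^ 2 / Λ)) := by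
        gcongr
        norm_num
    _ = _ := by ring

/-- The moments of the weighted uniform error on the event of a regular design. -/
theorem exists_lintegral_regular_le (s L σ : ℝ) (hs : 0 < s) (hL : 0 < L) (hσ : 0 < σ) (μ : ℝ → ℝ)
    {B : ℕ} (hB : 1 ≤ B) :
    ∃ C : ℝ, 0 ≤ C ∧ ∀ {n N : ℕ} {I : Set ℝ} {v : ℝ → ℝ} {cell : ℝ → ℕ} {a h u m : ℕ → ℝ}
      {ε θ Λ U : ℝ}, IsCellDesign s μ n N I v cell a h u m ε θ Λ U → 0 ≤ ε →
      ∀ f ∈ holderClass s L, ∀ X : Fin n → ℝ, (∀ i, X i ∈ Icc (0 : ℝ) 1) →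
      X ∈ regularDesign (strictFloor s) N a h m →
      ∫⁻ ξ, (⨆ x ∈ I, ENNReal.ofReal (v x * |localEst (strictFloor s) (a (cell x)) (h (cell x)) X
          (fun i => f (X i) + σ * ξ i) x - f x|)) ^ B ∂(noisePi n)
        ≤ ENNReal.ofReal (C * (ε ^ B + θ ^ B)) := by
  classical
  set r := strictFloor s with hr
  set D := lagrBound r with hD
  have hD0 : 0 < D := lagrBound_pos r
  set K : ℝ := 2 * ((r + 1) * D) with hK
  have hK0 : 0 < K := by positivity
  set c₁ : ℝ := (r + 1) * (D * (L * 3 ^ s)) with hc₁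
  set c₂ : ℝ := (r + 1) * (σ * D) with hc₂
  have hc₁0 : 0 < c₁ := by positivity
  have hc₂0 : 0 < c₂ := by positivity
  refine ⟨2 ^ B * c₁ ^ B + 2 ^ B * c₂ ^ B * (K ^ B * (3 ^ B + B.factorial * (2 * (r + 1)))),
    by positivity, ?_⟩
  intro n N I v cell a h u m ε θ Λ U hc hε f hf X hX01 hX
  have hθ := hc.noise_pos
  have hΛ := hc.one_le
  have hΛ0 : 0 < Λ := by linarith
  set G : ℕ → Fin (r + 1) → (Fin n → ℝ) → (Fin n → ℝ) → ℝ := fun k l X ξ =>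
    u k * tupEst (r := r) (boxWeight (a k) (h k) X) X ξ (subbinMid r (a k) (h k) l) with hG
  -- with this exponent each of the at most `(r + 1) exp Λ` exponential moments is of the order of
  -- `exp (2 Λ)`, and the level `T` is such that the factor `exp (-lam T) = exp (-3 Λ)` absorbs both
  set lam : ℝ := Λ / (K * θ) with hlam
  have hlam0 : 0 < lam := by positivity
  set T : ℝ := 3 * (K * θ) with hT
  have hlT : lam * T = 3 * Λ := by
    rw [hlam, hT]
    field_simp
  set W : (Fin n → ℝ) → (Fin n → ℝ) → ℝ := fun X ξ => T ^ B + (K * θ) ^ B * B.factorial *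
    Real.exp (-(3 * Λ)) * ∑ k ∈ Finset.range N, ∑ l, Real.exp (2 * lam * |G k l X ξ|) with hW
  have hpt : ∀ ξ,
      (⨆ x ∈ I, ENNReal.ofReal (v x * |localEst r (a (cell x)) (h (cell x)) X
          (fun i => f (X i) + σ * ξ i) x - f x|)) ^ B
        ≤ ENNReal.ofReal (2 ^ B * (c₁ * ε) ^ B + 2 ^ B * c₂ ^ B * W X ξ) := by
    intro ξ
    have hB0 : B ≠ 0 := by omega
    rw [ENNReal.iSup_pow_of_ne_zero hB0]
    refine iSup_le fun x => ?_
    rw [ENNReal.iSup_pow_of_ne_zero hB0]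
    refine iSup_le fun hx => ?_
    have hk := hc.cell_lt x hx
    set k := cell x with hkdef
    have hu := hc.bound_nonneg k hk
    rw [← ENNReal.ofReal_pow (mul_nonneg (hc.weight_nonneg x hx) (abs_nonneg _))]
    refine ENNReal.ofReal_le_ofReal ?_
    have herr := abs_localEst_sub_le (ξ := ξ) hs hL.le hσ.le hf hX01 (hc.subset hx)
      (hc.width_pos k hk) (hc.abs_sub_le x hx)
      (fun j => (half_pos (hc.mass_pos k hk)).trans_le (hX k hk j))
    obtain ⟨l₀, -, hl₀⟩ := Finset.exists_max_image (Finset.univ : Finset (Fin (r + 1)))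
      (fun l => |G k l X ξ|) ⟨0, Finset.mem_univ _⟩
    set g := |G k l₀ X ξ| with hg
    have hg0 : 0 ≤ g := abs_nonneg _
    have hy : v x * |localEst r (a k) (h k) X (fun i => f (X i) + σ * ξ i) x - f x|
        ≤ c₁ * ε + c₂ * g := by
      refine (mul_le_mul (hc.weight_le x hx) herr (abs_nonneg _) hu).trans ?_
      rw [mul_add]
      refine add_le_add ?_ ?_
      · rw [Real.mul_rpow (by norm_num) (hc.width_pos k hk).le]
        calc u k * ((r + 1) * (D * (L * (3 ^ s * h k ^ s)))) = c₁ * (u k * h k ^ s) := by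
              rw [hc₁]; ring
          _ ≤ c₁ * ε := by
              gcongr
              exact hc.bias_le k hk
      · rw [Finset.mul_sum]
        refine (Finset.sum_le_card_nsmul _ _ (σ * D * g) fun l _ => ?_).trans (le_of_eq ?_)
        · have := hl₀ l (Finset.mem_univ l)
          rw [hG] at this
          simp only [abs_mul, abs_of_nonneg hu] at this
          calc _ = σ * D * (u k * |tupEst (r := r) (boxWeight (a k) (h k) X) X ξ
                (subbinMid r (a k) (h k) l)|) := by ring
            _ ≤ σ * D * g := by
                refine mul_le_mul_of_nonneg_left (this.trans_eq ?_) (by positivity)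
                rw [hg, hG]
        · simp only [Finset.card_univ, Fintype.card_fin, nsmul_eq_mul, hc₂]
          push_cast
          ring
    have hgW : g ^ B ≤ W X ξ := by
      refine (pow_le_pow_add_exp hg0 hlam0 (T := T) (by positivity) B).trans ?_
      rw [hW]
      refine add_le_add le_rfl ?_
      have e1 : Real.exp (lam * (2 * g - T))
          = Real.exp (-(3 * Λ)) * Real.exp (2 * lam * g) := by
        rw [← Real.exp_add, ← hlT]
        congr 1
        ring
      have e2 : Real.exp (2 * lam * g)
          ≤ ∑ k ∈ Finset.range N, ∑ l, Real.exp (2 * lam * |G k l X ξ|) := by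
        refine le_trans ?_ (Finset.single_le_sum
          (f := fun k => ∑ l, Real.exp (2 * lam * |G k l X ξ|))
          (fun _ _ => Finset.sum_nonneg fun _ _ => (Real.exp_pos _).le) (Finset.mem_range.2 hk))
        exact Finset.single_le_sum (f := fun l => Real.exp (2 * lam * |G k l X ξ|))
          (fun _ _ => (Real.exp_pos _).le) (Finset.mem_univ l₀)
      have e3 : (B.factorial : ℝ) / lam ^ B ≤ (K * θ) ^ B * B.factorial := by
        rw [hlam, div_pow, div_div_eq_mul_div, mul_comm]
        exact div_le_self (by positivity) (one_le_pow₀ hΛ)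
      rw [e1, ← mul_assoc]
      gcongr
    calc _ ≤ (c₁ * ε + c₂ * g) ^ B :=
          pow_le_pow_left₀ (mul_nonneg (hc.weight_nonneg x hx) (abs_nonneg _)) hy B
      _ ≤ 2 ^ (B - 1) * ((c₁ * ε) ^ B + (c₂ * g) ^ B) :=
          add_pow_le (by positivity) (by positivity) B
      _ ≤ 2 ^ B * ((c₁ * ε) ^ B + (c₂ * g) ^ B) := by
          gcongr
          · norm_num
          · omega
      _ = 2 ^ B * (c₁ * ε) ^ B + 2 ^ B * c₂ ^ B * g ^ B := by rw [mul_pow c₂]; ring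
      _ ≤ _ := by gcongr
  have hint : ∫⁻ ξ, ENNReal.ofReal (W X ξ) ∂(noisePi n)
      ≤ ENNReal.ofReal (K ^ B * (3 ^ B + B.factorial * (2 * (r + 1))) * θ ^ B) := by
    have hGm : ∀ k l, Measurable fun ξ : Fin n → ℝ =>
        ENNReal.ofReal (Real.exp (2 * lam * |G k l X ξ|)) := by
      intro k l
      have : Measurable fun ξ : Fin n → ℝ => G k l X ξ := by
        simp only [hG, tupEst]
        fun_prop
      fun_prop
    have h1 : ∀ ξ, ENNReal.ofReal (W X ξ) = ENNReal.ofReal (T ^ B)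
        + ENNReal.ofReal ((K * θ) ^ B * B.factorial * Real.exp (-(3 * Λ)))
          * ∑ k ∈ Finset.range N, ∑ l, ENNReal.ofReal (Real.exp (2 * lam * |G k l X ξ|)) := by
      intro ξ
      rw [hW, ENNReal.ofReal_add (by positivity) (by positivity), ENNReal.ofReal_mul
        (by positivity), ENNReal.ofReal_sum_of_nonneg fun _ _ => Finset.sum_nonneg fun _ _ =>
        (Real.exp_pos _).le]
      congr 2
      exact Finset.sum_congr rfl fun k _ =>
        ENNReal.ofReal_sum_of_nonneg fun _ _ => (Real.exp_pos _).le
    have h2 : ∀ k ∈ Finset.range N, ∀ l, ∫⁻ ξ, ENNReal.ofReal (Real.exp (2 * lam * |G k l X ξ|))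
        ∂(noisePi n) ≤ ENNReal.ofReal (2 * Real.exp (2 * Λ)) := by
      intro k hk l
      refine (lintegral_exp_tupEst_noise_le hc hX (Finset.mem_range.1 hk) l (2 * lam)).trans ?_
      refine ENNReal.ofReal_le_ofReal (le_of_eq ?_)
      congr 2
      rw [← hr, ← hD, ← hK, hlam]
      field_simp
    simp only [h1]
    rw [lintegral_add_left measurable_const, lintegral_const_mul' _ _ ENNReal.ofReal_ne_top,
      lintegral_finsetSum _ fun k _ => Finset.measurable_fun_sum _ fun l _ => hGm k l]
    simp only [lintegral_const, measure_univ, mul_one]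
    have h3 : ∑ k ∈ Finset.range N, ∫⁻ ξ, ∑ l, ENNReal.ofReal (Real.exp (2 * lam * |G k l X ξ|))
        ∂(noisePi n) ≤ ENNReal.ofReal (N * ((r + 1) * (2 * Real.exp (2 * Λ)))) := by
      have : ENNReal.ofReal (N * ((r + 1) * (2 * Real.exp (2 * Λ))))
          = ∑ k ∈ Finset.range N, ∑ l : Fin (r + 1), ENNReal.ofReal (2 * Real.exp (2 * Λ)) := by
        rw [ENNReal.ofReal_mul (by positivity),
          ENNReal.ofReal_mul (p := (r + 1 : ℝ)) (by positivity)]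
        simp only [Finset.sum_const, Finset.card_range, Finset.card_univ, Fintype.card_fin,
          nsmul_eq_mul, ENNReal.ofReal_natCast]
        rw [ENNReal.ofReal_add (by positivity) (by positivity)]
        simp
      rw [this]
      refine Finset.sum_le_sum fun k hk => ?_
      rw [lintegral_finsetSum _ fun l _ => hGm k l]
      exact Finset.sum_le_sum fun l _ => h2 k hk l
    refine (add_le_add le_rfl (mul_le_mul_right h3 _)).trans ?_
    rw [← ENNReal.ofReal_mul (by positivity), ← ENNReal.ofReal_add (by positivity) (by positivity)]
    refine ENNReal.ofReal_le_ofReal ?_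
    have hN := hc.card_le
    calc T ^ B + (K * θ) ^ B * B.factorial * Real.exp (-(3 * Λ))
          * (N * ((r + 1) * (2 * Real.exp (2 * Λ))))
        ≤ T ^ B + (K * θ) ^ B * B.factorial * Real.exp (-(3 * Λ))
          * (Real.exp Λ * ((r + 1) * (2 * Real.exp (2 * Λ)))) := by gcongr
      _ = T ^ B + (K * θ) ^ B * B.factorial * (2 * (r + 1))
          * (Real.exp (-(3 * Λ)) * Real.exp Λ * Real.exp (2 * Λ)) := by ring
      _ = T ^ B + (K * θ) ^ B * B.factorial * (2 * (r + 1)) := by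
          rw [← Real.exp_add, ← Real.exp_add, show -(3 * Λ) + Λ + 2 * Λ = 0 by ring, Real.exp_zero,
            mul_one]
      _ = _ := by
          rw [hT, mul_pow, mul_pow]
          ring
  refine (lintegral_mono fun ξ => hpt ξ).trans ?_
  have h1 : ∀ ξ, ENNReal.ofReal (2 ^ B * (c₁ * ε) ^ B + 2 ^ B * c₂ ^ B * W X ξ)
      = ENNReal.ofReal (2 ^ B * (c₁ * ε) ^ B)
        + ENNReal.ofReal (2 ^ B * c₂ ^ B) * ENNReal.ofReal (W X ξ) := by
    intro ξ
    have hW0 : 0 ≤ W X ξ := by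
      rw [hW]
      positivity
    rw [ENNReal.ofReal_add (by positivity) (by positivity), ENNReal.ofReal_mul
      (p := 2 ^ B * c₂ ^ B) (by positivity)]
  simp only [h1]
  rw [lintegral_add_left measurable_const, lintegral_const_mul' _ _ ENNReal.ofReal_ne_top]
  simp only [lintegral_const, measure_univ, mul_one]
  refine (add_le_add le_rfl (mul_le_mul_right hint _)).trans ?_
  rw [← ENNReal.ofReal_mul (by positivity), ← ENNReal.ofReal_add (by positivity) (by positivity)]
  refine ENNReal.ofReal_le_ofReal ?_
  set A := 2 ^ B * c₁ ^ B
  set A' := 2 ^ B * c₂ ^ B * (K ^ B * (3 ^ B + B.factorial * (2 * (r + 1))))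
  have hA : 0 ≤ A := by positivity
  have hA' : 0 ≤ A' := by positivity
  have hε' : 0 ≤ ε ^ B := by positivity
  have hθ' : 0 ≤ θ ^ B := by positivity
  calc _ = A * ε ^ B + A' * θ ^ B := by rw [mul_pow]; ring
    _ ≤ (A + A') * (ε ^ B + θ ^ B) := by nlinarith [mul_nonneg hA hθ', mul_nonneg hA' hε']

end cells

theorem ENNReal.add_pow_le_two_pow_mul (x y : ℝ≥0∞) (p : ℕ) :
    (x + y) ^ p ≤ 2 ^ p * (x ^ p + y ^ p) := by
  calc (x + y) ^ p ≤ (2 * max x y) ^ p := by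
        gcongr
        rw [two_mul]
        exact add_le_add (le_max_left _ _) (le_max_right _ _)
    _ = 2 ^ p * (max x y) ^ p := mul_pow _ _ _
    _ ≤ _ := by
        gcongr
        rcases le_total x y with h | h
        · rw [max_eq_right h]; exact le_add_self
        · rw [max_eq_left h]; exact le_self_add

theorem ENNReal.mul_le_sq_add_sq (x y : ℝ≥0∞) : x * y ≤ x ^ 2 + y ^ 2 := by
  rcases le_total x y with h | h
  · exact (mul_le_mul_left h y).trans (by rw [← sq]; exact le_add_self)
  · exact (mul_le_mul_right h x).trans (by rw [← sq]; exact le_self_add)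

theorem ENNReal.le_add_inv_mul_sq (t : ℝ≥0∞) {c : ℝ≥0∞} (hc0 : c ≠ 0) (hc : c ≠ ∞) :
    t ≤ c + c⁻¹ * t ^ 2 := by
  rcases le_total t c with h | h
  · exact le_add_right h
  · refine le_add_left ?_
    calc t = c⁻¹ * (c * t) := by rw [← mul_assoc, ENNReal.inv_mul_cancel hc0 hc, one_mul]
      _ ≤ c⁻¹ * t ^ 2 := by
        rw [sq]
        gcongr

/-! ### The risk of the cell estimator -/

section cells

variable {s L σ : ℝ} {μ : ℝ → ℝ} {n N : ℕ} {I : Set ℝ} {v : ℝ → ℝ} {cell : ℝ → ℕ}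
  {a h u m : ℕ → ℝ} {ε θ Λ U : ℝ}

theorem measurableSet_regularDesign (r n N : ℕ) (a h m : ℕ → ℝ) :
    MeasurableSet (regularDesign (n := n) r N a h m) := by
  have : regularDesign (n := n) r N a h m = ⋂ k ∈ Finset.range N, ⋂ j : Fin (r + 1),
      {X | n * m k / 2 ≤ binCount (subbin r (a k) (h k) j) X} := by
    ext X
    simp [regularDesign]
  rw [this]
  refine Finset.measurableSet_biInter _ fun k _ => MeasurableSet.iInter fun j => ?_
  exact measurableSet_le measurable_const (Finset.measurable_fun_sum _ fun i _ =>
    (measurable_one.indicator (measurableSet_subbin r _ _ j)).comp (measurable_pi_apply i))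

/-- Union bound over the subintervals of all windows. -/
theorem designPi_compl_regularDesign_le (hμ : IsDesignDensity μ)
    (hc : IsCellDesign s μ n N I v cell a h u m ε θ Λ U) {b : ℝ} (hb : ∀ k < N, b ≤ n * m k) :
    designPi μ n (regularDesign (strictFloor s) N a h m)ᶜ
      ≤ ENNReal.ofReal (N * ((strictFloor s + 1) * Real.exp (-(b / 10)))) := by
  have hm := hc.mass_le
  generalize strictFloor s = r at *
  have hsub : (regularDesign (n := n) r N a h m)ᶜ ⊆ ⋃ k ∈ Finset.range N, ⋃ j ∈ Finset.univ,
      {X | binCount (subbin r (a k) (h k) j) X < n * m k / 2} := by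
    intro X hX
    simp only [regularDesign, mem_compl_iff, mem_ofPred_eq, not_forall, not_le] at hX
    obtain ⟨k, hk, j, hj⟩ := hX
    simp only [mem_iUnion]
    exact ⟨k, Finset.mem_range.2 hk, j, Finset.mem_univ j, hj⟩
  refine (measure_mono hsub).trans ?_
  have : ENNReal.ofReal (N * ((r + 1) * Real.exp (-(b / 10))))
      = ∑ k ∈ Finset.range N, ∑ j : Fin (r + 1), ENNReal.ofReal (Real.exp (-(b / 10))) := by
    rw [ENNReal.ofReal_mul (by positivity), ENNReal.ofReal_mul (p := (r + 1 : ℝ)) (by positivity)]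
    simp only [Finset.sum_const, Finset.card_range, Finset.card_univ, Fintype.card_fin,
      nsmul_eq_mul, ENNReal.ofReal_natCast]
    rw [ENNReal.ofReal_add (by positivity) (by positivity)]
    simp
  rw [this]
  refine (measure_biUnion_finset_le _ _).trans (Finset.sum_le_sum fun k hk => ?_)
  refine (measure_biUnion_finset_le _ _).trans (Finset.sum_le_sum fun j _ => ?_)
  refine (designPi_binCount_lt_le hμ (measurableSet_subbin r _ _ j)
    (hm k (Finset.mem_range.1 hk) j)).trans (ENNReal.ofReal_le_ofReal ?_)
  have := hb k (Finset.mem_range.1 hk)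
  gcongr

/-- A bound of the weighted uniform error that holds for every design. -/
theorem iSup_error_le_crude (hs : 0 < s) (hL : 0 < L) (hσ : 0 < σ)
    (hc : IsCellDesign s μ n N I v cell a h u m ε θ Λ U) (hU : 0 < U) (hn : 1 ≤ n)
    {f : ℝ → ℝ} (hf : f ∈ holderClass s L) {X : Fin n → ℝ} (hX : ∀ i, X i ∈ Icc (0 : ℝ) 1)
    (ξ : Fin n → ℝ) :
    (⨆ x ∈ I, ENNReal.ofReal (v x * |localEst (strictFloor s) (a (cell x)) (h (cell x)) X
          (fun i => f (X i) + σ * ξ i) x - f x|))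
      ≤ ENNReal.ofReal (U * (strictFloor s + 1)) * ((ENNReal.ofReal (lagrBound (strictFloor s))
        + ENNReal.ofReal (n ^ (strictFloor s + 1)) * (ENNReal.ofReal
          (∑ t : Fin (strictFloor s + 1) → Fin n, vandWeight X t))⁻¹)
        * (ENNReal.ofReal L + ENNReal.ofReal σ * ENNReal.ofReal (∑ i, |ξ i|))) := by
  have hn0 : (0 : ℝ) < n := by exact_mod_cast hn
  set S := ∑ t : Fin (strictFloor s + 1) → Fin n, vandWeight X t with hS
  have hS0 : 0 ≤ S := Finset.sum_nonneg fun t _ => vandWeight_nonneg t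
  -- if no tuple has a positive weight the right-hand side is infinite
  rcases hS0.eq_or_lt with h0 | h0
  · have h1 : ENNReal.ofReal (n ^ (strictFloor s + 1)) ≠ 0 := by
      rw [Ne, ENNReal.ofReal_eq_zero, not_le]
      positivity
    have h2 : ENNReal.ofReal L + ENNReal.ofReal σ * ENNReal.ofReal (∑ i, |ξ i|) ≠ 0 := by
      have : ENNReal.ofReal L ≠ 0 := by
        rw [Ne, ENNReal.ofReal_eq_zero, not_le]
        exact hL
      simp [this]
    have h3 : ENNReal.ofReal (U * (strictFloor s + 1)) ≠ 0 := by
      rw [Ne, ENNReal.ofReal_eq_zero, not_le]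
      positivity
    rw [← h0, ENNReal.ofReal_zero, ENNReal.inv_zero, ENNReal.mul_top h1, add_top,
      ENNReal.top_mul h2, ENNReal.mul_top h3]
    exact le_top
  · have hD := lagrBound_pos (strictFloor s)
    rw [← ENNReal.ofReal_inv_of_pos h0, ← ENNReal.ofReal_mul (by positivity),
      ← ENNReal.ofReal_add (by positivity) (by positivity), ← ENNReal.ofReal_mul hσ.le,
      ← ENNReal.ofReal_add hL.le (by positivity), ← ENNReal.ofReal_mul (by positivity),
      ← ENNReal.ofReal_mul (by positivity)]
    refine iSup₂_le fun x hx => ENNReal.ofReal_le_ofReal ?_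
    have hk := hc.cell_lt x hx
    have := abs_localEst_sub_le_crude (ξ := ξ) hs hL.le hσ.le hf hX (hc.subset hx)
      (hc.width_pos _ hk) (hc.abs_sub_le x hx) h0
    refine (mul_le_mul ((hc.weight_le x hx).trans (hc.bound_le _ hk)) this (abs_nonneg _)
      hU.le).trans (le_of_eq ?_)
    rw [← hS, div_eq_mul_inv]
    ring

/-- The moments of the crude bound grow at most polynomially. -/
theorem exists_lintegral_crude_le (s L σ : ℝ) (hL : 0 < L) (hσ : 0 < σ)
    (hμ : IsDesignDensity μ) {M : ℝ} (hM : ∀ x ∈ Icc (0 : ℝ) 1, μ x ≤ M) {B : ℕ} (hB : 1 ≤ B) :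
    ∃ (C : ℝ) (q n₀ : ℕ) (Ψ : (n : ℕ) → (Fin n → ℝ) → ℝ≥0∞), 0 ≤ C ∧ (∀ n, Measurable (Ψ n)) ∧
      (∀ n, n₀ ≤ n → 1 ≤ n → ∫⁻ X, Ψ n X ∂(designPi μ n) ≤ ENNReal.ofReal (C * n ^ q)) ∧
      ∀ n (X : Fin n → ℝ), ∫⁻ ξ, ((ENNReal.ofReal (lagrBound (strictFloor s))
        + ENNReal.ofReal (n ^ (strictFloor s + 1)) * (ENNReal.ofReal
          (∑ t : Fin (strictFloor s + 1) → Fin n, vandWeight X t))⁻¹)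
        * (ENNReal.ofReal L + ENNReal.ofReal σ * ENNReal.ofReal (∑ i, |ξ i|))) ^ (2 * B)
          ∂(noisePi n) ≤ Ψ n X := by
  generalize strictFloor s = r
  set D := lagrBound r
  have hD : 0 < D := lagrBound_pos r
  set p := 4 * B with hp
  obtain ⟨Cv, hCv, n₀, hv⟩ := exists_lintegral_inv_sum_vandWeight_le hμ hM r p
  obtain ⟨Cn, hCn0, hCn⟩ := exists_lintegral_sum_abs_noise_le (p := p) (by omega)
  lift Cv to ℝ≥0 using hCv
  set A : (n : ℕ) → (Fin n → ℝ) → ℝ≥0∞ := fun n X => ENNReal.ofReal D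
    + ENNReal.ofReal (n ^ (r + 1)) * (ENNReal.ofReal
          (∑ t : Fin (r + 1) → Fin n, vandWeight X t))⁻¹ with hA
  set E : (n : ℕ) → (Fin n → ℝ) → ℝ≥0∞ := fun n ξ =>
    ENNReal.ofReal L + ENNReal.ofReal σ * ENNReal.ofReal (∑ i, |ξ i|) with hE
  set e : ℕ → ℝ := fun n => 2 ^ p * (L ^ p + σ ^ p * (Cn * n ^ (p + 1))) with he
  have he0 : ∀ n, 0 ≤ e n := fun n => by positivity
  have hEint : ∀ n, ∫⁻ ξ, E n ξ ^ p ∂(noisePi n) ≤ ENNReal.ofReal (e n) := by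
    intro n
    calc ∫⁻ ξ, E n ξ ^ p ∂(noisePi n) ≤ ∫⁻ ξ, ENNReal.ofReal (2 ^ p) * (ENNReal.ofReal (L ^ p)
          + ENNReal.ofReal (σ ^ p) * ENNReal.ofReal ((∑ i, |ξ i|) ^ p)) ∂(noisePi n) := by
          refine lintegral_mono fun ξ => (ENNReal.add_pow_le_two_pow_mul _ _ p).trans_eq ?_
          rw [mul_pow, ← ENNReal.ofReal_pow hL.le, ← ENNReal.ofReal_pow hσ.le,
            ← ENNReal.ofReal_pow (Finset.sum_nonneg fun _ _ => abs_nonneg _),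
            ENNReal.ofReal_pow (p := 2) (by norm_num)]
          simp
      _ = ENNReal.ofReal (2 ^ p) * (ENNReal.ofReal (L ^ p) + ENNReal.ofReal (σ ^ p)
            * ∫⁻ ξ, ENNReal.ofReal ((∑ i, |ξ i|) ^ p) ∂(noisePi n)) := by
          rw [lintegral_const_mul' _ _ ENNReal.ofReal_ne_top, lintegral_add_left measurable_const,
            lintegral_const_mul' _ _ ENNReal.ofReal_ne_top]
          simp
      _ ≤ ENNReal.ofReal (2 ^ p) * (ENNReal.ofReal (L ^ p) + ENNReal.ofReal (σ ^ p)
            * ENNReal.ofReal (Cn * n ^ (p + 1))) := by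
          gcongr
          exact hCn n
      _ = ENNReal.ofReal (e n) := by
          rw [← ENNReal.ofReal_mul (by positivity), ← ENNReal.ofReal_add (by positivity)
            (by positivity), ← ENNReal.ofReal_mul (by positivity)]
  have hAm : ∀ n, Measurable (A n) := by
    intro n
    have h1 : ∀ t, Measurable fun X : Fin n → ℝ => vandWeight (r := r) X t := fun t =>
      Finset.measurable_fun_prod _ fun b _ => Finset.measurable_fun_prod _ fun c _ =>
        ((measurable_pi_apply (t b)).sub (measurable_pi_apply (t c))).abs
    have h2 : Measurable fun X : Fin n → ℝ => ∑ t : Fin (r + 1) → Fin n, vandWeight X t :=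
      Finset.measurable_fun_sum _ fun t _ => h1 t
    exact (h2.ennreal_ofReal.inv.const_mul _).const_add _
  refine ⟨2 ^ p * (D ^ p + Cv) + 2 ^ p * (L ^ p + σ ^ p * Cn), (r + 1) * p + (p + 1), n₀,
    fun n X => A n X ^ p + ENNReal.ofReal (e n), by positivity,
    fun n => ((hAm n).pow_const p).add_const _, ?_, ?_⟩
  · intro n hn hn1
    have := isProbabilityMeasure_designPi hμ n
    have hn1' : (1 : ℝ) ≤ n := by exact_mod_cast hn1
    rw [lintegral_add_right _ measurable_const]
    have h1 : ∫⁻ X, A n X ^ p ∂(designPi μ n)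
        ≤ ENNReal.ofReal (2 ^ p * (D ^ p + n ^ ((r + 1) * p) * Cv)) := by
      calc ∫⁻ X, A n X ^ p ∂(designPi μ n) ≤ ∫⁻ X, ENNReal.ofReal (2 ^ p) * (ENNReal.ofReal (D ^ p)
            + ENNReal.ofReal (n ^ ((r + 1) * p)) * (ENNReal.ofReal
          (∑ t : Fin (r + 1) → Fin n, vandWeight X t))⁻¹ ^ p) ∂(designPi μ n) := by
            refine lintegral_mono fun X => (ENNReal.add_pow_le_two_pow_mul _ _ p).trans_eq ?_
            rw [mul_pow, ← ENNReal.ofReal_pow hD.le, ← ENNReal.ofReal_pow (by positivity),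
              ENNReal.ofReal_pow (p := 2) (by norm_num), ← pow_mul]
            simp
        _ = ENNReal.ofReal (2 ^ p) * (ENNReal.ofReal (D ^ p)
            + ENNReal.ofReal (n ^ ((r + 1) * p)) * ∫⁻ X, (ENNReal.ofReal
          (∑ t : Fin (r + 1) → Fin n, vandWeight X t))⁻¹ ^ p ∂(designPi μ n)) := by
            rw [lintegral_const_mul' _ _ ENNReal.ofReal_ne_top, lintegral_add_left measurable_const,
              lintegral_const_mul' _ _ ENNReal.ofReal_ne_top]
            simp
        _ ≤ ENNReal.ofReal (2 ^ p) * (ENNReal.ofReal (D ^ p)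
            + ENNReal.ofReal (n ^ ((r + 1) * p)) * ENNReal.ofReal Cv) := by
            gcongr
            rw [ENNReal.ofReal_coe_nnreal]
            exact hv n hn
        _ = _ := by
            rw [← ENNReal.ofReal_mul (by positivity), ← ENNReal.ofReal_add (by positivity)
              (by positivity), ← ENNReal.ofReal_mul (by positivity)]
    refine (add_le_add h1 (le_of_eq (show ∫⁻ _, ENNReal.ofReal (e n) ∂(designPi μ n)
      = ENNReal.ofReal (e n) by simp))).trans ?_
    rw [← ENNReal.ofReal_add (by positivity) (he0 n)]
    refine ENNReal.ofReal_le_ofReal ?_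
    set Q : ℝ := (n : ℝ) ^ ((r + 1) * p + (p + 1)) with hQ
    have hQ1 : 1 ≤ Q := one_le_pow₀ hn1'
    have hQ2 : (n : ℝ) ^ ((r + 1) * p) ≤ Q := pow_le_pow_right₀ hn1' (by omega)
    have hQ3 : (n : ℝ) ^ (p + 1) ≤ Q := pow_le_pow_right₀ hn1' (by omega)
    have hDp : 0 ≤ D ^ p := by positivity
    have hLp : 0 ≤ L ^ p := by positivity
    calc 2 ^ p * (D ^ p + n ^ ((r + 1) * p) * Cv) + e n
        ≤ 2 ^ p * (D ^ p * Q + Q * Cv) + 2 ^ p * (L ^ p * Q + σ ^ p * (Cn * Q)) := by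
          rw [show e n = 2 ^ p * (L ^ p + σ ^ p * (Cn * n ^ (p + 1))) from rfl]
          have h1 : D ^ p ≤ D ^ p * Q := le_mul_of_one_le_right hDp hQ1
          have h2 : L ^ p ≤ L ^ p * Q := le_mul_of_one_le_right hLp hQ1
          gcongr
      _ = _ := by ring
  · intro n X
    calc ∫⁻ ξ, (A n X * E n ξ) ^ (2 * B) ∂(noisePi n)
        ≤ ∫⁻ ξ, (A n X ^ p + E n ξ ^ p) ∂(noisePi n) := by
          refine lintegral_mono fun ξ => ?_
          rw [mul_pow]
          refine (ENNReal.mul_le_sq_add_sq _ _).trans_eq ?_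
          rw [← pow_mul, ← pow_mul, hp, show 2 * B * 2 = 4 * B by ring]
      _ = A n X ^ p + ∫⁻ ξ, E n ξ ^ p ∂(noisePi n) := by
          rw [lintegral_add_left measurable_const]
          simp
      _ ≤ _ := add_le_add le_rfl (hEint n)

/-- The risk of the cell estimator tends to zero when bias and noise are negligible with respect
to the weights and the windows contain a number of observations growing as a power of `n`. -/
theorem exists_estimator_of_cells (hs : 0 < s) (hL : 0 < L) (hσ : 0 < σ)
    (hμ : IsDesignDensity μ) {M : ℝ} (hM : ∀ x ∈ Icc (0 : ℝ) 1, μ x ≤ M)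
    {I : ℕ → Set ℝ} {v : ℕ → ℝ → ℝ} {cell : ℕ → ℝ → ℕ} (hcell : ∀ n, Measurable (cell n))
    {a h u m : ℕ → ℕ → ℝ} {N : ℕ → ℕ} {ε θ Λ : ℕ → ℝ} {c α : ℝ} (hc : 0 < c) (hα : 0 < α) {p : ℕ}
    (hε : Tendsto ε atTop (𝓝 0)) (hε0 : ∀ᶠ n in atTop, 0 ≤ ε n) (hθ : Tendsto θ atTop (𝓝 0))
    (hN : ∀ᶠ n in atTop, N n ≤ n)
    (hm : ∀ᶠ n : ℕ in atTop, ∀ k < N n, c * (n : ℝ) ^ α ≤ n * m n k)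
    (hcells : ∀ᶠ n : ℕ in atTop, IsCellDesign s μ n (N n) (I n) (v n) (cell n) (a n) (h n) (u n)
      (m n) (ε n) (θ n) (Λ n) ((n : ℝ) ^ p)) :
    ∃ F : Estimator, ∀ w : ℝ → ℝ, IsLoss w →
      Tendsto (fun n => maxRisk s L σ μ w F n (I n) (v n)) atTop (𝓝 0) := by
  refine ⟨cellEstimator (strictFloor s) cell hcell a h, fun w hw =>
    tendsto_maxRisk_of_moments hμ (fun B hB => ?_) hw⟩
  obtain ⟨C₁, hC₁0, hC₁⟩ := exists_lintegral_regular_le s L σ hs hL hσ μ hB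
  obtain ⟨C₂, q, n₀, Ψ, hC₂0, hΨm, hΨ, hΨ'⟩ := exists_lintegral_crude_le s L σ hL hσ hμ hM hB
  set R : ℝ := strictFloor s + 1 with hR
  have hR0 : 0 < R := by positivity
  set Q : ℕ := 2 * B * p + q + 1 with hQ
  set τ : ℕ → ℝ := fun n => C₁ * (ε n ^ B + θ n ^ B)
    + (n ^ Q * (n * (R * Real.exp (-(c * (n : ℝ) ^ α / 10))))
      + R ^ (2 * B) * C₂ * (n : ℝ)⁻¹) with hτ
  refine ⟨fun n => ENNReal.ofReal (τ n), ?_, ?_⟩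
  · rw [← ENNReal.ofReal_zero]
    refine ENNReal.tendsto_ofReal ?_
    have hB0 : B ≠ 0 := by omega
    have t1 : Tendsto (fun n => C₁ * (ε n ^ B + θ n ^ B)) atTop (𝓝 0) := by
      simpa [hB0] using ((hε.pow B).add (hθ.pow B)).const_mul C₁
    have t2 : Tendsto (fun n : ℕ => R ^ (2 * B) * C₂ * (n : ℝ)⁻¹) atTop (𝓝 0) := by
      simpa using tendsto_inv_atTop_nhds_zero_nat (𝕜 := ℝ) |>.const_mul (R ^ (2 * B) * C₂)
    have t3 : Tendsto (fun n : ℕ => (n : ℝ) ^ Q * (n * (R * Real.exp (-(c * (n : ℝ) ^ α / 10)))))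
        atTop (𝓝 0) := by
      have hx : Tendsto (fun n : ℕ => (n : ℝ) ^ α) atTop atTop :=
        (tendsto_rpow_atTop hα).comp tendsto_natCast_atTop_atTop
      have h1 := (tendsto_rpow_mul_exp_neg_mul_atTop_nhds_zero ((Q + 1) / α) (c / 10)
        (by positivity)).comp hx
      have h2 := h1.const_mul R
      rw [mul_zero] at h2
      refine h2.congr fun n => ?_
      simp only [Function.comp]
      rw [← Real.rpow_mul (by positivity), mul_div_cancel₀ _ hα.ne',
        show ((Q : ℝ) + 1) = ((Q + 1 : ℕ) : ℝ) by push_cast; ring, Real.rpow_natCast, pow_succ,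
        show -(c / 10) * (n : ℝ) ^ α = -(c * (n : ℝ) ^ α / 10) by ring]
      ring
    simpa using t1.add (t3.add t2)
  · filter_upwards [hε0, hN, hm, hcells, eventually_ge_atTop n₀, eventually_ge_atTop 1]
      with n hεn hNn hmn hcn hn₀ hn1 f hf
    have hn0 : (0 : ℝ) < n := by exact_mod_cast hn1
    have := isProbabilityMeasure_designPi hμ n
    have hreg := measurableSet_regularDesign (strictFloor s) n (N n) (a n) (h n) (m n)
    set reg := regularDesign (n := n) (strictFloor s) (N n) (a n) (h n) (m n) with hregdef
    have hθn := hcn.noise_pos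
    set z : (Fin n → ℝ) → (Fin n → ℝ) → ℝ≥0∞ := fun X ξ =>
      ⨆ x ∈ I n, ENNReal.ofReal (v n x * |localEst (strictFloor s) (a n (cell n x))
        (h n (cell n x)) X (fun i => f (X i) + σ * ξ i) x - f x|) with hz
    have hstart : ∫⁻ ω, (⨆ x ∈ I n, ENNReal.ofReal (v n x *
        |(cellEstimator (strictFloor s) cell hcell a h).toFun n (observations f σ ω) x - f x|)) ^ B
        ∂(sampleLaw μ n) ≤ ∫⁻ X, ∫⁻ ξ, z X ξ ^ B ∂(noisePi n) ∂(designPi μ n) :=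
      lintegral_sampleLaw_le hμ fun X ξ => z X ξ ^ B
    refine hstart.trans ?_
    set c₀ : ℝ≥0∞ := ENNReal.ofReal (n ^ Q) with hc₀
    have hc₀0 : c₀ ≠ 0 := by
      rw [hc₀, Ne, ENNReal.ofReal_eq_zero, not_le]
      positivity
    set V : ℝ≥0∞ := ENNReal.ofReal (n ^ p * R) ^ (2 * B) with hV
    -- off the regular designs, compare the `B`-th moment with the moment of order `2 * B`
    have hbad : ∀ X : Fin n → ℝ, (∀ i, X i ∈ Icc (0 : ℝ) 1) →
        ∫⁻ ξ, z X ξ ^ B ∂(noisePi n) ≤ c₀ + c₀⁻¹ * (V * Ψ n X) := by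
      intro X hX
      calc ∫⁻ ξ, z X ξ ^ B ∂(noisePi n) ≤ ∫⁻ ξ, (c₀ + c₀⁻¹ * (V * ((ENNReal.ofReal
          (lagrBound (strictFloor s)) + ENNReal.ofReal (n ^ (strictFloor s + 1)) * (ENNReal.ofReal
          (∑ t : Fin (strictFloor s + 1) → Fin n, vandWeight X t))⁻¹)
          * (ENNReal.ofReal L + ENNReal.ofReal σ * ENNReal.ofReal (∑ i, |ξ i|))) ^ (2 * B)))
            ∂(noisePi n) := by
            refine lintegral_mono fun ξ => (ENNReal.le_add_inv_mul_sq _ hc₀0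
              ENNReal.ofReal_ne_top).trans ?_
            rw [← pow_mul, mul_comm B 2, hV, ← mul_pow]
            gcongr
            exact iSup_error_le_crude hs hL hσ hcn (by positivity) hn1 hf hX ξ
        _ = c₀ + c₀⁻¹ * (V * ∫⁻ ξ, ((ENNReal.ofReal
          (lagrBound (strictFloor s)) + ENNReal.ofReal (n ^ (strictFloor s + 1)) * (ENNReal.ofReal
          (∑ t : Fin (strictFloor s + 1) → Fin n, vandWeight X t))⁻¹)
          * (ENNReal.ofReal L + ENNReal.ofReal σ * ENNReal.ofReal (∑ i, |ξ i|))) ^ (2 * B)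
            ∂(noisePi n)) := by
            rw [lintegral_add_left measurable_const, lintegral_const_mul' _ _
              (ENNReal.inv_ne_top.2 hc₀0), lintegral_const_mul' _ _
              (ENNReal.pow_ne_top ENNReal.ofReal_ne_top)]
            simp only [lintegral_const, measure_univ, mul_one, hV]
        _ ≤ _ := by
            gcongr
            exact hΨ' n X
    calc ∫⁻ X, ∫⁻ ξ, z X ξ ^ B ∂(noisePi n) ∂(designPi μ n)
        ≤ ∫⁻ X, (ENNReal.ofReal (C₁ * (ε n ^ B + θ n ^ B))
          + (regᶜ.indicator (fun _ => c₀) X + c₀⁻¹ * (V * Ψ n X))) ∂(designPi μ n) := by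
          refine lintegral_mono_ae ?_
          filter_upwards [ae_mem_Icc_designPi hμ n] with X hX
          by_cases hXr : X ∈ reg
          · exact le_add_right (hC₁ hcn hεn f hf X hX hXr)
          · rw [Set.indicator_of_mem (by exact hXr)]
            exact le_add_left (hbad X hX)
      _ = ENNReal.ofReal (C₁ * (ε n ^ B + θ n ^ B))
          + (c₀ * designPi μ n regᶜ + c₀⁻¹ * (V * ∫⁻ X, Ψ n X ∂(designPi μ n))) := by
          rw [lintegral_add_left measurable_const, lintegral_add_left
            (measurable_const.indicator hreg.compl), lintegral_indicator_const hreg.compl,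
            lintegral_const_mul' _ _ (ENNReal.inv_ne_top.2 hc₀0), lintegral_const_mul' _ _
              (ENNReal.pow_ne_top ENNReal.ofReal_ne_top)]
          simp only [lintegral_const, measure_univ, mul_one, hV]
      _ ≤ ENNReal.ofReal (C₁ * (ε n ^ B + θ n ^ B))
          + (c₀ * ENNReal.ofReal (N n * (R * Real.exp (-(c * (n : ℝ) ^ α / 10))))
            + c₀⁻¹ * (V * ENNReal.ofReal (C₂ * n ^ q))) := by
          gcongr
          · exact designPi_compl_regularDesign_le hμ hcn hmn
          · exact hΨ n hn₀ hn1
      _ ≤ ENNReal.ofReal (τ n) := by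
          rw [hc₀, hV, ← ENNReal.ofReal_inv_of_pos (by positivity),
            ← ENNReal.ofReal_pow (by positivity), ← ENNReal.ofReal_mul (by positivity),
            ← ENNReal.ofReal_mul (by positivity), ← ENNReal.ofReal_mul (by positivity),
            ← ENNReal.ofReal_add (by positivity) (by positivity),
            ← ENNReal.ofReal_add (by positivity) (by positivity)]
          refine ENNReal.ofReal_le_ofReal (add_le_add le_rfl (add_le_add ?_ (le_of_eq ?_)))
          · have : (N n : ℝ) ≤ n := by exact_mod_cast hNn
            gcongr
          · rw [hQ, pow_succ, pow_add, mul_pow, ← pow_mul, mul_comm p]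
            field_simp

end cells

/-! ### The bandwidth -/

section bandwidth

variable {s L σ : ℝ} {μ : ℝ → ℝ} {n : ℕ} {x y : ℝ}

/-- The mass of the interval of radius `h` centred at `x`. -/
noncomputable def ballMass (μ : ℝ → ℝ) (x h : ℝ) : ℝ := (designLaw μ).real (Icc (x - h) (x + h))

theorem ballMass_nonneg (μ : ℝ → ℝ) (x h : ℝ) : 0 ≤ ballMass μ x h := measureReal_nonneg

theorem ballMass_mono (hμ : IsDesignDensity μ) {g h : ℝ}
    (hx : y - h ≤ x - g) (hy : x + g ≤ y + h) : ballMass μ x g ≤ ballMass μ y h := by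
  have := isProbabilityMeasure_designLaw hμ
  exact measureReal_mono (Icc_subset_Icc hx hy)

theorem bandwidth_spec (hs : 0 < s) (hL : 0 < L) (hσ : 0 < σ) (hμ : IsDesignDensity μ)
    (hn : 2 ≤ n) (hx : x ∈ Icc (0 : ℝ) 1) :
    0 < bandwidth s L σ μ n x ∧ 0 < ballMass μ x (bandwidth s L σ μ n x) ∧
      (L * bandwidth s L σ μ n x ^ s) ^ 2 * ballMass μ x (bandwidth s L σ μ n x)
        = σ ^ 2 * (Real.log n / n) := by
  obtain ⟨h0, heq⟩ := bandwidth_mem hs hL hσ hμ hn hx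
  set h := bandwidth s L σ μ n x
  have hn0 : (0 : ℝ) < n := by positivity
  have hlog : 0 < Real.log n := Real.log_pos (by exact_mod_cast hn)
  change L * h ^ s = σ * √(Real.log n / (n * ballMass μ x h)) at heq
  have hp : 0 < L * h ^ s := by positivity
  have hm : 0 < ballMass μ x h := by
    rcases (ballMass_nonneg μ x h).eq_or_lt with h1 | h1
    · rw [← h1] at heq
      simp [hp.ne'] at heq
    · exact h1
  refine ⟨h0, hm, ?_⟩
  rw [heq, mul_pow, Real.sq_sqrt (by positivity)]
  field_simp

theorem sq_mul_ballMass_lt (hs : 0 < s) (hL : 0 < L) (hμ : IsDesignDensity μ) {g h : ℝ}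
    (hg : 0 < g) (hgh : g < h) (hm : 0 < ballMass μ x g) :
    (L * g ^ s) ^ 2 * ballMass μ x g < (L * h ^ s) ^ 2 * ballMass μ x h := by
  have h1 : g ^ s < h ^ s := Real.rpow_lt_rpow hg.le hgh hs
  have h2 : ballMass μ x g ≤ ballMass μ x h := ballMass_mono hμ (by linarith) (by linarith)
  calc (L * g ^ s) ^ 2 * ballMass μ x g < (L * h ^ s) ^ 2 * ballMass μ x g := by gcongr
    _ ≤ _ := by gcongr

theorem bandwidth_le (hs : 0 < s) (hL : 0 < L) (hσ : 0 < σ) (hμ : IsDesignDensity μ)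
    (hn : 2 ≤ n) (hx : x ∈ Icc (0 : ℝ) 1) {t : ℝ} (ht : 0 < t)
    (h : σ ^ 2 * (Real.log n / n) ≤ (L * t ^ s) ^ 2 * ballMass μ x t) :
    bandwidth s L σ μ n x ≤ t := by
  obtain ⟨-, -, heq⟩ := bandwidth_spec hs hL hσ hμ hn hx
  have hn0 : (0 : ℝ) < n := by positivity
  have hlog : 0 < Real.log n := Real.log_pos (by exact_mod_cast hn)
  have hK : 0 < σ ^ 2 * (Real.log n / n) := by positivity
  by_contra! hlt
  have hm : 0 < ballMass μ x t := by
    rcases (ballMass_nonneg μ x t).eq_or_lt with h1 | h1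
    · rw [← h1, mul_zero] at h
      linarith
    · exact h1
  have := sq_mul_ballMass_lt hs hL hμ ht hlt hm
  linarith

theorem le_bandwidth (hs : 0 < s) (hL : 0 < L) (hσ : 0 < σ) (hμ : IsDesignDensity μ)
    (hn : 2 ≤ n) (hx : x ∈ Icc (0 : ℝ) 1) {t : ℝ}
    (h : (L * t ^ s) ^ 2 * ballMass μ x t ≤ σ ^ 2 * (Real.log n / n)) :
    t ≤ bandwidth s L σ μ n x := by
  obtain ⟨h0, hm, heq⟩ := bandwidth_spec hs hL hσ hμ hn hx
  by_contra! hlt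
  have := sq_mul_ballMass_lt hs hL hμ h0 hlt hm
  linarith

/-- The bandwidth is `1`-Lipschitz in the point. -/
theorem bandwidth_le_add_abs_sub (hs : 0 < s) (hL : 0 < L) (hσ : 0 < σ) (hμ : IsDesignDensity μ)
    (hn : 2 ≤ n) (hx : x ∈ Icc (0 : ℝ) 1) (hy : y ∈ Icc (0 : ℝ) 1) :
    bandwidth s L σ μ n x ≤ bandwidth s L σ μ n y + |x - y| := by
  obtain ⟨h0, hm, heq⟩ := bandwidth_spec hs hL hσ hμ hn hy
  set g := bandwidth s L σ μ n y
  have h1 := le_abs_self (x - y)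
  have h2 := neg_abs_le (x - y)
  have hle : g ≤ g + |x - y| := by
    have := abs_nonneg (x - y)
    linarith
  refine bandwidth_le hs hL hσ hμ hn hx (by positivity) ?_
  rw [← heq]
  have h3 : ballMass μ y g ≤ ballMass μ x (g + |x - y|) :=
    ballMass_mono hμ (by linarith) (by linarith)
  gcongr

/-- The cells attached to the bandwidth: the cells form a fine grid of `[P, Q]`, and the window of
a cell has length `δ` times the bandwidth at the grid point. -/
theorem isCellDesign_of_bandwidth (hs : 0 < s) (hL : 0 < L) (hσ : 0 < σ)
    (hμ : IsDesignDensity μ) (hn : 2 ≤ n) {P Q : ℝ} (hP : 0 ≤ P) (hPQ : P ≤ Q) (hQ : Q ≤ 1)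
    {v : ℝ → ℝ} {C₀ : ℝ} (hC₀ : 0 < C₀)
    (hv : ∀ x ∈ Icc P Q, 0 ≤ v x ∧ v x ≤ C₀ * (rate s L σ μ n x)⁻¹)
    {γ c₀ : ℝ} (hc₀ : 0 < c₀)
    (hmass : ∀ x ∈ Icc P Q, ∀ d, 0 < d → d ≤ 1 → ∀ b, 0 ≤ b →
      b + d * bandwidth s L σ μ n x ≤ 1 → x - bandwidth s L σ μ n x ≤ b →
      b + d * bandwidth s L σ μ n x ≤ x + bandwidth s L σ μ n x →
      c₀ * d ^ γ * ballMass μ x (bandwidth s L σ μ n x)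
        ≤ (designLaw μ).real (Icc b (b + d * bandwidth s L σ μ n x)))
    {Hm U δ Λ : ℝ} (hHm : 0 < Hm) (hHm' : ∀ x ∈ Icc P Q, Hm ≤ bandwidth s L σ μ n x)
    (hH : ∀ x ∈ Icc P Q, bandwidth s L σ μ n x ≤ 1 / 2)
    (hU : ∀ x ∈ Icc P Q, C₀ * 2 ^ s / (L * bandwidth s L σ μ n x ^ s) ≤ U)
    (hδ : 0 < δ) (hδ1 : δ ≤ 1) (hΛ : 1 ≤ Λ)
    (hcard : (⌊(Q - P) / (δ * Hm / 2)⌋₊ + 1 : ℝ) ≤ Real.exp Λ) :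
    IsCellDesign s μ n (⌊(Q - P) / (δ * Hm / 2)⌋₊ + 1) (Icc P Q) v
      (fun x => ⌊(x - P) / (δ * Hm / 2)⌋₊)
      (fun k => if P + k * (δ * Hm / 2) ≤ 1 / 2 then P + k * (δ * Hm / 2) else
        P + k * (δ * Hm / 2) - δ * bandwidth s L σ μ n (P + k * (δ * Hm / 2)))
      (fun k => δ * bandwidth s L σ μ n (P + k * (δ * Hm / 2)))
      (fun k => C₀ * 2 ^ s / (L * bandwidth s L σ μ n (P + k * (δ * Hm / 2)) ^ s))
      (fun k => c₀ * (δ / (2 * strictFloor s + 1)) ^ γ *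
        ballMass μ (P + k * (δ * Hm / 2)) (bandwidth s L σ μ n (P + k * (δ * Hm / 2))))
      (C₀ * 2 ^ s / L * δ ^ s)
      (√(C₀ ^ 2 * (2 ^ s) ^ 2 * (2 * strictFloor s + 1) ^ γ / (c₀ * σ ^ 2)
        * (Λ / (δ ^ γ * Real.log n)))) Λ U := by
  set Δ := δ * Hm / 2 with hΔ
  have hΔ0 : 0 < Δ := by positivity
  set H : ℝ → ℝ := bandwidth s L σ μ n with hHdef
  have hsub : Icc P Q ⊆ Icc 0 1 := Icc_subset_Icc hP hQ
  have hspec := fun x (hx : x ∈ Icc P Q) => bandwidth_spec hs hL hσ hμ hn (hsub hx)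
  have hn0 : (0 : ℝ) < n := by positivity
  have hlog : 0 < Real.log n := Real.log_pos (by exact_mod_cast hn)
  -- the grid points belong to the interval
  have hgrid : ∀ k < ⌊(Q - P) / Δ⌋₊ + 1, P + k * Δ ∈ Icc P Q := by
    intro k hk
    have h1 : (k : ℝ) ≤ (Q - P) / Δ :=
      (Nat.cast_le.2 (Nat.lt_succ_iff.1 hk)).trans (Nat.floor_le (div_nonneg (by linarith) hΔ0.le))
    rw [le_div_iff₀ hΔ0] at h1
    have : 0 ≤ (k : ℝ) * Δ := by positivity
    exact ⟨by linarith, by linarith⟩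
  have hcell : ∀ x ∈ Icc P Q, ⌊(x - P) / Δ⌋₊ < ⌊(Q - P) / Δ⌋₊ + 1 := by
    intro x hx
    refine Nat.lt_succ_of_le (Nat.floor_le_floor ?_)
    have := hx.2
    gcongr
  have hnear : ∀ x ∈ Icc P Q, P + ⌊(x - P) / Δ⌋₊ * Δ ≤ x ∧ x ≤ P + ⌊(x - P) / Δ⌋₊ * Δ + Δ := by
    intro x hx
    have h1 := Nat.floor_le (div_nonneg (sub_nonneg.2 hx.1) hΔ0.le)
    have h2 := (Nat.lt_floor_add_one ((x - P) / Δ)).le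
    rw [le_div_iff₀ hΔ0] at h1
    rw [div_le_iff₀ hΔ0] at h2
    constructor <;> linarith
  have hΔH : ∀ x ∈ Icc P Q, Δ ≤ H x / 2 ∧ Δ ≤ δ * H x := by
    intro x hx
    have h1 : δ * Hm ≤ 1 * Hm := by gcongr
    have h2 : δ * Hm ≤ δ * H x := by
      have := hHm' x hx
      gcongr
    have h3 : 0 < δ * Hm := by positivity
    have h4 := hHm' x hx
    constructor <;> linarith
  refine
    { subset := hsub
      cell_lt := hcell
      abs_sub_le := ?_
      weight_nonneg := fun x hx => (hv x hx).1
      weight_le := ?_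
      width_pos := fun k hk => mul_pos hδ (hspec _ (hgrid k hk)).1
      bound_nonneg := fun k hk => ?_
      bound_le := fun k hk => hU _ (hgrid k hk)
      mass_pos := fun k hk => ?_
      mass_le := fun k hk j => ?_
      bias_le := fun k hk => ?_
      noise_le := fun k hk => ?_
      noise_pos := by positivity
      one_le := hΛ
      card_le := by push_cast; exact hcard }
  · intro x hx
    obtain ⟨h1, h2⟩ := hnear x hx
    have h3 := (hΔH _ (hgrid _ (hcell x hx))).2
    have h4 : 0 < δ * H (P + ⌊(x - P) / Δ⌋₊ * Δ) :=
      mul_pos hδ (hspec _ (hgrid _ (hcell x hx))).1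
    rw [abs_le]
    split_ifs <;> constructor <;> linarith
  · intro x hx
    obtain ⟨h1, h2⟩ := hnear x hx
    have hk := hgrid _ (hcell x hx)
    have h3 := (hΔH _ hk).1
    set z := P + ⌊(x - P) / Δ⌋₊ * Δ with hz
    have h4 : H z ≤ H x + |z - x| := bandwidth_le_add_abs_sub hs hL hσ hμ hn (hsub hk) (hsub hx)
    have h5 : |z - x| ≤ Δ := abs_le.2 ⟨by linarith, by linarith⟩
    have hz0 : 0 < H z := (hspec z hk).1
    have h6 : H z / 2 ≤ H x := by linarith
    refine (hv x hx).2.trans ?_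
    rw [rate, mul_div_assoc]
    gcongr C₀ * ?_
    have h7 : (H z / 2) ^ s ≤ H x ^ s := by gcongr
    rw [Real.div_rpow hz0.le (by norm_num)] at h7
    have h8 : 0 < H z ^ s := by positivity
    have h9 : (0 : ℝ) < 2 ^ s := by positivity
    calc (L * H x ^ s)⁻¹ ≤ (L * (H z ^ s / 2 ^ s))⁻¹ := by gcongr
      _ = _ := by field_simp
  · have := (hspec _ (hgrid k hk)).1
    positivity
  · have := (hspec _ (hgrid k hk)).2.1
    positivity
  · have hz := hgrid k hk
    set z := P + k * Δ with hzdef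
    have hz0 : 0 < H z := (hspec z hz).1
    have hr : (0 : ℝ) < 2 * strictFloor s + 1 := by positivity
    have hw : 0 < δ * H z := by positivity
    have hwH : δ * H z ≤ H z := mul_le_of_le_one_left hz0.le hδ1
    have hH2 := hH z hz
    have hz01 := hsub hz
    set A := if z ≤ 1 / 2 then z else z - δ * H z with hA
    have hA1 : 0 ≤ A ∧ A + δ * H z ≤ 1 ∧ z - H z ≤ A ∧ A + δ * H z ≤ z + H z := by
      rw [hA]
      have := hz01.1
      have := hz01.2
      have : H z ≤ 1 / 2 := hH2
      split_ifs with hcase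
      · refine ⟨?_, ?_, ?_, ?_⟩ <;> linarith
      · refine ⟨?_, ?_, ?_, ?_⟩ <;> linarith
    have hin := subbin_subset (r := strictFloor s) (a := A) hw.le j
    have hle : A + 2 * j * (δ * H z / (2 * strictFloor s + 1))
        ≤ A + (2 * j + 1) * (δ * H z / (2 * strictFloor s + 1)) := by
      gcongr
      linarith
    rw [subbin, Icc_subset_Icc_iff hle] at hin
    have e1 : A + (2 * j + 1) * (δ * H z / (2 * strictFloor s + 1))
        = A + 2 * j * (δ * H z / (2 * strictFloor s + 1))
          + δ / (2 * strictFloor s + 1) * H z := by ring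
    have hd1 : δ / (2 * strictFloor s + 1) ≤ 1 := by
      rw [div_le_one hr]
      have : (0 : ℝ) ≤ strictFloor s := by positivity
      linarith
    have := hmass z hz (δ / (2 * strictFloor s + 1)) (by positivity) hd1
      (A + 2 * j * (δ * H z / (2 * strictFloor s + 1))) (by linarith [hin.1])
      (by rw [← e1]; linarith [hin.2]) (by linarith [hin.1])
      (by rw [← e1]; linarith [hin.2])
    rw [subbin, e1]
    exact this
  · have hz0 : 0 < H (P + k * Δ) := (hspec _ (hgrid k hk)).1
    rw [Real.mul_rpow hδ.le hz0.le]
    have : 0 < H (P + k * Δ) ^ s := by positivity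
    exact le_of_eq (by field_simp)
  · obtain ⟨hz0, hm0, heq⟩ := hspec _ (hgrid k hk)
    set z := P + k * Δ with hzdef
    change 0 < ballMass μ z (H z) at hm0
    change (L * H z ^ s) ^ 2 * ballMass μ z (H z) = _ at heq
    change (C₀ * 2 ^ s / (L * H z ^ s)) ^ 2 ≤ _
    change 0 < H z at hz0
    have hz1 : 0 < H z ^ s := by positivity
    rw [Real.sq_sqrt (by positivity), Real.div_rpow hδ.le (by positivity)]
    have e2 : ballMass μ z (H z) = σ ^ 2 * (Real.log n / n) / (L * H z ^ s) ^ 2 := by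
      rw [← heq]
      field_simp
    rw [e2]
    have hδγ : 0 < δ ^ γ := by positivity
    have hrγ : 0 < (2 * (strictFloor s : ℝ) + 1) ^ γ := by positivity
    exact le_of_eq (by field_simp)

end bandwidth

/-! ### Estimation at a rate faster than the bandwidth gives -/

/-- Estimation at a rate faster than the rate given by the bandwidth, on intervals whose length
exceeds the smallest bandwidth by a subpolynomial factor only. The factor `δ n` by which the windows
are shorter than the bandwidth tends to zero so slowly that the variance gains from the small number
of cells. -/
theorem exists_estimator_of_bandwidth {s L σ : ℝ} {μ : ℝ → ℝ} (hs : 0 < s) (hL : 0 < L)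
    (hσ : 0 < σ) (hμ : IsDesignDensity μ) {M : ℝ} (hM : ∀ x ∈ Icc (0 : ℝ) 1, μ x ≤ M)
    {P Q : ℕ → ℝ} (hPQ : ∀ᶠ n in atTop, 0 ≤ P n ∧ P n ≤ Q n ∧ Q n ≤ 1)
    {v : ℕ → ℝ → ℝ} {C₀ : ℝ} (hC₀ : 0 < C₀)
    (hv : ∀ᶠ n in atTop, ∀ x ∈ Icc (P n) (Q n), 0 ≤ v n x ∧ v n x ≤ C₀ * (rate s L σ μ n x)⁻¹)
    {γ c₀ : ℝ} (hγ : 1 ≤ γ) (hc₀ : 0 < c₀)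
    (hmass : ∀ᶠ n in atTop, ∀ x ∈ Icc (P n) (Q n), ∀ d, 0 < d → d ≤ 1 → ∀ b, 0 ≤ b →
      b + d * bandwidth s L σ μ n x ≤ 1 → x - bandwidth s L σ μ n x ≤ b →
      b + d * bandwidth s L σ μ n x ≤ x + bandwidth s L σ μ n x →
      c₀ * d ^ γ * ballMass μ x (bandwidth s L σ μ n x)
        ≤ (designLaw μ).real (Icc b (b + d * bandwidth s L σ μ n x)))
    {κ : ℝ} (hκ : 0 < κ)
    (hH : ∀ᶠ n : ℕ in atTop, ∀ x ∈ Icc (P n) (Q n), bandwidth s L σ μ n x ≤ (n : ℝ) ^ (-κ))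
    {Hm : ℕ → ℝ} {p₀ : ℝ} (hHm : ∀ᶠ n : ℕ in atTop, (n : ℝ) ^ (-p₀) ≤ Hm n)
    (hHm' : ∀ᶠ n : ℕ in atTop, ∀ x ∈ Icc (P n) (Q n), Hm n ≤ bandwidth s L σ μ n x)
    (hlen : (fun n => Real.log (1 + (Q n - P n) / Hm n)) =o[atTop] fun n : ℕ => Real.log n) :
    ∃ F : Estimator, ∀ w : ℝ → ℝ, IsLoss w →
      Tendsto (fun n => maxRisk s L σ μ w F n (Icc (P n) (Q n)) (v n)) atTop (𝓝 0) := by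
  have hγ0 : 0 < γ := by linarith
  -- `Λ` bounds the logarithm of the number of cells and `η` is its negligible ratio to `log n`; the
  -- power of `η` in the definition of `δ` makes the noise level `√(η / δ ^ γ)` tend to zero as well
  set Λ : ℕ → ℝ := fun n => 2 + Real.log (1 + (Q n - P n) / Hm n) + Real.log (Real.log n) with hΛ
  set η : ℕ → ℝ := fun n => Λ n / Real.log n with hη
  set δ : ℕ → ℝ := fun n => η n ^ (1 / (2 * γ)) with hδ
  set c₃ : ℝ := C₀ ^ 2 * (2 ^ s) ^ 2 * (2 * strictFloor s + 1) ^ γ / (c₀ * σ ^ 2) with hc₃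
  set c₄ : ℝ := c₀ * (1 / (2 * strictFloor s + 1)) ^ γ * (σ ^ 2 / L ^ 2) with hc₄
  have hc₄0 : 0 < c₄ := by positivity
  have hcast : Tendsto (fun n : ℕ => (n : ℝ)) atTop atTop := tendsto_natCast_atTop_atTop
  have hlogt : Tendsto (fun n : ℕ => Real.log n) atTop atTop := Real.tendsto_log_atTop.comp hcast
  have hη0 : Tendsto η atTop (𝓝 0) := by
    have h1 : (fun _ : ℕ => (2 : ℝ)) =o[atTop] fun n : ℕ => Real.log n :=
      isLittleO_const_left.2 (Or.inr (tendsto_norm_atTop_atTop.comp hlogt))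
    have h2 : (fun n : ℕ => Real.log (Real.log n)) =o[atTop] fun n : ℕ => Real.log n :=
      Real.isLittleO_log_id_atTop.comp_tendsto hlogt
    exact ((h1.add hlen).add h2).tendsto_div_nhds_zero
  have hδ0 : Tendsto δ atTop (𝓝 0) := by
    have := hη0.rpow_const (p := 1 / (2 * γ)) (Or.inr (by positivity))
    rwa [Real.zero_rpow (by positivity)] at this
  -- facts that hold for large `n`
  have hbase : ∀ᶠ n : ℕ in atTop, 2 ≤ n ∧ 1 ≤ Real.log n ∧ 0 ≤ Real.log (Real.log n) ∧
      0 ≤ Real.log (1 + (Q n - P n) / Hm n) ∧ 0 < Hm n ∧ 1 ≤ Λ n ∧ 0 < η n ∧ η n ≤ 1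
      ∧ 0 < δ n ∧ δ n ≤ 1 ∧ δ n ^ γ = η n ^ (1 / 2 : ℝ) ∧ (δ n)⁻¹ ≤ Real.log n := by
    filter_upwards [eventually_ge_atTop 2, hlogt.eventually_ge_atTop 1, hPQ, hHm,
      hη0.eventually_le_const one_pos] with n hn hl hpq hHmn hη1
    have hn0 : (0 : ℝ) < n := by positivity
    have hHm0 : 0 < Hm n := (Real.rpow_pos_of_pos hn0 _).trans_le hHmn
    have hll : 0 ≤ Real.log (Real.log n) := Real.log_nonneg hl
    have hlg : 0 ≤ Real.log (1 + (Q n - P n) / Hm n) := by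
      refine Real.log_nonneg ?_
      have : 0 ≤ (Q n - P n) / Hm n := div_nonneg (by linarith [hpq.2.1]) hHm0.le
      linarith
    have hΛ1 : 1 ≤ Λ n := by simp only [hΛ]; linarith
    have hηp : 0 < η n := by simp only [hη]; positivity
    have hδp : 0 < δ n := by simp only [hδ]; positivity
    refine ⟨hn, hl, hll, hlg, hHm0, hΛ1, hηp, hη1, hδp, ?_, ?_, ?_⟩
    · exact Real.rpow_le_one hηp.le hη1 (by positivity)
    · simp only [hδ]
      rw [← Real.rpow_mul hηp.le]
      congr 1
      field_simp
    · have hηl : (Real.log n)⁻¹ ≤ η n := by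
        simp only [hη]
        rw [inv_eq_one_div]
        gcongr
      have h1 : (Real.log n)⁻¹ ≤ δ n := by
        refine hηl.trans ?_
        simp only [hδ]
        conv_lhs => rw [← Real.rpow_one (η n)]
        refine Real.rpow_le_rpow_of_exponent_ge hηp hη1 ?_
        rw [div_le_one (by positivity)]
        linarith
      exact inv_le_of_inv_le₀ (by linarith) h1
  have hpoly : ∀ᶠ n : ℕ in atTop, ∀ x ∈ Icc (P n) (Q n),
      C₀ * 2 ^ s / (L * bandwidth s L σ μ n x ^ s) ≤ (n : ℝ) ^ (⌈p₀ * s⌉₊ + 1) := by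
    filter_upwards [hbase, hHm, hHm', hcast.eventually_ge_atTop (C₀ * 2 ^ s / L)]
      with n hb hHmn hHmn' hnC x hx
    have hn1 : (1 : ℝ) ≤ n := by exact_mod_cast (by omega : 1 ≤ n)
    have hn0 : (0 : ℝ) < n := by linarith
    have h1 : ((n : ℝ) ^ (-p₀)) ^ s ≤ bandwidth s L σ μ n x ^ s := by
      have := hHmn.trans (hHmn' x hx)
      gcongr
    have h2 : 0 < ((n : ℝ) ^ (-p₀)) ^ s := by positivity
    calc C₀ * 2 ^ s / (L * bandwidth s L σ μ n x ^ s)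
        ≤ C₀ * 2 ^ s / (L * ((n : ℝ) ^ (-p₀)) ^ s) := by gcongr
      _ = C₀ * 2 ^ s / L * (n : ℝ) ^ (p₀ * s) := by
          rw [← Real.rpow_mul hn0.le, neg_mul, Real.rpow_neg hn0.le]
          field_simp
      _ ≤ n * (n : ℝ) ^ ⌈p₀ * s⌉₊ := by
          rw [← Real.rpow_natCast]
          gcongr
          exact Nat.le_ceil _
      _ = _ := by ring
  have hcard : ∀ᶠ n : ℕ in atTop,
      (⌊(Q n - P n) / (δ n * Hm n / 2)⌋₊ + 1 : ℝ) ≤ Real.exp (Λ n) := by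
    filter_upwards [hbase, hPQ] with n hb hpq
    obtain ⟨hn, hl, hll, hlg, hHm0, hΛ1, hηp, hη1, hδp, hδ1, hδγ, hδl⟩ := hb
    have hy : 0 ≤ (Q n - P n) / Hm n := div_nonneg (by linarith [hpq.2.1]) hHm0.le
    have h1 : (Q n - P n) / (δ n * Hm n / 2) = 2 * ((Q n - P n) / Hm n) * (δ n)⁻¹ := by
      field_simp
    have h2 : Real.exp (Λ n) = Real.exp 2 * (1 + (Q n - P n) / Hm n) * Real.log n := by
      simp only [hΛ]
      rw [Real.exp_add, Real.exp_add, Real.exp_log (by linarith), Real.exp_log (by linarith)]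
    have h3 : (2 : ℝ) ≤ Real.exp 2 := by
      have := Real.add_one_le_exp (2 : ℝ)
      linarith
    calc (⌊(Q n - P n) / (δ n * Hm n / 2)⌋₊ + 1 : ℝ)
        ≤ 2 * ((Q n - P n) / Hm n) * (δ n)⁻¹ + 1 := by
          rw [← h1]
          gcongr
          exact Nat.floor_le (div_nonneg (by linarith [hpq.2.1]) (by positivity))
      _ ≤ 2 * ((Q n - P n) / Hm n) * Real.log n + 2 * Real.log n := by
          gcongr
          linarith
      _ = 2 * (1 + (Q n - P n) / Hm n) * Real.log n := by ring
      _ ≤ _ := by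
          rw [h2]
          gcongr
  refine exists_estimator_of_cells hs hL hσ hμ hM
    (cell := fun n x => ⌊(x - P n) / (δ n * Hm n / 2)⌋₊)
    (a := fun n k => if P n + k * (δ n * Hm n / 2) ≤ 1 / 2 then P n + k * (δ n * Hm n / 2) else
        P n + k * (δ n * Hm n / 2) - δ n * bandwidth s L σ μ n (P n + k * (δ n * Hm n / 2)))
    (h := fun n k => δ n * bandwidth s L σ μ n (P n + k * (δ n * Hm n / 2)))
    (u := fun n k => C₀ * 2 ^ s / (L * bandwidth s L σ μ n (P n + k * (δ n * Hm n / 2)) ^ s))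
    (m := fun n k => c₀ * (δ n / (2 * strictFloor s + 1)) ^ γ *
        ballMass μ (P n + k * (δ n * Hm n / 2))
          (bandwidth s L σ μ n (P n + k * (δ n * Hm n / 2))))
    (N := fun n => ⌊(Q n - P n) / (δ n * Hm n / 2)⌋₊ + 1)
    (ε := fun n => C₀ * 2 ^ s / L * δ n ^ s)
    (θ := fun n => √(c₃ * (Λ n / (δ n ^ γ * Real.log n))))
    (Λ := Λ) (c := c₄) (α := 2 * s * κ) (p := ⌈p₀ * s⌉₊ + 1)
    (fun n => ?_) hc₄0 (by positivity) ?_ ?_ ?_ ?_ ?_ ?_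
  · exact Nat.measurable_floor.comp ((measurable_id.sub_const _).div_const _)
  · have := (hδ0.rpow_const (p := s) (Or.inr hs.le)).const_mul (C₀ * 2 ^ s / L)
    rwa [Real.zero_rpow hs.ne', mul_zero] at this
  · filter_upwards [hbase] with n hb
    have := hb.2.2.2.2.2.2.2.2.1
    positivity
  · have h1 : Tendsto (fun n => √(c₃ * η n ^ (1 / 2 : ℝ))) atTop (𝓝 0) := by
      have h2 := (hη0.rpow_const (p := 1 / 2) (Or.inr (by norm_num))).const_mul c₃
      rw [Real.zero_rpow (by norm_num), mul_zero] at h2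
      simpa using h2.sqrt
    refine h1.congr' ?_
    filter_upwards [hbase] with n hb
    obtain ⟨hn, hl, hll, hlg, hHm0, hΛ1, hηp, hη1, hδp, hδ1, hδγ, hδl⟩ := hb
    rw [hδγ]
    congr 2
    have : Λ n / (η n ^ (1 / 2 : ℝ) * Real.log n) = η n / η n ^ (1 / 2 : ℝ) := by
      simp only [hη]
      rw [mul_comm, div_mul_eq_div_div]
    rw [this, eq_div_iff (by positivity), ← Real.rpow_add hηp]
    norm_num
  · filter_upwards [hbase, hcard] with n hb hc
    obtain ⟨hn, hl, hll, hlg, hHm0, hΛ1, hηp, hη1, hδp, hδ1, hδγ, hδl⟩ := hb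
    have h1 : Λ n ≤ Real.log n := by
      simp only [hη] at hη1
      rwa [div_le_one (by linarith)] at hη1
    have h2 : Real.exp (Λ n) ≤ n := by
      refine (Real.exp_le_exp.2 h1).trans_eq (Real.exp_log ?_)
      positivity
    exact_mod_cast hc.trans h2
  · filter_upwards [hbase, hPQ, hH] with n hb hpq hHn k hk
    obtain ⟨hn, hl, hll, hlg, hHm0, hΛ1, hηp, hη1, hδp, hδ1, hδγ, hδl⟩ := hb
    have hn0 : (0 : ℝ) < n := by positivity
    have hz : P n + k * (δ n * Hm n / 2) ∈ Icc (P n) (Q n) := by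
      have hΔ0 : 0 < δ n * Hm n / 2 := by positivity
      have h1 : (k : ℝ) ≤ (Q n - P n) / (δ n * Hm n / 2) :=
        (Nat.cast_le.2 (Nat.lt_succ_iff.1 hk)).trans
          (Nat.floor_le (div_nonneg (by linarith [hpq.2.1]) hΔ0.le))
      rw [le_div_iff₀ hΔ0] at h1
      have : 0 ≤ (k : ℝ) * (δ n * Hm n / 2) := by positivity
      exact ⟨by linarith, by linarith⟩
    generalize P n + k * (δ n * Hm n / 2) = z at hz ⊢
    obtain ⟨hz0, hm0, heq⟩ := bandwidth_spec hs hL hσ hμ hn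
      (Icc_subset_Icc hpq.1 hpq.2.2 hz)
    have hzκ := hHn z hz
    set H := bandwidth s L σ μ n z
    have e2 : ballMass μ z H = σ ^ 2 * (Real.log n / n) / (L * H ^ s) ^ 2 := by
      rw [← heq]
      field_simp
    rw [e2, Real.div_rpow hδp.le (by positivity), hδγ]
    have h1 : (n : ℝ) ^ (2 * s * κ) ≤ 1 / (H ^ s) ^ 2 := by
      have : H ^ s ≤ (n : ℝ) ^ (-κ * s) := by
        rw [Real.rpow_mul hn0.le]
        gcongr
      rw [le_div_iff₀ (by positivity)]
      calc (n : ℝ) ^ (2 * s * κ) * (H ^ s) ^ 2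
          ≤ (n : ℝ) ^ (2 * s * κ) * ((n : ℝ) ^ (-κ * s)) ^ 2 := by gcongr
        _ = 1 := by
          rw [← Real.rpow_natCast, ← Real.rpow_mul hn0.le, ← Real.rpow_add hn0]
          convert Real.rpow_zero (n : ℝ) using 2
          push_cast
          ring
    have h2 : 1 ≤ η n ^ (1 / 2 : ℝ) * Real.log n := by
      have h3 : η n ≤ η n ^ (1 / 2 : ℝ) := by
        conv_lhs => rw [← Real.rpow_one (η n)]
        exact Real.rpow_le_rpow_of_exponent_ge hηp hη1 (by norm_num)
      have h4 : η n * Real.log n = Λ n := by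
        simp only [hη]
        field_simp
      calc 1 ≤ η n * Real.log n := by rw [h4]; exact hΛ1
        _ ≤ _ := by gcongr
    have hHs : 0 < H ^ s := by positivity
    calc c₄ * (n : ℝ) ^ (2 * s * κ) ≤ c₄ * (1 / (H ^ s) ^ 2) := by gcongr
      _ ≤ c₄ * (1 / (H ^ s) ^ 2) * (η n ^ (1 / 2 : ℝ) * Real.log n) :=
          le_mul_of_one_le_right (by positivity) h2
      _ = _ := by
          rw [hc₄, Real.div_rpow zero_le_one (by positivity), Real.one_rpow]
          field_simp
  · have hhalf : ∀ᶠ n : ℕ in atTop, (n : ℝ) ^ (-κ) ≤ 1 / 2 :=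
      ((tendsto_rpow_neg_atTop hκ).comp hcast).eventually_le_const (by norm_num)
    filter_upwards [hbase, hPQ, hv, hmass, hH, hHm', hpoly, hcard, hhalf]
      with n hb hpq hvn hmn hHn hHmn hpn hcn hhn
    obtain ⟨hn, hl, hll, hlg, hHm0, hΛ1, hηp, hη1, hδp, hδ1, hδγ, hδl⟩ := hb
    exact isCellDesign_of_bandwidth hs hL hσ hμ hn hpq.1 hpq.2.1 hpq.2.2 hC₀ hvn hc₀ hmn hHm0 hHmn
      (fun x hx => (hHn x hx).trans hhn) hpn hδp hδ1 hΛ1 hcn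

/-! ### Subpolynomial sequences -/

/-- The sequence is eventually non-negative and grows more slowly than every power of `n`. -/
def IsSubpoly (y : ℕ → ℝ) : Prop := ∀ ε : ℝ, 0 < ε → ∀ᶠ n : ℕ in atTop, 0 ≤ y n ∧ y n ≤ (n : ℝ) ^ ε

namespace IsSubpoly

variable {y z : ℕ → ℝ}

theorem const {C : ℝ} (hC : 0 ≤ C) : IsSubpoly fun _ => C := by
  intro ε hε
  filter_upwards [((tendsto_rpow_atTop hε).comp
    (tendsto_natCast_atTop_atTop (R := ℝ))).eventually_ge_atTop C] with n hn
  exact ⟨hC, hn⟩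

theorem mono (hz : IsSubpoly z) (h : ∀ᶠ n in atTop, 0 ≤ y n ∧ y n ≤ z n) : IsSubpoly y := by
  intro ε hε
  filter_upwards [h, hz ε hε] with n h1 h2
  exact ⟨h1.1, h1.2.trans h2.2⟩

theorem mul (hy : IsSubpoly y) (hz : IsSubpoly z) : IsSubpoly fun n => y n * z n := by
  intro ε hε
  filter_upwards [hy (ε / 2) (by positivity), hz (ε / 2) (by positivity),
    eventually_ge_atTop 1] with n h1 h2 hn
  have hn0 : (0 : ℝ) < n := by exact_mod_cast hn
  refine ⟨mul_nonneg h1.1 h2.1, ?_⟩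
  calc y n * z n ≤ (n : ℝ) ^ (ε / 2) * (n : ℝ) ^ (ε / 2) :=
        mul_le_mul h1.2 h2.2 h2.1 (by positivity)
    _ = _ := by rw [← Real.rpow_add hn0, add_halves]

theorem add (hy : IsSubpoly y) (hz : IsSubpoly z) : IsSubpoly fun n => y n + z n := by
  intro ε hε
  filter_upwards [hy (ε / 2) (by positivity), hz (ε / 2) (by positivity),
    const (C := 2) (by norm_num) (ε / 2) (by positivity), eventually_ge_atTop 1]
    with n h1 h2 h3 hn
  have hn0 : (0 : ℝ) < n := by exact_mod_cast hn
  refine ⟨add_nonneg h1.1 h2.1, ?_⟩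
  calc y n + z n ≤ 2 * (n : ℝ) ^ (ε / 2) := by linarith [h1.2, h2.2]
    _ ≤ (n : ℝ) ^ (ε / 2) * (n : ℝ) ^ (ε / 2) := by
        gcongr
        exact h3.2
    _ = _ := by rw [← Real.rpow_add hn0, add_halves]

theorem rpow (hy : IsSubpoly y) {p : ℝ} (hp : 0 < p) : IsSubpoly fun n => y n ^ p := by
  intro ε hε
  filter_upwards [hy (ε / p) (by positivity)] with n h1
  refine ⟨Real.rpow_nonneg h1.1 p, (Real.rpow_le_rpow h1.1 h1.2 hp.le).trans_eq ?_⟩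
  rw [← Real.rpow_mul (Nat.cast_nonneg n)]
  congr 1
  field_simp

theorem log : IsSubpoly fun n => Real.log n := by
  intro ε hε
  filter_upwards [((isLittleO_log_rpow_atTop hε).comp_tendsto
    (tendsto_natCast_atTop_atTop (R := ℝ))).bound one_pos, eventually_ge_atTop 1] with n h1 hn
  have h2 : 0 ≤ Real.log n := Real.log_nonneg (by exact_mod_cast hn)
  simp only [Function.comp, Real.norm_eq_abs, one_mul] at h1
  rw [abs_of_nonneg h2, abs_of_nonneg (by positivity)] at h1
  exact ⟨h2, h1⟩

theorem of_isLittleO_log (h0 : ∀ n, 0 < y n)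
    (h : (fun n => Real.log (y n)) =o[atTop] fun n : ℕ => Real.log n) : IsSubpoly y := by
  intro ε hε
  filter_upwards [h.bound hε, eventually_ge_atTop 1] with n h1 hn
  have hn0 : (0 : ℝ) < n := by exact_mod_cast hn
  have h2 : 0 ≤ Real.log n := Real.log_nonneg (by exact_mod_cast hn)
  rw [Real.norm_eq_abs, Real.norm_eq_abs, abs_of_nonneg h2] at h1
  refine ⟨(h0 n).le, (Real.log_le_log_iff (h0 n) (by positivity)).1 ?_⟩
  rw [Real.log_rpow hn0]
  exact (le_abs_self _).trans h1

theorem isLittleO_log_one_add (hy : IsSubpoly y) :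
    (fun n => Real.log (1 + y n)) =o[atTop] fun n : ℕ => Real.log n := by
  refine isLittleO_iff.2 fun ε hε => ?_
  filter_upwards [((const zero_le_one).add hy) ε hε, hy ε hε, eventually_ge_atTop 1]
    with n h1 h2 hn
  have hn0 : (0 : ℝ) < n := by exact_mod_cast hn
  rw [Real.norm_eq_abs, Real.norm_eq_abs, abs_of_nonneg (Real.log_nonneg (by linarith [h2.1])),
    abs_of_nonneg (Real.log_nonneg (by exact_mod_cast hn)), ← Real.log_rpow hn0]
  exact Real.log_le_log (by linarith [h2.1]) h1.2

theorem div_rpow_le (hy : IsSubpoly y) {e : ℝ} (he : 0 < e) :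
    ∀ᶠ n : ℕ in atTop, (y n / n) ^ e ≤ (n : ℝ) ^ (-(e / 2)) := by
  filter_upwards [hy (1 / 2) (by norm_num), eventually_ge_atTop 1] with n h1 hn
  have hn0 : (0 : ℝ) < n := by exact_mod_cast hn
  calc (y n / n) ^ e ≤ ((n : ℝ) ^ (1 / 2 : ℝ) / n) ^ e := by
        refine Real.rpow_le_rpow (div_nonneg h1.1 hn0.le) ?_ he.le
        gcongr
        exact h1.2
    _ = _ := by
        rw [show (n : ℝ) ^ (1 / 2 : ℝ) / n = (n : ℝ) ^ (-(1 / 2) : ℝ) by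
          rw [div_eq_iff hn0.ne', ← Real.rpow_add_one hn0.ne']
          norm_num, ← Real.rpow_mul hn0.le]
        congr 1
        ring

theorem tendsto_div_rpow (hy : IsSubpoly y) {e : ℝ} (he : 0 < e) :
    Tendsto (fun n : ℕ => (y n / n) ^ e) atTop (𝓝 0) := by
  refine squeeze_zero' ?_ (hy.div_rpow_le he)
    ((tendsto_rpow_neg_atTop (half_pos he)).comp (tendsto_natCast_atTop_atTop (R := ℝ)))
  filter_upwards [hy 1 one_pos] with n h1
  exact Real.rpow_nonneg (div_nonneg h1.1 (Nat.cast_nonneg n)) _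

end IsSubpoly

/-! ### Masses of intervals -/

section mass

variable {s L σ : ℝ} {μ : ℝ → ℝ}

theorem mul_sub_le_designLaw (hμ : IsDesignDensity μ) {p q c : ℝ} (hp : 0 ≤ p) (hq : q ≤ 1)
    (hc : 0 ≤ c) (h : ∀ y ∈ Icc p q, c ≤ μ y) : c * (q - p) ≤ (designLaw μ).real (Icc p q) := by
  have := isProbabilityMeasure_designLaw hμ
  rw [measureReal_def, ← ENNReal.ofReal_le_iff_le_toReal (measure_ne_top _ _), designLaw,
    withDensity_apply _ measurableSet_Icc, Measure.restrict_restrict measurableSet_Icc,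
    inter_eq_left.2 (Icc_subset_Icc hp hq), ENNReal.ofReal_mul hc, ← Real.volume_Icc,
    ← setLIntegral_const]
  exact setLIntegral_mono' measurableSet_Icc fun y hy => ENNReal.ofReal_le_ofReal (h y hy)

theorem designLaw_le_mul_sub {M : ℝ} (hM : ∀ x ∈ Icc (0 : ℝ) 1, μ x ≤ M) (hM0 : 0 ≤ M)
    {p q : ℝ} (hpq : p ≤ q) : (designLaw μ).real (Icc p q) ≤ M * (q - p) := by
  have h0 : 0 ≤ M * (q - p) := mul_nonneg hM0 (by linarith)
  refine ENNReal.toReal_le_of_le_ofReal h0 ?_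
  rw [designLaw, withDensity_apply _ measurableSet_Icc,
    Measure.restrict_restrict measurableSet_Icc]
  calc ∫⁻ y in Icc p q ∩ Icc 0 1, ENNReal.ofReal (μ y)
      ≤ ∫⁻ _ in Icc p q ∩ Icc 0 1, ENNReal.ofReal M :=
        setLIntegral_mono' (measurableSet_Icc.inter measurableSet_Icc) fun y hy =>
          ENNReal.ofReal_le_ofReal (hM y hy.2)
    _ ≤ ∫⁻ _ in Icc p q, ENNReal.ofReal M := lintegral_mono_set inter_subset_left
    _ = _ := by rw [setLIntegral_const, Real.volume_Icc, ENNReal.ofReal_mul hM0]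

theorem mul_le_ballMass (hμ : IsDesignDensity μ) {m : ℝ} (hm : 0 ≤ m)
    (h : ∀ x ∈ Icc (0 : ℝ) 1, m ≤ μ x) {x t : ℝ} (hx : x ∈ Icc (0 : ℝ) 1) (ht : 0 ≤ t)
    (ht' : t ≤ 1 / 2) : m * t ≤ ballMass μ x t := by
  have := isProbabilityMeasure_designLaw hμ
  rcases le_total x (1 / 2) with hx2 | hx2
  · have h1 : m * (x + t - x) ≤ _ := mul_sub_le_designLaw (p := x) (q := x + t) hμ hx.1
      (by linarith) hm fun y hy => h y ⟨by linarith [hy.1, hx.1], by linarith [hy.2]⟩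
    rw [add_sub_cancel_left] at h1
    exact h1.trans (measureReal_mono (Icc_subset_Icc (by linarith) le_rfl))
  · have h1 : m * (x - (x - t)) ≤ _ := mul_sub_le_designLaw (p := x - t) (q := x) hμ
      (by linarith) hx.2 hm fun y hy => h y ⟨by linarith [hy.1], by linarith [hy.2, hx.2]⟩
    rw [sub_sub_cancel] at h1
    exact h1.trans (measureReal_mono (Icc_subset_Icc le_rfl (by linarith)))

/-- The explicit solution of the bandwidth equation for a mass function `A h ^ γ`. -/
theorem sq_mul_critical_radius (hs : 0 < s) (hL : 0 < L) {A γ τ : ℝ} (hA : 0 < A) (hγ : 0 < γ)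
    (hτ : 0 < τ) (hσ : 0 < σ) :
    (L * ((σ ^ 2 / (L ^ 2 * A) * τ) ^ (1 / (2 * s + γ))) ^ s) ^ 2
      * (A * ((σ ^ 2 / (L ^ 2 * A) * τ) ^ (1 / (2 * s + γ))) ^ γ) = σ ^ 2 * τ := by
  set B := σ ^ 2 / (L ^ 2 * A) * τ with hB
  have hB0 : 0 < B := by positivity
  set u := B ^ (1 / (2 * s + γ)) with hu
  have hu0 : 0 < u := by positivity
  have h1 : (u ^ s) ^ 2 * u ^ γ = B := by
    rw [← Real.rpow_natCast, ← Real.rpow_mul hu0.le, ← Real.rpow_add hu0, hu,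
      ← Real.rpow_mul hB0.le]
    convert Real.rpow_one B using 2
    push_cast
    field_simp
  calc (L * u ^ s) ^ 2 * (A * u ^ γ) = L ^ 2 * A * ((u ^ s) ^ 2 * u ^ γ) := by ring
    _ = _ := by
      rw [h1, hB]
      field_simp

end mass

/-! ### Designs with a density bounded away from zero -/

section regular

variable {s L σ : ℝ} {μ : ℝ → ℝ}

/-- Comparison of the mass of a ball of radius `t` with multiples of `t`. -/
theorem exists_bandwidth_bounds (hs : 0 < s) (hL : 0 < L) (hσ : 0 < σ) (hμ : IsDesignDensity μ)
    {M : ℝ} (hM0 : 0 < M) (hM : ∀ x ∈ Icc (0 : ℝ) 1, μ x ≤ M) {m : ℝ} (hm : 0 < m)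
    (h : ∀ x ∈ Icc (0 : ℝ) 1, m ≤ μ x) :
    ∃ c C : ℝ, 0 < c ∧ 0 < C ∧ ∀ᶠ n : ℕ in atTop, ∀ x ∈ Icc (0 : ℝ) 1,
      c * (Real.log n / n) ^ (1 / (2 * s + 1)) ≤ bandwidth s L σ μ n x ∧
      bandwidth s L σ μ n x ≤ C * (Real.log n / n) ^ (1 / (2 * s + 1)) := by
  have he : 0 < 1 / (2 * s + 1) := by positivity
  refine ⟨(σ ^ 2 / (L ^ 2 * (2 * M))) ^ (1 / (2 * s + 1)),
    (σ ^ 2 / (L ^ 2 * m)) ^ (1 / (2 * s + 1)), by positivity, by positivity, ?_⟩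
  have ht := (IsSubpoly.log.tendsto_div_rpow he).const_mul
    ((σ ^ 2 / (L ^ 2 * m)) ^ (1 / (2 * s + 1)))
  rw [mul_zero] at ht
  filter_upwards [eventually_ge_atTop 2, ht.eventually_le_const (u := 1 / 2) (by norm_num)]
    with n hn hn2 x hx
  have hn0 : (0 : ℝ) < n := by positivity
  have hlog : 0 < Real.log n := Real.log_pos (by exact_mod_cast hn)
  have hτ : 0 < Real.log n / n := by positivity
  rw [← Real.mul_rpow (by positivity) hτ.le] at hn2 ⊢
  rw [← Real.mul_rpow (by positivity) hτ.le]
  constructor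
  · refine le_bandwidth hs hL hσ hμ hn hx ?_
    rw [← sq_mul_critical_radius hs hL (by positivity : 0 < 2 * M) one_pos hτ hσ]
    gcongr
    have hu : 0 ≤ (σ ^ 2 / (L ^ 2 * (2 * M)) * (Real.log n / n)) ^ (1 / (2 * s + 1)) := by
      positivity
    refine (designLaw_le_mul_sub hM hM0.le (by linarith)).trans_eq ?_
    rw [Real.rpow_one]
    ring
  · refine bandwidth_le hs hL hσ hμ hn hx (by positivity) ?_
    rw [← sq_mul_critical_radius hs hL hm one_pos hτ hσ]
    gcongr
    rw [Real.rpow_one]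
    exact mul_le_ballMass hμ hm.le h hx (by positivity) hn2

theorem exists_rate_bounds (hs : 0 < s) (hL : 0 < L) (hσ : 0 < σ) (hμ : IsDesignDensity μ)
    {M : ℝ} (hM0 : 0 < M) (hM : ∀ x ∈ Icc (0 : ℝ) 1, μ x ≤ M) {m : ℝ} (hm : 0 < m)
    (h : ∀ x ∈ Icc (0 : ℝ) 1, m ≤ μ x) :
    ∃ c C : ℝ, 0 < c ∧ 0 < C ∧ ∀ᶠ n : ℕ in atTop, ∀ x ∈ Icc (0 : ℝ) 1,
      c * (Real.log n / n) ^ (s / (2 * s + 1)) ≤ rate s L σ μ n x ∧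
      rate s L σ μ n x ≤ C * (Real.log n / n) ^ (s / (2 * s + 1)) := by
  obtain ⟨c, C, hc, hC, hcC⟩ := exists_bandwidth_bounds hs hL hσ hμ hM0 hM hm h
  refine ⟨L * c ^ s, L * C ^ s, by positivity, by positivity, ?_⟩
  filter_upwards [hcC, eventually_ge_atTop 2] with n hn hn2 x hx
  have hn0 : (0 : ℝ) < n := by positivity
  have hlog : 0 < Real.log n := Real.log_pos (by exact_mod_cast hn2)
  have hτ : 0 < Real.log n / n := by positivity
  have e1 : ∀ a : ℝ, 0 < a → L * a ^ s * (Real.log n / n) ^ (s / (2 * s + 1))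
      = L * (a * (Real.log n / n) ^ (1 / (2 * s + 1))) ^ s := by
    intro a ha
    rw [Real.mul_rpow ha.le (by positivity), ← Real.rpow_mul hτ.le, one_div_mul_eq_div, mul_assoc]
  have h0 := (bandwidth_spec hs hL hσ hμ hn2 hx).1
  obtain ⟨h1, h2⟩ := hn x hx
  rw [e1 c hc, e1 C hC, rate]
  constructor <;> gcongr

theorem exists_estimator_of_le_density (hs : 0 < s) (hL : 0 < L) (hσ : 0 < σ)
    (hμ : IsDesignDensity μ) {M : ℝ} (hM0 : 0 < M) (hM : ∀ x ∈ Icc (0 : ℝ) 1, μ x ≤ M)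
    {m : ℝ} (hm : 0 < m) (h : ∀ x ∈ Icc (0 : ℝ) 1, m ≤ μ x) {ell : ℕ → ℝ}
    (hell : IsSubpoly ell) {p q : ℕ → ℝ} (hpq : ∀ n, 0 ≤ p n ∧ p n ≤ q n ∧ q n ≤ 1)
    (hlen : (fun n => q n - p n) ~[atTop] (fun n : ℕ => (ell n / n) ^ (1 / (1 + 2 * s)))) :
    ∃ F : Estimator, ∀ w : ℝ → ℝ, IsLoss w →
      Tendsto (fun n : ℕ => maxRisk s L σ μ w F n (Icc (p n) (q n))
        fun _ => (n / Real.log n) ^ (s / (2 * s + 1))) atTop (𝓝 0) := by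
  obtain ⟨c, C, hc, hC, hcC⟩ := exists_bandwidth_bounds hs hL hσ hμ hM0 hM hm h
  obtain ⟨c', C', hc', hC', hcC'⟩ := exists_rate_bounds hs hL hσ hμ hM0 hM hm h
  have he : 0 < 1 / (2 * s + 1) := by positivity
  have hsub : ∀ n, Icc (p n) (q n) ⊆ Icc 0 1 := fun n => Icc_subset_Icc (hpq n).1 (hpq n).2.2
  have hlogt : ∀ᶠ n : ℕ in atTop, 1 ≤ Real.log n :=
    (Real.tendsto_log_atTop.comp (tendsto_natCast_atTop_atTop (R := ℝ))).eventually_ge_atTop 1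
  refine exists_estimator_of_bandwidth hs hL hσ hμ hM (Eventually.of_forall hpq)
    (v := fun n _ => (n / Real.log n) ^ (s / (2 * s + 1))) hC' ?_ le_rfl
    (c₀ := m / (2 * M)) (by positivity) ?_ (κ := 1 / (2 * s + 1) / 2) (by positivity) ?_
    (Hm := fun n => c * (Real.log n / n) ^ (1 / (2 * s + 1)))
    (p₀ := 1 + 1 / (2 * s + 1)) ?_ ?_ ?_
  · filter_upwards [hcC', eventually_ge_atTop 2] with n hn hn2 x hx
    have hn0 : (0 : ℝ) < n := by positivity
    have hlog : 0 < Real.log n := Real.log_pos (by exact_mod_cast hn2)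
    have h0 := (bandwidth_spec hs hL hσ hμ hn2 (hsub n hx)).1
    have h1 : 0 < rate s L σ μ n x := by
      rw [rate]
      positivity
    refine ⟨by positivity, ?_⟩
    rw [← inv_div, Real.inv_rpow (by positivity), ← div_eq_mul_inv, le_div_iff₀ h1,
      inv_mul_le_iff₀ (by positivity), mul_comm]
    exact (hn x (hsub n hx)).2
  · filter_upwards [eventually_ge_atTop 2] with n hn x hx d hd hd1 b hb hb1 _ _
    have h0 := (bandwidth_spec hs hL hσ hμ hn (hsub n hx)).1
    have h1 : m * (b + d * bandwidth s L σ μ n x - b) ≤ _ := mul_sub_le_designLaw hμ hb hb1 hm.le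
      fun y hy => h y ⟨hb.trans hy.1, hy.2.trans hb1⟩
    refine le_trans ?_ h1
    rw [Real.rpow_one]
    calc m / (2 * M) * d * ballMass μ x (bandwidth s L σ μ n x)
        ≤ m / (2 * M) * d * (M * (x + bandwidth s L σ μ n x - (x - bandwidth s L σ μ n x))) := by
          gcongr
          exact designLaw_le_mul_sub hM hM0.le (by linarith)
      _ = _ := by
          field_simp
          ring
  · have h1 : IsSubpoly fun n : ℕ => C ^ (2 * s + 1) * Real.log n :=
      (IsSubpoly.const (by positivity)).mul IsSubpoly.log
    filter_upwards [hcC, h1.div_rpow_le he, eventually_ge_atTop 2] with n hn hn1 hn2 x hx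
    have hlog : 0 < Real.log n := Real.log_pos (by exact_mod_cast hn2)
    refine (hn x (hsub n hx)).2.trans (le_of_eq_of_le ?_ hn1)
    rw [mul_div_assoc, Real.mul_rpow (by positivity) (by positivity), ← Real.rpow_mul hC.le,
      mul_one_div_cancel (by positivity), Real.rpow_one]
  · filter_upwards [IsSubpoly.const (inv_nonneg.2 hc.le) 1 one_pos, hlogt,
      eventually_ge_atTop 1] with n h1 h2 hn
    have hn0 : (0 : ℝ) < n := by exact_mod_cast hn
    rw [neg_add, Real.rpow_add hn0]
    gcongr
    · rw [Real.rpow_neg hn0.le]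
      exact inv_le_of_inv_le₀ hc h1.2
    · rw [Real.rpow_neg hn0.le, ← Real.inv_rpow hn0.le, inv_eq_one_div]
      gcongr
  · filter_upwards [hcC] with n hn x hx
    exact (hn x (hsub n hx)).1
  · obtain ⟨K, hK, hKb⟩ := hlen.isBigO.exists_pos
    have h1 : IsSubpoly fun n => K / c * ell n ^ (1 / (2 * s + 1)) :=
      (IsSubpoly.const (by positivity)).mul (hell.rpow he)
    refine (h1.mono ?_).isLittleO_log_one_add
    filter_upwards [hKb.bound, hlogt, eventually_ge_atTop 1, hell 1 one_pos]
      with n h2 h3 hn h4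
    have hn0 : (0 : ℝ) < n := by exact_mod_cast hn
    have h5 : 0 ≤ q n - p n := sub_nonneg.2 (hpq n).2.1
    have h6 := h4.1
    have h7 : 0 < Real.log n := by linarith
    have h8 : 0 < (Real.log n / n) ^ (1 / (2 * s + 1)) := by positivity
    refine ⟨by positivity, ?_⟩
    rw [Real.norm_eq_abs, Real.norm_eq_abs, abs_of_nonneg h5, abs_of_nonneg (by positivity),
      add_comm 1] at h2
    rw [div_le_iff₀ (by positivity)]
    calc q n - p n ≤ K * (ell n / n) ^ (1 / (2 * s + 1)) := h2
      _ = K * (ell n ^ (1 / (2 * s + 1)) * (1 / n) ^ (1 / (2 * s + 1))) := by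
          rw [← Real.mul_rpow h6 (by positivity), mul_one_div]
      _ ≤ K * (ell n ^ (1 / (2 * s + 1)) * (Real.log n / n) ^ (1 / (2 * s + 1))) := by
          gcongr
      _ = _ := by
          field_simp

end regular

/-! ### Designs with a zero of the density -/

section vanishing

variable {s L σ : ℝ} {μ : ℝ → ℝ} {x₀ β g₀ c : ℝ}

theorem ballMass_le_of_vanishing (hμ : IsDesignDensity μ)
    (hball : ∀ h, 0 < h → h ≤ g₀ → ballMass μ x₀ h = h ^ (β + 1)) {x t : ℝ} (ht : 0 < t)
    (hg : |x - x₀| + t ≤ g₀) : ballMass μ x t ≤ (|x - x₀| + t) ^ (β + 1) := by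
  have h0 := abs_nonneg (x - x₀)
  rw [← hball _ (by positivity) hg]
  have h1 := le_abs_self (x - x₀)
  have h2 := neg_abs_le (x - x₀)
  exact ballMass_mono hμ (by linarith) (by linarith)

/-- Away from the zero of the density, the mass of an interval is bounded by the difference of the
masses of two balls centred at the zero. -/
theorem ballMass_le_of_lt_abs_sub (hμ : IsDesignDensity μ) (hβ : 0 ≤ β)
    (hball : ∀ h, 0 < h → h ≤ g₀ → ballMass μ x₀ h = h ^ (β + 1)) {x t : ℝ} (ht : 0 < t)
    (htx : t < |x - x₀|) (hg : |x - x₀| + t ≤ g₀) :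
    ballMass μ x t ≤ 2 * (β + 1) * t * (|x - x₀| + t) ^ β := by
  have := isProbabilityMeasure_designLaw hμ
  have hac : designLaw μ ≪ volume :=
    (withDensity_absolutelyContinuous _ _).trans Measure.absolutelyContinuous_restrict
  set d := |x - x₀| with hd
  have h1 : ballMass μ x t + ballMass μ x₀ (d - t) ≤ ballMass μ x₀ (d + t) := by
    have hdisj : AEDisjoint (designLaw μ) (Icc (x - t) (x + t))
        (Icc (x₀ - (d - t)) (x₀ + (d - t))) := by
      have hsub : Icc (x - t) (x + t) ∩ Icc (x₀ - (d - t)) (x₀ + (d - t))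
          ⊆ {x - t, x + t} := by
        rintro y ⟨⟨hy1, hy2⟩, hy3, hy4⟩
        rcases abs_cases (x - x₀) with ⟨h, -⟩ | ⟨h, -⟩
        · left
          linarith
        · right
          rw [mem_singleton_iff]
          linarith
      exact measure_mono_null hsub (hac ((Set.toFinite _).measure_zero _))
    rw [ballMass, ballMass, ← measureReal_union₀ measurableSet_Icc.nullMeasurableSet hdisj]
    have h2 := le_abs_self (x - x₀)
    have h3 := neg_abs_le (x - x₀)
    exact measureReal_mono (union_subset (Icc_subset_Icc (by linarith) (by linarith))
      (Icc_subset_Icc (by linarith) (by linarith)))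
  rw [hball _ (by linarith) (by linarith), hball _ (by linarith) hg] at h1
  have hs0 : 0 < d + t := by linarith
  have h2 : 1 + (β + 1) * (-(2 * t / (d + t))) ≤ (1 + -(2 * t / (d + t))) ^ (β + 1) := by
    refine one_add_mul_self_le_rpow_one_add ?_ (by linarith)
    rw [neg_le_neg_iff, div_le_one hs0]
    linarith
  rw [show 1 + -(2 * t / (d + t)) = (d - t) / (d + t) by field_simp; ring,
    Real.div_rpow (by linarith) hs0.le, le_div_iff₀ (by positivity)] at h2
  have h3 : (d + t) ^ (β + 1) = (d + t) ^ β * (d + t) := Real.rpow_add_one hs0.ne' β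
  have h4 : (1 + (β + 1) * -(2 * t / (d + t))) * (d + t) ^ (β + 1)
      = (d + t) ^ (β + 1) - 2 * (β + 1) * t * (d + t) ^ β := by
    rw [h3]
    field_simp
    ring
  linarith

/-- Near the zero of the density, a subinterval of relative length `δ` carries at least the
fraction `δ ^ (β + 1)` of the mass of an interval, up to a constant. -/
theorem exists_mul_rpow_mul_ballMass_le (hμ : IsDesignDensity μ) (hβ : 0 ≤ β)
    (hball : ∀ h, 0 < h → h ≤ g₀ → ballMass μ x₀ h = h ^ (β + 1)) (hc : 0 < c)
    (hlow : ∀ y ∈ Icc (0 : ℝ) 1, y ≠ x₀ → |y - x₀| ≤ g₀ → c * |y - x₀| ^ β ≤ μ y) :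
    ∃ c₀ : ℝ, 0 < c₀ ∧ ∀ x t, 0 < t → |x - x₀| + t ≤ g₀ → ∀ δ, 0 < δ → δ ≤ 1 → ∀ b, 0 ≤ b →
      b + δ * t ≤ 1 → x - t ≤ b → b + δ * t ≤ x + t →
      c₀ * δ ^ (β + 1) * ballMass μ x t ≤ (designLaw μ).real (Icc b (b + δ * t)) := by
  have := isProbabilityMeasure_designLaw hμ
  refine ⟨min (c / 12 ^ (β + 1)) (c / (3 ^ β * (2 * (β + 1)))), by positivity, ?_⟩
  intro x t ht hg δ hδ hδ1 b hb hb1 hbx hbx'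
  have hδt : 0 < δ * t := by positivity
  have hδt1 : δ * t ≤ t := mul_le_of_le_one_left ht.le hδ1
  set d := |x - x₀| with hd
  have hd0 : 0 ≤ d := abs_nonneg _
  have hm0 := ballMass_nonneg μ x t
  have hd1 := le_abs_self (x - x₀)
  have hd2 := neg_abs_le (x - x₀)
  have hJ : ∀ y ∈ Icc b (b + δ * t), |y - x₀| ≤ g₀ := fun y hy =>
    abs_le.2 ⟨by linarith [hy.1], by linarith [hy.2]⟩
  -- lower bounds of the density on subintervals at distance `e` from the zero
  have key : ∀ e p q, 0 < e → b ≤ p → q ≤ b + δ * t → (∀ y ∈ Icc p q, e ≤ |y - x₀|) →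
      c * e ^ β * (q - p) ≤ (designLaw μ).real (Icc b (b + δ * t)) := by
    intro e p q he hp hq hy
    refine le_trans (mul_sub_le_designLaw hμ (hb.trans hp) (hq.trans hb1) (by positivity) ?_)
      (measureReal_mono (Icc_subset_Icc hp hq))
    intro y hyJ
    have h1 := hy y hyJ
    refine le_trans ?_ (hlow y ⟨by linarith [hyJ.1], by linarith [hyJ.2]⟩ ?_
      (hJ y ⟨hp.trans hyJ.1, hyJ.2.trans hq⟩))
    · gcongr
    · rintro rfl
      rw [sub_self, abs_zero] at h1
      linarith
  rcases lt_or_ge d (2 * t) with hdt | hdt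
  · have h1 : c * (δ * t / 4) ^ β * (δ * t / 4)
        ≤ (designLaw μ).real (Icc b (b + δ * t)) := by
      -- one of the two outer quarters of the interval is far from the zero
      rcases le_total x₀ (b + δ * t / 2) with hx0 | hx0
      · have := key (δ * t / 4) (b + δ * t * 3 / 4) (b + δ * t) (by positivity) (by linarith) le_rfl
          fun y hy => le_trans (by linarith [hy.1]) (le_abs_self _)
        convert this using 2
        ring
      · have := key (δ * t / 4) b (b + δ * t / 4) (by positivity) le_rfl (by linarith)
          fun y hy => le_trans (by linarith [hy.2]) (neg_le_abs _)
        convert this using 2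
        ring
    calc _ ≤ c / 12 ^ (β + 1) * δ ^ (β + 1) * (3 * t) ^ (β + 1) := by
          gcongr
          · exact min_le_left _ _
          · refine (ballMass_le_of_vanishing hμ hball ht hg).trans ?_
            gcongr
            linarith
      _ = c * ((δ * t / 4) ^ (β + 1)) := by
          rw [mul_assoc, ← Real.mul_rpow (by positivity) (by positivity), div_mul_eq_mul_div,
            mul_div_assoc, ← Real.div_rpow (by positivity) (by positivity)]
          congr 2
          ring
      _ ≤ _ := by rwa [Real.rpow_add_one (by positivity), ← mul_assoc]
  · have h1 : c * ((d + t) / 3) ^ β * (b + δ * t - b)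
        ≤ (designLaw μ).real (Icc b (b + δ * t)) := by
      refine key _ b (b + δ * t) (by positivity) le_rfl le_rfl fun y hy => ?_
      have h2 : d ≤ |y - x₀| + |x - y| := by
        rw [add_comm]
        exact abs_sub_le x y x₀
      have h3 : |x - y| ≤ t := abs_le.2 ⟨by linarith [hy.2], by linarith [hy.1]⟩
      linarith
    have h2 := ballMass_le_of_lt_abs_sub hμ hβ hball ht (by linarith) hg
    have h3 : δ ^ (β + 1) ≤ δ := by
      conv_rhs => rw [← Real.rpow_one δ]
      exact Real.rpow_le_rpow_of_exponent_ge hδ hδ1 (by linarith)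
    calc _ ≤ c / (3 ^ β * (2 * (β + 1))) * δ * (2 * (β + 1) * t * (d + t) ^ β) := by
          gcongr
          exact min_le_right _ _
      _ = c * ((d + t) / 3) ^ β * (b + δ * t - b) := by
          rw [Real.div_rpow (by positivity) (by norm_num)]
          field_simp
          ring
      _ ≤ _ := h1

/-- The bandwidths near the zero `x₀` of the density and the length of the interval agree up to
subpolynomial factors, so that `exists_estimator_of_bandwidth` applies. -/
theorem exists_estimator_of_vanishing (hs : 0 < s) (hL : 0 < L) (hσ : 0 < σ)
    (hμ : IsDesignDensity μ) {M : ℝ} (hM : ∀ x ∈ Icc (0 : ℝ) 1, μ x ≤ M) {ell : ℕ → ℝ}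
    (hell0 : ∀ n, 0 < ell n) (hell : IsSubpoly ell) (hx₀ : x₀ ∈ Icc (0 : ℝ) 1) (hβ : 0 ≤ β)
    (hg₀ : 0 < g₀) (hball : ∀ h, 0 < h → h ≤ g₀ → ballMass μ x₀ h = h ^ (β + 1)) (hc : 0 < c)
    (hlow : ∀ y ∈ Icc (0 : ℝ) 1, y ≠ x₀ → |y - x₀| ≤ g₀ → c * |y - x₀| ^ β ≤ μ y) :
    ∃ F : Estimator, ∀ w : ℝ → ℝ, IsLoss w →
      Tendsto (fun n : ℕ => maxRisk s L σ μ w F n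
        (Icc (x₀ - (ell n / n) ^ (1 / (1 + 2 * s + β)))
          (x₀ + (ell n / n) ^ (1 / (1 + 2 * s + β))) ∩ Icc 0 1)
        fun x => (rate s L σ μ n x)⁻¹) atTop (𝓝 0) := by
  obtain ⟨c₀, hc₀, hmass⟩ := exists_mul_rpow_mul_ballMass_le hμ hβ hball hc hlow
  have hγ0 : 0 < β + 1 := by linarith
  set e : ℝ := 1 / (1 + 2 * s + β) with he
  have he' : e = 1 / (2 * s + (β + 1)) := by
    rw [he]
    ring_nf
  have he0 : 0 < e := by positivity
  set D : ℕ → ℝ := fun n => (ell n / n) ^ e with hD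
  -- the bandwidth at `x₀` is `(κ₁ log n / n) ^ e`
  set κ₁ : ℝ := σ ^ 2 / (L ^ 2 * 1) with hκ₁
  -- `B` dominates the radius `D` of the interval as well as the bandwidth at its centre
  set B : ℕ → ℝ := fun n => ((1 + ell n) * Real.log n / n) ^ e with hB
  -- `ρ B` is a lower bound for the bandwidths
  set c₅ : ℝ := min 1 (σ ^ 2 / (L ^ 2 * 2 ^ (β + 1))) with hc₅
  have hc₅0 : 0 < c₅ := by positivity
  set ρ : ℕ → ℝ := fun n => (c₅ / (1 + ell n)) ^ (1 / (2 * s)) with hρ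
  have hsA : IsSubpoly fun n => 1 + ell n := (IsSubpoly.const zero_le_one).add hell
  have hsρ : IsSubpoly fun n => 2 * (ρ n)⁻¹ := by
    refine ((IsSubpoly.const zero_le_two).mul
      (((IsSubpoly.const (inv_nonneg.2 hc₅0.le)).mul hsA).rpow
        (p := 1 / (2 * s)) (by positivity))).mono (Eventually.of_forall fun n => ?_)
    have := hell0 n
    refine ⟨by positivity, le_of_eq ?_⟩
    simp only [hρ]
    rw [← Real.inv_rpow (by positivity), inv_div, div_eq_inv_mul]
  have hlogt : ∀ᶠ n : ℕ in atTop, 1 ≤ Real.log n :=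
    (Real.tendsto_log_atTop.comp (tendsto_natCast_atTop_atTop (R := ℝ))).eventually_ge_atTop 1
  -- an upper bound for the bandwidths
  have hsU : IsSubpoly fun n : ℕ => (2 : ℝ) ^ (1 / e) * ((κ₁ + 1) * ((1 + ell n) * Real.log n)) :=
    (IsSubpoly.const (by positivity)).mul
      ((IsSubpoly.const (by positivity)).mul (hsA.mul IsSubpoly.log))
  set U : ℕ → ℝ := fun n => 2 * ((κ₁ + 1) * ((1 + ell n) * Real.log n) / n) ^ e with hU
  have hUeq : ∀ n : ℕ, 1 ≤ n →
      ((2 : ℝ) ^ (1 / e) * ((κ₁ + 1) * ((1 + ell n) * Real.log n)) / n) ^ e = U n := by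
    intro n hn
    have := hell0 n
    have := Real.log_nonneg (x := n) (by exact_mod_cast hn)
    rw [mul_div_assoc, Real.mul_rpow (by positivity) (by positivity), ← Real.rpow_mul zero_le_two,
      one_div_mul_cancel he0.ne', Real.rpow_one]
  have hU0 : Tendsto U atTop (𝓝 0) := by
    refine (hsU.tendsto_div_rpow he0).congr' ?_
    filter_upwards [eventually_ge_atTop 1] with n hn using hUeq n hn
  have hev : ∀ᶠ n : ℕ in atTop, 2 ≤ n ∧ 1 ≤ Real.log n ∧ 0 < D n ∧ D n ≤ B n ∧ 0 < ρ n ∧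
      ρ n ≤ 1 ∧ 0 < B n ∧ 2 * B n ≤ g₀ ∧ D n + U n ≤ g₀ ∧
      (∀ x ∈ Icc (0 : ℝ) 1, |x - x₀| ≤ D n → bandwidth s L σ μ n x ≤ U n) := by
    filter_upwards [eventually_ge_atTop 2, hlogt, hU0.eventually_le_const (half_pos hg₀)]
      with n hn hl hUn
    have hn0 : (0 : ℝ) < n := by positivity
    have hl0 : 0 < Real.log n := by linarith
    have hen := hell0 n
    have hκ₁0 : 0 < κ₁ := by positivity
    have hDB : D n ≤ B n := by
      simp only [hD, hB]
      gcongr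
      nlinarith
    have hDp : 0 < D n := by positivity
    have hBp : 0 < B n := by positivity
    have hBU : 2 * B n ≤ U n := by
      have h1 : (1 + ell n) * Real.log n ≤ (κ₁ + 1) * ((1 + ell n) * Real.log n) :=
        le_mul_of_one_le_left (by positivity) (by linarith)
      exact mul_le_mul_of_nonneg_left (Real.rpow_le_rpow (by positivity)
        (div_le_div_of_nonneg_right h1 hn0.le) he0.le) zero_le_two
    refine ⟨hn, hl, hDp, hDB, by positivity, ?_, hBp, by linarith, by linarith, ?_⟩
    · refine Real.rpow_le_one (by positivity) ?_ (by positivity)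
      rw [div_le_one (by positivity)]
      exact (min_le_left _ _).trans (by linarith)
    · intro x hx hxD
      have h1 := bandwidth_le_add_abs_sub hs hL hσ hμ hn hx hx₀
      have hτ : 0 < Real.log n / n := by positivity
      have hcr := sq_mul_critical_radius hs hL one_pos hγ0 hτ hσ
      rw [← he'] at hcr
      have h2 : (κ₁ * (Real.log n / n)) ^ e ≤ U n / 2 := by
        simp only [hU]
        rw [mul_div_cancel_left₀ _ two_ne_zero, mul_div_assoc, mul_div_assoc]
        gcongr
        · linarith
        · exact le_mul_of_one_le_left (by positivity) (by linarith)
      have h3 : bandwidth s L σ μ n x₀ ≤ (κ₁ * (Real.log n / n)) ^ e := by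
        refine bandwidth_le hs hL hσ hμ hn hx₀ (by positivity) (le_of_eq ?_)
        rw [← hcr, hball _ (by positivity) (by linarith), one_mul]
      linarith
  have hDI : ∀ n, 0 ≤ D n → max (x₀ - D n) 0 ≤ min (x₀ + D n) 1 := by
    intro n hn
    have h1 := hx₀.1
    have h2 := hx₀.2
    exact max_le (le_min (by linarith) (by linarith)) (le_min (by linarith) (by linarith))
  have hmem : ∀ n, ∀ x ∈ Icc (max (x₀ - D n) 0) (min (x₀ + D n) 1),
      x ∈ Icc (0 : ℝ) 1 ∧ |x - x₀| ≤ D n := by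
    intro n x hx
    rw [← Icc_inter_Icc] at hx
    exact ⟨hx.2, abs_le.2 ⟨by linarith [hx.1.1], by linarith [hx.1.2]⟩⟩
  simp only [Icc_inter_Icc]
  refine exists_estimator_of_bandwidth hs hL hσ hμ hM
    (P := fun n => max (x₀ - D n) 0) (Q := fun n => min (x₀ + D n) 1)
    (v := fun n x => (rate s L σ μ n x)⁻¹) (γ := β + 1) ?_ one_pos ?_ (by linarith) hc₀ ?_
    (κ := e / 2) (by positivity) ?_ (Hm := fun n => ρ n * B n) (p₀ := 1 + e) ?_ ?_ ?_
  · filter_upwards [hev] with n h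
    exact ⟨le_max_right _ _, hDI n h.2.2.1.le, min_le_right _ _⟩
  · filter_upwards [hev] with n h x hx
    have h0 := (bandwidth_spec hs hL hσ hμ h.1 (hmem n x hx).1).1
    rw [one_mul, rate]
    exact ⟨by positivity, le_rfl⟩
  · filter_upwards [hev] with n h x hx δ hδ hδ1 b hb hb1 hb2 hb3
    obtain ⟨hn, hl, hD0, hDB, hρ0, hρ1, hB0, hBg, hDU, hbw⟩ := h
    obtain ⟨hx1, hx2⟩ := hmem n x hx
    exact hmass x _ (bandwidth_spec hs hL hσ hμ hn hx1).1
      (by linarith [hbw x hx1 hx2]) δ hδ hδ1 b hb hb1 hb2 hb3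
  · filter_upwards [hev, hsU.div_rpow_le he0] with n h h1 x hx
    obtain ⟨hn, hl, hD0, hDB, hρ0, hρ1, hB0, hBg, hDU, hbw⟩ := h
    rw [hUeq n (by omega)] at h1
    exact (hbw x (hmem n x hx).1 (hmem n x hx).2).trans h1
  · filter_upwards [hev, hsρ 1 one_pos] with n h h1
    obtain ⟨hn, hl, hD0, hDB, hρ0, hρ1, hB0, hBg, hDU, hbw⟩ := h
    have hn0 : (0 : ℝ) < n := by positivity
    have hen := hell0 n
    have h2 : 0 < (ρ n)⁻¹ := by positivity
    rw [neg_add, Real.rpow_add hn0]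
    gcongr
    · rw [Real.rpow_neg hn0.le]
      exact inv_le_of_inv_le₀ hρ0 (by linarith [h1.2])
    · simp only [hB]
      rw [Real.rpow_neg hn0.le, ← Real.inv_rpow hn0.le, inv_eq_one_div]
      gcongr
      nlinarith
  · filter_upwards [hev] with n h x hx
    obtain ⟨hn, hl, hD0, hDB, hρ0, hρ1, hB0, hBg, hDU, hbw⟩ := h
    obtain ⟨hx1, hx2⟩ := hmem n x hx
    have hn0 : (0 : ℝ) < n := by positivity
    have hen := hell0 n
    have hρB : ρ n * B n ≤ B n := mul_le_of_le_one_left hB0.le hρ1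
    refine le_bandwidth hs hL hσ hμ hn hx1 ?_
    have h1 : ballMass μ x (ρ n * B n) ≤ (2 * B n) ^ (β + 1) := by
      refine (ballMass_le_of_vanishing hμ hball (by positivity) (by linarith)).trans ?_
      have := abs_nonneg (x - x₀)
      gcongr
      linarith
    have h2 : (ρ n ^ s) ^ 2 = c₅ / (1 + ell n) := by
      simp only [hρ]
      rw [← Real.rpow_natCast, ← Real.rpow_mul (by positivity), ← Real.rpow_mul (by positivity)]
      convert Real.rpow_one _ using 2
      push_cast
      field_simp
    have h3 : (B n ^ s) ^ 2 * B n ^ (β + 1) = (1 + ell n) * Real.log n / n := by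
      rw [← Real.rpow_natCast, ← Real.rpow_mul hB0.le, ← Real.rpow_add hB0]
      simp only [hB]
      rw [← Real.rpow_mul (by positivity)]
      convert Real.rpow_one _ using 2
      rw [he']
      push_cast
      field_simp
    calc (L * (ρ n * B n) ^ s) ^ 2 * ballMass μ x (ρ n * B n)
        ≤ (L * (ρ n * B n) ^ s) ^ 2 * (2 * B n) ^ (β + 1) := by gcongr
      _ = L ^ 2 * 2 ^ (β + 1) * (ρ n ^ s) ^ 2 * ((B n ^ s) ^ 2 * B n ^ (β + 1)) := by
          rw [Real.mul_rpow hρ0.le hB0.le, Real.mul_rpow zero_le_two hB0.le]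
          ring
      _ = L ^ 2 * 2 ^ (β + 1) * c₅ * (Real.log n / n) := by
          rw [h2, h3]
          field_simp
      _ ≤ L ^ 2 * 2 ^ (β + 1) * (σ ^ 2 / (L ^ 2 * 2 ^ (β + 1))) * (Real.log n / n) := by
          gcongr
          exact min_le_right _ _
      _ = _ := by field_simp
  · refine (hsρ.mono ?_).isLittleO_log_one_add
    filter_upwards [hev] with n h
    obtain ⟨hn, hl, hD0, hDB, hρ0, hρ1, hB0, hBg, hDU, hbw⟩ := h
    refine ⟨div_nonneg (sub_nonneg.2 (hDI n hD0.le)) (by positivity), ?_⟩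
    rw [div_le_iff₀ (by positivity)]
    calc min (x₀ + D n) 1 - max (x₀ - D n) 0 ≤ (x₀ + D n) - (x₀ - D n) :=
          sub_le_sub (min_le_left _ _) (le_max_left _ _)
      _ ≤ 2 * B n := by linarith
      _ = _ := by field_simp

end vanishing

theorem proposition1 (s L σ : ℝ) (hs : 0 < s) (hL : 0 < L) (hσ : 0 < σ)
    (ell : ℕ → ℝ) (hell : ∀ n, 0 < ell n)
    (hlog : (fun n : ℕ => Real.log (ell n)) =o[atTop] fun n : ℕ => Real.log n)
    (μ : ℝ → ℝ) (hμ : IsDesignDensity μ) (hbdd : ∃ M : ℝ, ∀ x ∈ Icc (0 : ℝ) 1, μ x ≤ M) :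
    -- (a)
    ((∃ m : ℝ, 0 < m ∧ ∀ x ∈ Icc (0 : ℝ) 1, m ≤ μ x) →
      (∃ c C : ℝ, 0 < c ∧ 0 < C ∧ ∀ᶠ n : ℕ in atTop, ∀ x ∈ Icc (0 : ℝ) 1,
        c * (Real.log n / n) ^ (s / (2 * s + 1)) ≤ rate s L σ μ n x ∧
        rate s L σ μ n x ≤ C * (Real.log n / n) ^ (s / (2 * s + 1))) ∧
      (∃ c : ℝ, 0 < c ∧ ∀ p q : ℝ, 0 ≤ p → p ≤ q → q ≤ 1 →
        c * (q - p) ≤ (designLaw μ).real (Icc p q)) ∧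
      ∀ p q : ℕ → ℝ, (∀ n, 0 ≤ p n ∧ p n ≤ q n ∧ q n ≤ 1) →
        (fun n => q n - p n) ~[atTop] (fun n : ℕ => (ell n / n) ^ (1 / (1 + 2 * s))) →
        ∃ F : Estimator, ∀ w : ℝ → ℝ, IsLoss w →
          Tendsto (fun n : ℕ => maxRisk s L σ μ w F n (Icc (p n) (q n))
            fun _ => (n / Real.log n) ^ (s / (2 * s + 1))) atTop (𝓝 0)) ∧
    -- (b)
    (∀ x₀ ∈ Icc (0 : ℝ) 1, ∀ β : ℝ, 0 ≤ β → μ x₀ = 0 →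
      (∀ᶠ h in 𝓝[>] (0 : ℝ), (designLaw μ).real (Icc (x₀ - h) (x₀ + h)) = h ^ (β + 1)) →
      (∃ c : ℝ, 0 < c ∧ ∀ᶠ y in 𝓝[≠] x₀, y ∈ Icc (0 : ℝ) 1 → c * |y - x₀| ^ β ≤ μ y) →
      ∃ F : Estimator, ∀ w : ℝ → ℝ, IsLoss w →
        Tendsto (fun n : ℕ => maxRisk s L σ μ w F n
          (Icc (x₀ - (ell n / n) ^ (1 / (1 + 2 * s + β)))
            (x₀ + (ell n / n) ^ (1 / (1 + 2 * s + β))) ∩ Icc 0 1)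
          fun x => (rate s L σ μ n x)⁻¹) atTop (𝓝 0)) := by
  obtain ⟨M₀, hM₀⟩ := hbdd
  obtain ⟨M, hM0, hM⟩ : ∃ M : ℝ, 0 < M ∧ ∀ x ∈ Icc (0 : ℝ) 1, μ x ≤ M :=
    ⟨max M₀ 1, by positivity, fun x hx => (hM₀ x hx).trans (le_max_left _ _)⟩
  have hsub : IsSubpoly ell := IsSubpoly.of_isLittleO_log hell hlog
  refine ⟨fun ⟨m, hm, hmμ⟩ => ⟨exists_rate_bounds hs hL hσ hμ hM0 hM hm hmμ,
    ⟨m, hm, fun p q hp _ hq => mul_sub_le_designLaw hμ hp hq hm.le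
      fun y hy => hmμ y ⟨hp.trans hy.1, hy.2.trans hq⟩⟩,
    fun p q hpq hlen =>
      exists_estimator_of_le_density hs hL hσ hμ hM0 hM hm hmμ hsub hpq hlen⟩, ?_⟩
  intro x₀ hx₀ β hβ _ hball ⟨c, hc, hlow⟩
  obtain ⟨g₁, hg₁, hball⟩ := mem_nhdsGT_iff_exists_Ioc_subset.1 hball
  obtain ⟨g₂, hg₂, hlow⟩ := Metric.eventually_nhds_iff.1 (eventually_nhdsWithin_iff.1 hlow)
  have hg₁ : 0 < g₁ := hg₁
  refine exists_estimator_of_vanishing hs hL hσ hμ hM hell hsub hx₀ hβ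
    (g₀ := min g₁ (g₂ / 2)) (by positivity)
    (fun h h0 h1 => hball ⟨h0, h1.trans (min_le_left _ _)⟩) hc fun y hy hne hyg => ?_
  refine hlow ?_ hne hy
  rw [Real.dist_eq]
  linarith [min_le_right g₁ (g₂ / 2)]
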